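/- \textbf{Model.} A synchronous cognitive radio network has $n$ nodes with unique identities. Each node can access $c$ channels, which it addresses by its own local labels. Two nodes are neighbors iff they are within transmission range of each other and share at least one channel. Every pair of neighbors shares at least $k\ge 1$ and at most $k_{max}\le c$ channels, and the neighbor graph is connected with maximum degree $\Delta$. In each time slot a node broadcasts its identity on one of its channels, listens on one of its channels, or is idle. A node listening on a channel hears the identity of a neighbor iff exactly one of its neighbors broadcasts on this channel in this slot; otherwise it hears nothing (no collision detection). All nodes start simultaneously and use independent private randomness. Let $k\le\hat k\le c$. A \emph{good neighbor} of $u$ is a neighbor sharing at least $\hat k$ channels with $u$; $\Delta_{\hat k}$ is the maximum number of good neighbors of a node. The $\hat k$-neighbor-discovery problem asks every node to find (at least) the identities of all its good neighbors, reporting only identities of neighbors. Write $\lg=\log_2$ and $R=\max(1,\lceil\lg\Delta\rceil)$; let $a,A,B>0$ and $\delta\in(0,1)$ be constants. \textbf{Algorithm CKSeek} (with constants $\delta,a,A,B$). At the start of every step, in both parts, each node becomes broadcaster or listener with probability $1/2$ each. \emph{Part one} has $\lceil A\,(c^2/\hat k)\lg n\rceil$ steps, each with $R$ rounds of $L=\lceil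 a\lg n\rceil$ slots. In each step each node picks one of its channels uniformly at random. In every slot of round $i=1,\dots,R$, a broadcaster broadcasts its identity on its channel with probability $2^{-(i-1)}$ and is otherwise idle; a listener listens. If $i$ is the first round in which a listener heard messages in more than a $(1+\delta)\,8e^{-7}$ fraction of the slots, it obtains the count $2^{i+1}$ for its channel in this step; if there is no such round, the count is $0$. Let $x_{ch}$ be the sum of the counts obtained by the node for channel $ch$ in part one. \emph{Part two} has $\lceil B\,((k_{max}/\hat k)\Delta_{\hat k}+\Delta+c)\lg n\rceil$ steps of $R$ slots. A broadcaster picks one of its channels uniformly at random and broadcasts its identity on it in the $i$-th slot of the step with probability $2^{-(R-i+1)}$, $i=1,\dots,R$, being otherwise idle. A listener picks channel $ch$ with probability $x_{ch}/\sum_{ch'}x_{ch'}$ (it is idle in this step if all its counts are $0$) and listens on it in all slots of the step. At the end every node outputs the set of all identities it has heard in both parts. \textbf{Theorem.} There is $\delta_0\in(0,1)$ such that for every $\delta\in(0,\delta_0]$ and every $\alpha\ge 1$ there are constants $a,A,B,C>0$ such that for every network as above, of any size and with any parameters $n,c,k,k_{max}$, and every $\hat k$ with $k\le\hat k\le c$,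 the algorithm CKSeek with the constants $\delta,a,A,B$ uses at most $$C\left(\frac{c^2}{\hat k}\lg^3 n+\Big(\frac{k_{max}}{\hat k}\Delta_{\hat k}+\Delta\Big)\lg^2 n\right)$$ slots and, with probability at least $1-n^{-\alpha}$, solves the $\hat k$-neighbor-discovery problem (for all nodes simultaneously). -/

import Mathlib

open MeasureTheory

/-- A cognitive radio network on the node set `V` (a node is its own identity) over a set `Ch` of
physical channels: a symmetric "within transmission range" relation, and for every node `c`
available channels, which the node addresses through its own local labels `Fin c`. -/
structure Network (V : Type*) (Ch : Type*) (c : ℕ) where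
  inRange : SimpleGraph V
  chan : V → Fin c ↪ Ch

/-- What the radio of a node does in one slot; channels are given by local labels, and the message
of a broadcasting node is its identity. -/
inductive RadioAction (c : ℕ) where
  | broadcast (l : Fin c)
  | listen (l : Fin c)
  | idle

namespace Network

variable {V Ch : Type*} {c : ℕ} (N : Network V Ch c)

/-- The set of channels available to both `u` and `v`. -/
def shared (u v : V) : Set Ch := Set.range (N.chan u) ∩ Set.range (N.chan v)

/-- The number of channels that `u` and `v` share. -/
noncomputable def overlap (u v : V) : ℕ := (N.shared u v).ncard

/-- Two nodes are neighbors iff they are within range of each other and share some channel. -/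
def graph : SimpleGraph V where
  Adj u v := N.inRange.Adj u v ∧ (N.shared u v).Nonempty
  symm := ⟨fun u v h => ⟨h.1.symm, by
    have h2 := h.2
    rwa [shared, Set.inter_comm] at h2⟩⟩
  loopless := ⟨fun u h => N.inRange.loopless.irrefl u h.1⟩

/-- The good neighbors of `u`: those sharing at least `khat` channels with `u`. -/
def goodNeighbors (khat : ℕ) (u : V) : Set V := {v | N.graph.Adj u v ∧ khat ≤ N.overlap u v}

/-- The maximum number of neighbors of a node. -/
noncomputable def maxDeg [Fintype V] : ℕ :=
  Finset.univ.sup fun u => (N.graph.neighborSet u).ncard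

/-- The maximum number of good neighbors of a node. -/
noncomputable def maxGoodDeg [Fintype V] (khat : ℕ) : ℕ :=
  Finset.univ.sup fun u => (N.goodNeighbors khat u).ncard

open Classical in
/-- What `u` hears in one slot in which every node `w` performs `acts w`: if `u` listens on a
channel and exactly one neighbor of `u` broadcasts on that channel, then `u` hears the identity of
that neighbor; in all other cases (silence, collision, `u` not listening) it hears nothing. -/
noncomputable def receive (acts : V → RadioAction c) (u : V) : Option V :=
  match acts u with
  | .listen l =>
      if h : ∃! v, N.graph.Adj u v ∧
          ∃ l', acts v = RadioAction.broadcast l' ∧ N.chan v l' = N.chan u l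
      then some h.choose else none
  | _ => none

end Network

/-- A synchronous randomized distributed protocol that stops after `slots` slots. In slot `t`
(counted from `0`) a node acts as a function of its own private random numbers (`r (s, m)` is its
`m`-th random number of slot `s`) and of what it has itself heard in the slots before `t`. -/
structure Protocol (V : Type*) (c : ℕ) where
  slots : ℕ
  act : (r : ℕ × ℕ → unitInterval) → (t : ℕ) → (hist : Fin t → Option V) → RadioAction c

/-- The probability space of the random numbers of all nodes: all of them are independent and
uniformly distributed in `[0,1]`. -/
noncomputable def randomness (V : Type*) : Measure (V × ℕ × ℕ → unitInterval) :=
  Measure.infinitePi fun _ => (volume : Measure unitInterval)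

namespace Protocol

variable {V Ch : Type*} {c : ℕ} (P : Protocol V c) (N : Network V Ch c)

/-- What node `u` hears in slot `t` when all nodes start `P` simultaneously in slot `0` and `w` in
the random numbers. -/
noncomputable def heard (w : V × ℕ × ℕ → unitInterval) (t : ℕ) (u : V) : Option V :=
  N.receive (fun x => P.act (fun i => w (x, i)) t (fun s => heard w s.1 x)) u
termination_by t
decreasing_by exact s.2

/-- The identities that `u` has heard when `P` stops; this is the output of `u`. -/
def discovered (w : V × ℕ × ℕ → unitInterval) (u : V) : Set V :=
  {v | ∃ t < P.slots, P.heard N w t u = some v}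

/-- The run with random numbers `w` achieves `khat`-neighbor-discovery: every node finds (at least)
all its good neighbors, and it reports neighbors only. -/
def SolvesDiscovery (khat : ℕ) (w : V × ℕ × ℕ → unitInterval) : Prop :=
  ∀ u, N.goodNeighbors khat u ⊆ P.discovered N w u ∧ P.discovered N w u ⊆ N.graph.neighborSet u

end Protocol

namespace CKSeek

open Classical in
/-- Random choice of a label with probabilities proportional to the weights `wt`, driven by a
uniform `x` in `[0,1]`: label `l` is chosen iff `x * (total weight)` lies in the half-open interval
`[wt 0 + ... + wt (l-1), wt 0 + ... + wt l)`. There is no choice if all weights are `0`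
(or in the null event `x = 1`). -/
noncomputable def pick {c : ℕ} (wt : Fin c → ℕ) (x : unitInterval) : Option (Fin c) :=
  if h : ∃ l : Fin c, ((∑ j ∈ Finset.Iio l, wt j : ℕ) : ℝ) ≤ (x : ℝ) * (∑ j, wt j : ℕ) ∧
      (x : ℝ) * (∑ j, wt j : ℕ) < ((∑ j ∈ Finset.Iic l, wt j : ℕ) : ℝ)
  then some h.choose else none

open Classical in
/-- The estimate of the counting procedure, which has `R` rounds (here numbered from `0`, with guess
`2 ^ i` in round `i`) of `L` slots each; `heardIn i` is the number of messages heard in round `i`.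
For the first round `i` in which messages were heard in more than a fraction `thr` of the slots, the
estimate is four times the guess; it is `0` if there is no such round. -/
noncomputable def countEstimate (R L : ℕ) (thr : ℝ) (heardIn : ℕ → ℕ) : ℕ :=
  if h : ∃ i, i < R ∧ thr * L < heardIn i then 2 ^ (Nat.find h + 2) else 0

/-- The role of a node in the step starting in slot `s`: `true` is broadcaster, `false` listener,
each with probability `1/2`. -/
noncomputable def isBroadcaster (r : ℕ × ℕ → unitInterval) (s : ℕ) : Bool :=
  decide ((r (s, 0) : ℝ) ≤ 1 / 2)

/-- The uniformly random channel label drawn in the step starting in slot `s`. -/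
noncomputable def uniformLabel (c : ℕ) (r : ℕ × ℕ → unitInterval) (s : ℕ) : Option (Fin c) :=
  pick (fun _ => 1) (r (s, 1))

/-- Broadcast on the label `l` in slot `t` with probability `2 ^ (-j)`, otherwise do nothing. -/
noncomputable def broadcastWithProb {c : ℕ} (r : ℕ × ℕ → unitInterval) (t j : ℕ) (l : Fin c) :
    RadioAction c :=
  if (r (t, 2) : ℝ) ≤ (1 / 2) ^ j then .broadcast l else .idle

/-- A slot of part one. A step has `R * L` slots and consists of one run of the counting procedure
on a uniformly random channel; in its round `i` (from `0`), that is, when the guess is `2 ^ i`, a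
broadcaster broadcasts in every slot with probability `1 / 2 ^ i`, and a listener listens. -/
noncomputable def partOne (R L c : ℕ) (r : ℕ × ℕ → unitInterval) (t : ℕ) : RadioAction c :=
  match uniformLabel c r (t / (R * L) * (R * L)) with
  | none => .idle
  | some l =>
      if isBroadcaster r (t / (R * L) * (R * L)) then
        broadcastWithProb r t (t % (R * L) / L) l
      else .listen l

open Classical in
/-- The total count that a node obtains for its channel `l` during the `T₁` steps of part one, if
`h t` is what it hears in slot `t`. -/
noncomputable def totalCount (T₁ R L : ℕ) (thr : ℝ) {V : Type*} {c : ℕ}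
    (r : ℕ × ℕ → unitInterval) (h : ℕ → Option V) (l : Fin c) : ℕ :=
  ∑ q ∈ Finset.range T₁,
    if isBroadcaster r (q * (R * L)) = false ∧ uniformLabel c r (q * (R * L)) = some l then
      countEstimate R L thr fun i =>
        ((Finset.range L).filter fun s => (h (q * (R * L) + i * L + s)).isSome = true).card
    else 0

/-- A slot of part two, the `t`-th one (from `0`), `T` being the number of slots of part one.
A step has `R` slots. A broadcaster goes to a uniformly random channel and broadcasts with
probabilities `2 ^ (-R), ..., 2 ^ (-1)` in the successive slots of the step. A listener listens
throughout the step on a channel chosen with probability proportional to its total count. -/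
noncomputable def partTwo (T R : ℕ) {c : ℕ} (cnt : Fin c → ℕ) (r : ℕ × ℕ → unitInterval)
    (t : ℕ) : RadioAction c :=
  if isBroadcaster r (T + t / R * R) then
    match uniformLabel c r (T + t / R * R) with
    | none => .idle
    | some l => broadcastWithProb r (T + t) (R - t % R) l
  else
    match pick cnt (r (T + t / R * R, 1)) with
    | none => .idle
    | some l => .listen l

/-- The algorithm with `T₁` steps in part one, each consisting of `R` rounds of `L` slots, and `T₂`
steps in part two, each consisting of `R` slots. -/
noncomputable def protocol (V : Type*) (c T₁ T₂ R L : ℕ) (thr : ℝ) : Protocol V c where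
  slots := T₁ * (R * L) + T₂ * R
  act r t hist :=
    if t < T₁ * (R * L) then partOne R L c r t
    else
      partTwo (T₁ * (R * L)) R
        (totalCount T₁ R L thr r fun s => if hs : s < t then hist ⟨s, hs⟩ else none)
        r (t - T₁ * (R * L))

end CKSeek

/-- `CKSeek` for `n` nodes with `c` channels each, at most `kmax` channels shared by two neighbors,
maximum degree `D` and maximum number of good neighbors `Dhat`. The constants hidden in the
asymptotic step numbers are `A` (steps of part one), `B` (steps of part two) and `a` (slots of a
round of the counting procedure); `δ` determines the threshold `(1 + δ) * 8 * e ^ (-7)` of the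
counting procedure. The number of rounds is `lg D`, rounded up and at least `1`. -/
noncomputable def ckSeek (V : Type*) (δ a A B : ℝ) (n c kmax khat D Dhat : ℕ) : Protocol V c :=
  CKSeek.protocol V c
    ⌈A * ((c : ℝ) ^ 2 / khat) * Real.logb 2 n⌉₊
    ⌈B * ((kmax : ℝ) / khat * Dhat + D + c) * Real.logb 2 n⌉₊
    (max 1 (Nat.clog 2 D))
    ⌈a * Real.logb 2 n⌉₊
    ((1 + δ) * (8 * Real.exp (-7)))

/-! Fix a node u and a good neighbor v; a union bound over the at most n² pairs gives the theorem,
and that only neighbors are reported holds on every run. For a label l of u let h_l be the number of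
neighbors having that channel (`Network.holders`), and let S be the sum of all h_l
(`Network.degSum`). Double counting gives S ≤ kmax·Δ_khat + khat·Δ (`Network.degSum_le`). Call a
channel shared by u and v sparse if h_l ≤ 16c, and dense otherwise.

If at least khat/2 shared channels are sparse, part one alone finds v. In the first slot of a step
every broadcaster transmits, and once u listens and v broadcasts on a sparse channel, no other
holder is there with constant probability. A step succeeds with probability of order khat/c²
(`measureReal_not_discovered_partOne_le`).

Otherwise nearly all the work is done by part two on at least khat/2 dense channels. With high
probability the count of a dense channel is at least of order h_l·T₁/c²
(`measureReal_channelCount_le`), and the sum of all counts is at most of order S·T₁/c²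
(`measureReal_sum_channelCount_le`). So u listens on l with probability of order at least h_l/S, and
in the slot with broadcasting probability 2^(-j), c·2^j ≈ h_l, it then hears v with probability of
order 1/h_l. The product 1/S does not depend on h_l; summing over the dense channels gives khat/S
per step, so of order (S/khat)·lg n steps suffice (`measureReal_not_discovered_partTwo_le`).

The counts are reliable because, with m broadcasters, a slot of a round whose guess is close to m
carries a message with probability at least 1/32, whereas for a guess at most m/8 this probability
is at most 8e^(-7). The threshold separates the two cases, so an estimate rarely exceeds 8m and, for
m ≥ 2 within the range of the guesses, rarely falls below m/2. The lower bound for one channel is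
then a Chernoff bound. The upper bound for the sum uses the moment generating function of the number
of broadcasters met in a step, plus Markov's inequality for the rare overestimates.

Independence is read off from the coordinates of the tape: roles and channels, broadcast bits,
different steps, different nodes and the two parts use disjoint coordinates. The counts depend on
part one only and the broadcasts of part two do not depend on counts, so one may condition on the
counts (`measureReal_conditional_le`). -/

open ProbabilityTheory ENNReal

/-- The random numbers of all nodes. -/
abbrev Tape (V : Type*) := V × ℕ × ℕ → unitInterval

instance (V : Type*) : IsProbabilityMeasure (randomness V) := by
  unfold randomness; infer_instance

/-! ### Independence of disjoint sets of coordinates, and tail bounds. -/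

section Coordinates

variable {V : Type*}

/-- The σ-algebra of the events that depend only on the random numbers with an index in `A`. -/
@[reducible] def coordSigma (A : Set (V × ℕ × ℕ)) : MeasurableSpace (Tape V) :=
  ⨆ i ∈ A, MeasurableSpace.comap (fun w : Tape V => w i) inferInstance

lemma coordSigma_mono {A B : Set (V × ℕ × ℕ)} (h : A ⊆ B) : coordSigma A ≤ coordSigma B :=
  biSup_mono h

lemma coordSigma_le (A : Set (V × ℕ × ℕ)) :
    coordSigma A ≤ (MeasurableSpace.pi : MeasurableSpace (Tape V)) :=
  iSup₂_le fun i _ => (measurable_pi_apply i).comap_le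

lemma measurable_coord {A : Set (V × ℕ × ℕ)} {i : V × ℕ × ℕ} (hi : i ∈ A) :
    Measurable[coordSigma A] fun w : Tape V => w i := by
  rw [measurable_iff_comap_le]
  exact le_iSup₂_of_le i hi le_rfl

lemma indep_coordSigma {A B : Set (V × ℕ × ℕ)} (h : Disjoint A B) :
    Indep (coordSigma A) (coordSigma B) (randomness V) := by
  refine indep_iSup_of_disjoint (fun i => (measurable_pi_apply i).comap_le) ?_ h
  exact iIndepFun_infinitePi (P := fun _ : V × ℕ × ℕ => (volume : Measure unitInterval))
    (X := fun _ x => x) (fun _ => measurable_id)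

lemma lintegral_mul_of_disjoint {A B : Set (V × ℕ × ℕ)} (h : Disjoint A B)
    {f g : Tape V → ℝ≥0∞} (hf : Measurable[coordSigma A] f) (hg : Measurable[coordSigma B] g) :
    ∫⁻ w, f w * g w ∂randomness V = (∫⁻ w, f w ∂randomness V) * ∫⁻ w, g w ∂randomness V :=
  lintegral_mul_eq_lintegral_mul_lintegral_of_independent_measurableSpace
    (coordSigma_le A) (coordSigma_le B) (indep_coordSigma h) hf hg

variable {κ : Type*}

lemma lintegral_prod_of_disjoint (s : Finset κ) (A : κ → Set (V × ℕ × ℕ))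
    (hA : (s : Set κ).PairwiseDisjoint A) (f : κ → Tape V → ℝ≥0∞)
    (hf : ∀ q ∈ s, Measurable[coordSigma (A q)] (f q)) :
    ∫⁻ w, ∏ q ∈ s, f q w ∂randomness V = ∏ q ∈ s, ∫⁻ w, f q w ∂randomness V := by
  classical
  induction s using Finset.induction_on with
  | empty => simp
  | insert a s ha ih =>
    simp only [Finset.prod_insert ha]
    rw [← ih (hA.subset (by simp)) fun q hq => hf q (Finset.mem_insert_of_mem hq)]
    refine lintegral_mul_of_disjoint (B := ⋃ q ∈ s, A q) ?_ (hf a (Finset.mem_insert_self a s)) ?_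
    · rw [Set.disjoint_iUnion₂_right]
      intro q hq
      exact hA (by simp) (by simp [hq]) (by rintro rfl; exact ha hq)
    · refine Finset.measurable_fun_prod (m := coordSigma (⋃ q ∈ s, A q)) s fun q hq => ?_
      exact (hf q (Finset.mem_insert_of_mem hq)).mono
        (coordSigma_mono (Set.subset_biUnion_of_mem (u := A) hq)) le_rfl

lemma measure_biInter_of_disjoint (s : Finset κ) (A : κ → Set (V × ℕ × ℕ))
    (hA : (s : Set κ).PairwiseDisjoint A) (E : κ → Set (Tape V))
    (hE : ∀ q ∈ s, MeasurableSet[coordSigma (A q)] (E q)) :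
    randomness V (⋂ q ∈ s, E q) = ∏ q ∈ s, randomness V (E q) := by
  have hm : ∀ q ∈ s, MeasurableSet (E q) := fun q hq => coordSigma_le _ _ (hE q hq)
  rw [← lintegral_indicator_one (s.measurableSet_biInter hm)]
  have h1 : ∀ w, (⋂ q ∈ s, E q).indicator (1 : Tape V → ℝ≥0∞) w =
      ∏ q ∈ s, (E q).indicator 1 w := by
    intro w
    by_cases hw : w ∈ ⋂ q ∈ s, E q
    · rw [Set.indicator_of_mem hw]
      refine (Finset.prod_eq_one fun q hq => ?_).symm
      rw [Set.indicator_of_mem (Set.mem_iInter₂.1 hw q hq)]; rfl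
    · rw [Set.indicator_of_notMem hw]
      simp only [Set.mem_iInter, not_forall] at hw
      obtain ⟨q, hq, hw⟩ := hw
      exact (Finset.prod_eq_zero hq (Set.indicator_of_notMem hw _)).symm
  simp_rw [h1]
  rw [lintegral_prod_of_disjoint s A hA (fun q => (E q).indicator 1)
    (fun q hq => Measurable.indicator (m := coordSigma (A q)) measurable_const (hE q hq))]
  exact Finset.prod_congr rfl fun q hq => lintegral_indicator_one (hm q hq)

lemma measure_inter_of_disjoint {A B : Set (V × ℕ × ℕ)} (h : Disjoint A B)
    {E F : Set (Tape V)} (hE : MeasurableSet[coordSigma A] E) (hF : MeasurableSet[coordSigma B] F) :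
    randomness V (E ∩ F) = randomness V E * randomness V F :=
  (Indep_iff _ _ _).1 (indep_coordSigma h) E F hE hF

/-- If `E k` has probability at most `b` for every value `k ∈ G` of a discrete random variable that
is independent of `E k`, then this also holds conditionally. -/
lemma measure_conditional_le [Countable κ] {A B : Set (V × ℕ × ℕ)} (h : Disjoint A B)
    (X : Tape V → κ) (hX : ∀ k, MeasurableSet[coordSigma A] {w | X w = k}) (G : Set κ)
    (E : κ → Set (Tape V)) (hE : ∀ k, MeasurableSet[coordSigma B] (E k)) (b : ℝ≥0∞)
    (hb : ∀ k ∈ G, randomness V (E k) ≤ b) :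
    randomness V {w | X w ∈ G ∧ w ∈ E (X w)} ≤ b * randomness V {w | X w ∈ G} := by
  have h1 : {w | X w ∈ G ∧ w ∈ E (X w)} = ⋃ k : G, {w | X w = k} ∩ E k := by
    ext w; simp
  have h2 : {w | X w ∈ G} = ⋃ k : G, {w | X w = k} := by
    ext w; simp
  have hdisj : Pairwise (Function.onFun Disjoint fun k : G => {w | X w = k}) := by
    intro k l hkl
    refine Set.disjoint_left.2 fun w hw hw' => hkl (Subtype.ext ?_)
    simp only [Set.mem_ofPred_eq] at hw hw'
    exact hw.symm.trans hw'
  rw [h1, h2, measure_iUnion hdisj fun k => coordSigma_le _ _ (hX k), ← ENNReal.tsum_mul_left]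
  refine (measure_iUnion_le _).trans (ENNReal.tsum_le_tsum fun k => ?_)
  rw [measure_inter_of_disjoint h (hX k) (hE k), mul_comm]
  gcongr
  exact hb k k.2

lemma lintegral_exp_sum_le (s : Finset κ) (A : κ → Set (V × ℕ × ℕ))
    (hA : (s : Set κ).PairwiseDisjoint A) (Y : κ → Tape V → ℝ)
    (hY : ∀ q ∈ s, Measurable[coordSigma (A q)] (Y q)) (b : κ → ℝ)
    (hb : ∀ q ∈ s, ∫⁻ w, ENNReal.ofReal (Real.exp (Y q w)) ∂randomness V ≤
      ENNReal.ofReal (Real.exp (b q))) :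
    ∫⁻ w, ENNReal.ofReal (Real.exp (∑ q ∈ s, Y q w)) ∂randomness V ≤
      ENNReal.ofReal (Real.exp (∑ q ∈ s, b q)) := by
  simp_rw [Real.exp_sum]
  simp_rw [ENNReal.ofReal_prod_of_nonneg fun q (_ : q ∈ s) => (Real.exp_pos _).le]
  rw [lintegral_prod_of_disjoint s A hA fun q w => ENNReal.ofReal (Real.exp (Y q w))]
  · exact Finset.prod_le_prod' hb
  · intro q hq
    exact ENNReal.measurable_ofReal.comp (Real.measurable_exp.comp (hY q hq))

/-- The exponential Markov inequality for a sum of independent random variables. -/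
lemma chernoff (s : Finset κ) (A : κ → Set (V × ℕ × ℕ))
    (hA : (s : Set κ).PairwiseDisjoint A) (Y : κ → Tape V → ℝ)
    (hY : ∀ q ∈ s, Measurable[coordSigma (A q)] (Y q)) (b θ : ℝ)
    (hb : ∀ q ∈ s, ∫⁻ w, ENNReal.ofReal (Real.exp (Y q w)) ∂randomness V ≤
      ENNReal.ofReal (Real.exp b)) :
    randomness V {w | θ ≤ ∑ q ∈ s, Y q w} ≤ ENNReal.ofReal (Real.exp (s.card * b - θ)) := by
  have h1 := lintegral_exp_sum_le s A hA Y hY (fun _ => b) hb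
  rw [Finset.sum_const, nsmul_eq_mul] at h1
  have hm : Measurable fun w => ENNReal.ofReal (Real.exp (∑ q ∈ s, Y q w)) := by
    refine ENNReal.measurable_ofReal.comp (Real.measurable_exp.comp ?_)
    exact Finset.measurable_sum s fun q hq => (hY q hq).mono (coordSigma_le _) le_rfl
  have h2 := meas_ge_le_lintegral_div (μ := randomness V) hm.aemeasurable
    (ε := ENNReal.ofReal (Real.exp θ)) (by simp [Real.exp_pos]) ENNReal.ofReal_ne_top
  have h3 : {w | θ ≤ ∑ q ∈ s, Y q w} ⊆ {w | ENNReal.ofReal (Real.exp θ) ≤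
      ENNReal.ofReal (Real.exp (∑ q ∈ s, Y q w))} := fun w hw =>
    ENNReal.ofReal_le_ofReal (Real.exp_le_exp.2 hw)
  refine (measure_mono h3).trans (h2.trans ?_)
  rw [Real.exp_sub, ENNReal.ofReal_div_of_pos (Real.exp_pos _)]
  gcongr

open Classical in
-- The expectation is 1 + (e^c - 1)·P(E), which is increasing or decreasing in P(E) according to the
-- sign of c. The two alternatives serve the upper and the lower tail.
lemma lintegral_exp_indicator_le {E : Set (Tape V)} (hE : MeasurableSet E) (c p : ℝ)
    (h : (0 ≤ c ∧ (randomness V).real E ≤ p) ∨ (c ≤ 0 ∧ p ≤ (randomness V).real E)) :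
    ∫⁻ w, ENNReal.ofReal (Real.exp (if w ∈ E then c else 0)) ∂randomness V ≤
      ENNReal.ofReal (Real.exp ((Real.exp c - 1) * p)) := by
  have h1 : ∀ w, ENNReal.ofReal (Real.exp (if w ∈ E then c else 0)) =
      E.indicator (fun _ => ENNReal.ofReal (Real.exp c)) w + Eᶜ.indicator (fun _ => 1) w := by
    intro w
    by_cases hw : w ∈ E <;> simp [hw]
  simp_rw [h1]
  rw [lintegral_add_left (measurable_const.indicator hE), lintegral_indicator_const hE,
    lintegral_indicator_const hE.compl, one_mul, ← ofReal_measureReal, ← ofReal_measureReal,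
    ← ENNReal.ofReal_mul (Real.exp_pos _).le, ← ENNReal.ofReal_add (by positivity) (by positivity),
    probReal_compl_eq_one_sub hE]
  refine ENNReal.ofReal_le_ofReal ?_
  have h2 : Real.exp c * (randomness V).real E + (1 - (randomness V).real E) =
      (Real.exp c - 1) * (randomness V).real E + 1 := by ring
  rw [h2]
  refine (Real.add_one_le_exp _).trans (Real.exp_le_exp.2 ?_)
  rcases h with ⟨hc, hp⟩ | ⟨hc, hp⟩
  · exact mul_le_mul_of_nonneg_left hp (by linarith [Real.add_one_le_exp c])
  · exact mul_le_mul_of_nonpos_left hp (by linarith [Real.exp_le_one_iff.2 hc])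

open Classical in
lemma card_filter_eq_sum_mul (s : Finset κ) (E : κ → Set (Tape V)) (c : ℝ) (w : Tape V) :
    ∑ q ∈ s, (if w ∈ E q then c else 0) = c * (s.filter fun q => w ∈ E q).card := by
  rw [Finset.sum_ite, Finset.sum_const_zero, add_zero, Finset.sum_const, nsmul_eq_mul, mul_comm]

open Classical in
lemma measurable_ite_mem {A : Set (V × ℕ × ℕ)} {E : Set (Tape V)}
    (hE : MeasurableSet[coordSigma A] E) (c : ℝ) :
    Measurable[coordSigma A] fun w => if w ∈ E then c else (0 : ℝ) :=
  Measurable.ite (m := coordSigma A) hE measurable_const measurable_const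

open Classical in
/-- Lower tail for the number of successes in independent trials. -/
lemma few_successes_le (s : Finset κ) (A : κ → Set (V × ℕ × ℕ))
    (hA : (s : Set κ).PairwiseDisjoint A) (E : κ → Set (Tape V))
    (hE : ∀ q ∈ s, MeasurableSet[coordSigma (A q)] (E q)) (p : ℝ) (hp0 : 0 ≤ p)
    (hp : ∀ q ∈ s, p ≤ (randomness V).real (E q)) :
    (randomness V).real {w | ((s.filter fun q => w ∈ E q).card : ℝ) ≤ s.card * p / 4} ≤
      Real.exp (-(s.card * p / 3)) := by
  have h1 := chernoff s A hA (fun q w => if w ∈ E q then (-1 : ℝ) else 0)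
    (fun q hq => measurable_ite_mem (hE q hq) _) ((Real.exp (-1) - 1) * p) (-(s.card * p / 4))
    fun q hq => lintegral_exp_indicator_le (coordSigma_le _ _ (hE q hq)) _ _
      (Or.inr ⟨by norm_num, hp q hq⟩)
  simp_rw [card_filter_eq_sum_mul] at h1
  have h2 : {w : Tape V | ((s.filter fun q => w ∈ E q).card : ℝ) ≤ s.card * p / 4} =
      {w | -(s.card * p / 4) ≤ -1 * ((s.filter fun q => w ∈ E q).card : ℝ)} := by
    ext w; simp
  rw [h2]
  refine ENNReal.toReal_le_of_le_ofReal (Real.exp_pos _).le (h1.trans ?_)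
  refine ENNReal.ofReal_le_ofReal (Real.exp_le_exp.2 ?_)
  -- The tilt is -1, so the exponent is (e⁻¹ - 1 + 1/4) times the mean, and 5/12 is what makes this
  -- -1/3.
  have h3 : Real.exp (-1) ≤ 5 / 12 := by
    rw [Real.exp_neg, inv_le_comm₀ (Real.exp_pos _) (by norm_num)]
    linarith [Real.exp_one_gt_d9]
  have h4 : (0 : ℝ) ≤ s.card * p := by positivity
  nlinarith

open Classical in
/-- Upper tail for the number of successes in independent trials. -/
lemma many_successes_le (s : Finset κ) (A : κ → Set (V × ℕ × ℕ))
    (hA : (s : Set κ).PairwiseDisjoint A) (E : κ → Set (Tape V))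
    (hE : ∀ q ∈ s, MeasurableSet[coordSigma (A q)] (E q)) (p δ : ℝ) (hp0 : 0 ≤ p)
    (hδ : 0 < δ) (hδ1 : δ ≤ 1) (hp : ∀ q ∈ s, (randomness V).real (E q) ≤ p) :
    (randomness V).real {w | (1 + δ) * p * s.card ≤ ((s.filter fun q => w ∈ E q).card : ℝ)} ≤
      Real.exp (-(s.card * p * δ ^ 2 / 4)) := by
  have h1 := chernoff s A hA (fun q w => if w ∈ E q then δ / 2 else 0)
    (fun q hq => measurable_ite_mem (hE q hq) _) ((Real.exp (δ / 2) - 1) * p)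
    (δ / 2 * ((1 + δ) * p * s.card))
    fun q hq => lintegral_exp_indicator_le (coordSigma_le _ _ (hE q hq)) _ _
      (Or.inl ⟨by positivity, hp q hq⟩)
  simp_rw [card_filter_eq_sum_mul] at h1
  have h2 : {w : Tape V | (1 + δ) * p * s.card ≤ ((s.filter fun q => w ∈ E q).card : ℝ)} ⊆
      {w | δ / 2 * ((1 + δ) * p * s.card) ≤ δ / 2 * ((s.filter fun q => w ∈ E q).card : ℝ)} :=
    fun w hw => mul_le_mul_of_nonneg_left hw (half_pos hδ).le
  refine ENNReal.toReal_le_of_le_ofReal (Real.exp_pos _).le ((measure_mono h2).trans (h1.trans ?_))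
  refine ENNReal.ofReal_le_ofReal (Real.exp_le_exp.2 ?_)
  -- With tilt δ/2 the exponent per unit of mean is at most δ/2 + δ²/4 - (δ/2)(1 + δ) = -δ²/4.
  have h3 : Real.exp (δ / 2) ≤ 1 + δ / 2 + (δ / 2) ^ 2 := by
    have := Real.abs_exp_sub_one_sub_id_le (x := δ / 2) (by
      rw [abs_of_pos (by linarith)]; linarith)
    linarith only [(abs_le.1 this).2]
  have h4 : (0 : ℝ) ≤ s.card * p := by positivity
  nlinarith

lemma no_success_le (s : Finset κ) (A : κ → Set (V × ℕ × ℕ))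
    (hA : (s : Set κ).PairwiseDisjoint A) (E : κ → Set (Tape V))
    (hE : ∀ q ∈ s, MeasurableSet[coordSigma (A q)] (E q)) (p : ℝ)
    (hp : ∀ q ∈ s, p ≤ (randomness V).real (E q)) :
    (randomness V).real (⋂ q ∈ s, (E q)ᶜ) ≤ Real.exp (-(s.card * p)) := by
  rw [measureReal_def, measure_biInter_of_disjoint s A hA _ fun q hq => (hE q hq).compl,
    ENNReal.toReal_prod]
  have h1 : Real.exp (-(s.card * p)) = ∏ _q ∈ s, Real.exp (-p) := by
    rw [Finset.prod_const, ← Real.exp_nat_mul]; ring_nf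
  rw [h1]
  refine Finset.prod_le_prod (fun _ _ => by positivity) fun q hq => ?_
  change (randomness V).real (E q)ᶜ ≤ _
  rw [probReal_compl_eq_one_sub (coordSigma_le _ _ (hE q hq))]
  linarith [hp q hq, Real.add_one_le_exp (-p)]

end Coordinates

/-! ### Choosing a label with given weights. -/

namespace CKSeek

lemma sum_Iic_eq {c : ℕ} (wt : Fin c → ℕ) (l : Fin c) :
    ∑ j ∈ Finset.Iic l, wt j = (∑ j ∈ Finset.Iio l, wt j) + wt l := by
  rw [← Finset.Iio_insert, Finset.sum_insert (by simp), add_comm]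

lemma sum_Iic_le_sum_Iio {c : ℕ} (wt : Fin c → ℕ) {l l' : Fin c} (h : l < l') :
    ∑ j ∈ Finset.Iic l, wt j ≤ ∑ j ∈ Finset.Iio l', wt j := by
  refine Finset.sum_le_sum_of_subset fun j hj => ?_
  simp only [Finset.mem_Iic, Finset.mem_Iio] at hj ⊢
  exact hj.trans_lt h

/-- The intervals of different labels are disjoint, so the label selected by choice is the only
candidate. -/
lemma pick_eq_some_iff {c : ℕ} (wt : Fin c → ℕ) (x : unitInterval) (l : Fin c) :
    pick wt x = some l ↔
      ((∑ j ∈ Finset.Iio l, wt j : ℕ) : ℝ) ≤ (x : ℝ) * (∑ j, wt j : ℕ) ∧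
      (x : ℝ) * (∑ j, wt j : ℕ) < ((∑ j ∈ Finset.Iic l, wt j : ℕ) : ℝ) := by
  have huniq : ∀ l l' : Fin c,
      ((∑ j ∈ Finset.Iio l, wt j : ℕ) : ℝ) ≤ (x : ℝ) * (∑ j, wt j : ℕ) →
      (x : ℝ) * (∑ j, wt j : ℕ) < ((∑ j ∈ Finset.Iic l', wt j : ℕ) : ℝ) → ¬ l' < l := by
    intro l l' h1 h2 h
    have h3 : ((∑ j ∈ Finset.Iic l', wt j : ℕ) : ℝ) ≤ ((∑ j ∈ Finset.Iio l, wt j : ℕ) : ℝ) := by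
      exact_mod_cast sum_Iic_le_sum_Iio wt h
    linarith
  unfold pick
  constructor
  · intro h
    split_ifs at h with hex
    · have := hex.choose_spec
      rw [Option.some_inj.1 h] at this
      exact this
  · intro h
    have hex : ∃ l : Fin c, ((∑ j ∈ Finset.Iio l, wt j : ℕ) : ℝ) ≤ (x : ℝ) * (∑ j, wt j : ℕ) ∧
      (x : ℝ) * (∑ j, wt j : ℕ) < ((∑ j ∈ Finset.Iic l, wt j : ℕ) : ℝ) := ⟨l, h⟩
    rw [dif_pos hex]
    have hs := hex.choose_spec
    congr 1
    exact le_antisymm (not_lt.1 (huniq _ _ hs.1 h.2)) (not_lt.1 (huniq _ _ h.1 hs.2))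

lemma measurableSet_pick {c : ℕ} (wt : Fin c → ℕ) (o : Option (Fin c)) :
    MeasurableSet {x | pick wt x = o} := by
  have hsome : ∀ l, MeasurableSet {x | pick wt x = some l} := by
    intro l
    simp_rw [pick_eq_some_iff]
    exact (measurableSet_le measurable_const (measurable_subtype_coe.mul_const _)).inter
      (measurableSet_lt (measurable_subtype_coe.mul_const _) measurable_const)
  rcases o with _ | l
  · have : {x | pick wt x = none} = (⋃ l, {x | pick wt x = some l})ᶜ := by
      ext x
      simp [Option.eq_none_iff_forall_not_mem]
    rw [this]
    exact (MeasurableSet.iUnion hsome).compl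
  · exact hsome l

lemma volume_pick {c : ℕ} (wt : Fin c → ℕ) (l : Fin c) (h : 0 < ∑ j, wt j) :
    (volume {x | pick wt x = some l}).toReal = (wt l : ℝ) / (∑ j, wt j : ℕ) := by
  set W : ℝ := ((∑ j, wt j : ℕ) : ℝ) with hW
  have hW0 : 0 < W := by rw [hW]; exact_mod_cast h
  have hb : ((∑ j ∈ Finset.Iic l, wt j : ℕ) : ℝ) ≤ W := by
    rw [hW]; exact_mod_cast Finset.sum_le_sum_of_subset (Finset.subset_univ _)
  have hab : ((∑ j ∈ Finset.Iic l, wt j : ℕ) : ℝ) = (∑ j ∈ Finset.Iio l, wt j : ℕ) + wt l := by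
    exact_mod_cast sum_Iic_eq wt l
  have ha0 : (0 : ℝ) ≤ (∑ j ∈ Finset.Iio l, wt j : ℕ) := Nat.cast_nonneg _
  have hwt : (0 : ℝ) ≤ wt l := Nat.cast_nonneg _
  have hset : {x | pick wt x = some l} =
      Set.Ico (⟨(∑ j ∈ Finset.Iio l, wt j : ℕ) / W, by positivity,
          (div_le_one hW0).2 (by linarith)⟩ : unitInterval)
        ⟨(∑ j ∈ Finset.Iic l, wt j : ℕ) / W, by positivity, (div_le_one hW0).2 hb⟩ := by
    ext x
    simp only [Set.mem_ofPred_eq, Set.mem_Ico, ← Subtype.coe_le_coe, ← Subtype.coe_lt_coe]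
    rw [pick_eq_some_iff, div_le_iff₀ hW0, lt_div_iff₀ hW0]
  rw [hset, unitInterval.volume_Ico, ENNReal.toReal_ofReal]
  · rw [← sub_div, hab]; ring_nf
  · rw [← sub_div, hab]; ring_nf; positivity

end CKSeek

/-! ### Probabilities of the decisions of a single node. -/

section Events

variable {V : Type*}

lemma measureReal_and_of_disjoint {A B : Set (V × ℕ × ℕ)} (h : Disjoint A B)
    {P Q : Tape V → Prop} (hP : MeasurableSet[coordSigma A] {w | P w})
    (hQ : MeasurableSet[coordSigma B] {w | Q w}) :
    (randomness V).real {w | P w ∧ Q w} =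
      (randomness V).real {w | P w} * (randomness V).real {w | Q w} := by
  simp only [measureReal_def]
  rw [← ENNReal.toReal_mul, ← measure_inter_of_disjoint h hP hQ]
  rfl

lemma measurableSet_coord {A : Set (V × ℕ × ℕ)} {i : V × ℕ × ℕ} (hi : i ∈ A)
    {E : Set unitInterval} (hE : MeasurableSet E) :
    MeasurableSet[coordSigma A] {w : Tape V | w i ∈ E} :=
  measurable_coord hi hE

lemma measure_coord (i : V × ℕ × ℕ) {E : Set unitInterval} (hE : MeasurableSet E) :
    randomness V {w : Tape V | w i ∈ E} = volume E :=
  (measurePreserving_eval_infinitePi (fun _ : V × ℕ × ℕ => (volume : Measure unitInterval))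
    i).measure_preimage hE.nullMeasurableSet

lemma measurableSet_bit {A : Set (V × ℕ × ℕ)} {i : V × ℕ × ℕ} (hi : i ∈ A) (p : ℝ) :
    MeasurableSet[coordSigma A] {w : Tape V | (w i : ℝ) ≤ p} :=
  measurableSet_coord hi (E := {x | (x : ℝ) ≤ p})
    (measurableSet_le measurable_subtype_coe measurable_const)

lemma measureReal_bit (i : V × ℕ × ℕ) (p : ℝ) (h0 : 0 ≤ p) (h1 : p ≤ 1) :
    (randomness V).real {w : Tape V | (w i : ℝ) ≤ p} = p := by
  have h := measure_coord (V := V) i (E := Set.Iic (⟨p, h0, h1⟩ : unitInterval)) measurableSet_Iic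
  rw [unitInterval.volume_Iic] at h
  rw [measureReal_def]
  change (randomness V {w : Tape V | w i ∈ Set.Iic (⟨p, h0, h1⟩ : unitInterval)}).toReal = p
  rw [h, ENNReal.toReal_ofReal h0]

/-- The role and the uniformly random channel of node `x` in the step starting in slot `s`. -/
noncomputable def choice (c : ℕ) (w : Tape V) (s : ℕ) (x : V) : Bool × Option (Fin c) :=
  (CKSeek.isBroadcaster (fun i => w (x, i)) s, CKSeek.uniformLabel c (fun i => w (x, i)) s)

lemma measurableSet_role {A : Set (V × ℕ × ℕ)} {x : V} {s : ℕ} (h : (x, s, 0) ∈ A) (b : Bool) :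
    MeasurableSet[coordSigma A]
      {w : Tape V | CKSeek.isBroadcaster (fun i => w (x, i)) s = b} := by
  have h1 := measurableSet_bit h (1 / 2 : ℝ)
  cases b
  · convert h1.compl using 1
    ext w; simp [CKSeek.isBroadcaster]
  · convert h1 using 1
    ext w; simp [CKSeek.isBroadcaster]

lemma measurableSet_pick_coord {A : Set (V × ℕ × ℕ)} {i : V × ℕ × ℕ} (h : i ∈ A) {c : ℕ}
    (wt : Fin c → ℕ) (o : Option (Fin c)) :
    MeasurableSet[coordSigma A] {w : Tape V | CKSeek.pick wt (w i) = o} :=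
  measurableSet_coord h (CKSeek.measurableSet_pick wt o)

lemma measureReal_role (x : V) (s : ℕ) (b : Bool) :
    (randomness V).real {w : Tape V | CKSeek.isBroadcaster (fun i => w (x, i)) s = b} = 1 / 2 := by
  have h1 := measureReal_bit (x, s, 0) (1 / 2 : ℝ) (by norm_num) (by norm_num)
  cases b
  · have h2 : {w : Tape V | CKSeek.isBroadcaster (fun i => w (x, i)) s = false} =
        {w : Tape V | (w (x, s, 0) : ℝ) ≤ 1 / 2}ᶜ := by
      ext w; simp [CKSeek.isBroadcaster]
    rw [h2, probReal_compl_eq_one_sub (coordSigma_le Set.univ _ (measurableSet_bit (Set.mem_univ _) _)), h1]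
    norm_num
  · rw [← h1]
    congr 1
    ext w; simp [CKSeek.isBroadcaster]

lemma measureReal_role_pick (x : V) (s : ℕ) (b : Bool) {c : ℕ} (wt : Fin c → ℕ) (l : Fin c)
    (h : 0 < ∑ j, wt j) :
    (randomness V).real {w : Tape V | CKSeek.isBroadcaster (fun i => w (x, i)) s = b ∧
      CKSeek.pick wt (w (x, s, 1)) = some l} = 1 / 2 * ((wt l : ℝ) / (∑ j, wt j : ℕ)) := by
  rw [measureReal_and_of_disjoint (A := {(x, s, 0)}) (B := {(x, s, 1)}) (by simp)
    (measurableSet_role (Set.mem_singleton _) b)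
    (measurableSet_pick_coord (Set.mem_singleton _) wt (some l)), measureReal_role,
    ← CKSeek.volume_pick wt l h]
  exact congrArg (fun r => 1 / 2 * ENNReal.toReal r)
    (measure_coord (x, s, 1) (CKSeek.measurableSet_pick wt (some l)))

lemma measureReal_choice (x : V) (s : ℕ) (b : Bool) {c : ℕ} (l : Fin c) :
    (randomness V).real {w : Tape V | choice c w s x = (b, some l)} = 1 / (2 * c) := by
  have h0 : 0 < ∑ _j : Fin c, 1 := by simpa using l.pos
  have h := measureReal_role_pick x s b (fun _ : Fin c => 1) l h0
  simp only [Finset.sum_const, Finset.card_univ, Fintype.card_fin, smul_eq_mul, mul_one] at h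
  simp only [choice, Prod.mk.injEq, CKSeek.uniformLabel]
  rw [h]
  push_cast
  field_simp

lemma measurableSet_choice {A : Set (V × ℕ × ℕ)} {x : V} {s : ℕ} (h0 : (x, s, 0) ∈ A)
    (h1 : (x, s, 1) ∈ A) {c : ℕ} (k : Bool × Option (Fin c)) :
    MeasurableSet[coordSigma A] {w : Tape V | choice c w s x = k} := by
  obtain ⟨b, o⟩ := k
  simp only [choice, Prod.mk.injEq, CKSeek.uniformLabel]
  exact (measurableSet_role h0 b).inter (measurableSet_pick_coord h1 _ o)

lemma measurableSet_choices [Finite V] {A : Set (V × ℕ × ℕ)} {s : ℕ}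
    (h : ∀ x, (x, s, 0) ∈ A ∧ (x, s, 1) ∈ A) {c : ℕ} (k : V → Bool × Option (Fin c)) :
    MeasurableSet[coordSigma A] {w : Tape V | choice c w s = k} := by
  have : {w : Tape V | choice c w s = k} = ⋂ x, {w | choice c w s x = k x} := by
    ext w; simp [funext_iff]
  rw [this]
  exact MeasurableSet.iInter (m := coordSigma A) fun x =>
    measurableSet_choice (h x).1 (h x).2 (k x)

/-- Node `x` broadcasts on its label `l` in slot `t` of the step starting in slot `s`, the
broadcasting probability of the slot being `2 ^ (-j)`. -/
def sends {c : ℕ} (s t j : ℕ) (x : V) (l : Fin c) : Set (Tape V) :=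
  {w | choice c w s x = (true, some l) ∧ (w (x, t, 2) : ℝ) ≤ (1 / 2) ^ j}

lemma measurableSet_sends {A : Set (V × ℕ × ℕ)} {x : V} {s t : ℕ} (j : ℕ) (h0 : (x, s, 0) ∈ A)
    (h1 : (x, s, 1) ∈ A) (h2 : (x, t, 2) ∈ A) {c : ℕ} (l : Fin c) :
    MeasurableSet[coordSigma A] (sends s t j x l) :=
  (measurableSet_choice h0 h1 _).inter (measurableSet_bit h2 _)

lemma measureReal_sends (s t j : ℕ) (x : V) {c : ℕ} (l : Fin c) :
    (randomness V).real (sends s t j x l) = 1 / (2 * c) * (1 / 2) ^ j := by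
  unfold sends
  rw [measureReal_and_of_disjoint (A := {(x, s, 0), (x, s, 1)}) (B := {(x, t, 2)})
    (by simp) (measurableSet_choice (by simp) (by simp) (true, some l))
    (measurableSet_bit (Set.mem_singleton _) ((1 / 2 : ℝ) ^ j)), measureReal_choice,
    measureReal_bit _ _ (by positivity) (pow_le_one₀ (by norm_num) (by norm_num))]

end Events

/-! ### Elementary estimates for the probability of a single sender. -/

section RealBounds

/-- Bernoulli's inequality shows that N factors 1 - 1/(2N) multiply to at least 1/2; at most K such
blocks are needed. -/
lemma half_pow_le_one_sub_pow {N n K : ℕ} (hN : 1 ≤ N) (hn : n ≤ K * N) :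
    (1 / 2 : ℝ) ^ K ≤ (1 - 1 / (2 * N)) ^ n := by
  have hN' : (1 : ℝ) ≤ N := by exact_mod_cast hN
  have h0 : (1 : ℝ) / (2 * N) ≤ 1 / 2 := by
    rw [div_le_div_iff₀ (by positivity) (by norm_num)]; linarith
  have h00 : (0 : ℝ) < 1 / (2 * N) := by positivity
  have h1 : (1 / 2 : ℝ) ≤ (1 - 1 / (2 * N)) ^ N := by
    have := one_add_mul_le_pow (a := -(1 / (2 * N) : ℝ)) (by linarith) N
    have h2 : (1 : ℝ) + N * -(1 / (2 * N)) = 1 / 2 := by field_simp; norm_num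
    rw [h2] at this
    rwa [sub_eq_add_neg]
  calc (1 / 2 : ℝ) ^ K ≤ ((1 - 1 / (2 * N)) ^ N) ^ K := by gcongr
    _ = (1 - 1 / (2 * N)) ^ (K * N) := by rw [← pow_mul, mul_comm N K]
    _ ≤ _ := pow_le_pow_of_le_one (by linarith) (by linarith) hn

/-- With p = 2^(-i) and x = m·p ≥ 8 the left side is at most x·e^(1-x), which decreases for x ≥ 1
and equals 8e^(-7) at x = 8. This is the origin of the constant in the threshold. -/
lemma single_sender_prob_le {i m : ℕ} (h : 8 * 2 ^ i ≤ m) :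
    (m : ℝ) * (1 / 2) ^ i * (1 - (1 / 2) ^ i) ^ (m - 1) ≤ 8 * Real.exp (-7) := by
  set p : ℝ := (1 / 2) ^ i with hp
  have hp0 : 0 < p := by positivity
  have hp1 : p ≤ 1 := pow_le_one₀ (by norm_num) (by norm_num)
  have hx : 8 ≤ (m : ℝ) * p := by
    have h1 : ((8 * 2 ^ i : ℕ) : ℝ) ≤ m := by exact_mod_cast h
    have h2 : (2 : ℝ) ^ i * p = 1 := by rw [hp, ← mul_pow]; norm_num
    push_cast at h1
    nlinarith
  have hm : 1 ≤ m := le_trans (Nat.mul_pos (by norm_num) (by positivity)) h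
  have h1 : (1 - p) ^ (m - 1) ≤ Real.exp (-((m : ℝ) * p) + 1) := by
    calc (1 - p) ^ (m - 1) ≤ Real.exp (-p) ^ (m - 1) := by
          gcongr
          linarith [Real.add_one_le_exp (-p)]
      _ = Real.exp (-((m : ℝ) * p) + p) := by
          rw [← Real.exp_nat_mul]
          congr 1
          push_cast [Nat.cast_sub hm]
          ring
      _ ≤ _ := by gcongr
  have h2 : (m : ℝ) * p ≤ 8 * Real.exp ((m : ℝ) * p - 8) := by
    linarith [Real.add_one_le_exp ((m : ℝ) * p - 8)]
  calc (m : ℝ) * p * (1 - p) ^ (m - 1)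
      ≤ 8 * Real.exp ((m : ℝ) * p - 8) * Real.exp (-((m : ℝ) * p) + 1) := by
        gcongr
    _ = 8 * Real.exp (-7) := by rw [mul_assoc, ← Real.exp_add]; ring_nf

/-- The expected number of senders is at least 1/2 and the others stay silent with probability at
least 2^(-4). For i = 0 everyone sends, so a message gets through only if m = 1. -/
lemma le_single_sender_prob {i m : ℕ} (h1 : m ≤ 2 * 2 ^ i) (h2 : 2 ^ i ≤ 2 * m)
    (h3 : i = 0 → m = 1) :
    1 / 32 ≤ (m : ℝ) * (1 / 2) ^ i * (1 - (1 / 2) ^ i) ^ (m - 1) := by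
  rcases i with _ | i
  · rw [h3 rfl]; norm_num
  · have h4 := half_pow_le_one_sub_pow (N := 2 ^ i) (n := m - 1) (K := 4) Nat.one_le_two_pow
      (by rw [pow_succ] at h1; omega)
    have h5 : (1 : ℝ) / (2 * (2 ^ i : ℕ)) = (1 / 2) ^ (i + 1) := by
      push_cast; rw [pow_succ, one_div_pow]; field_simp
    rw [h5] at h4
    have h6 : (1 / 2 : ℝ) ≤ m * (1 / 2) ^ (i + 1) := by
      have h7 : ((2 ^ (i + 1) : ℕ) : ℝ) ≤ ((2 * m : ℕ) : ℝ) := by exact_mod_cast h2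
      push_cast at h7
      rw [one_div_pow, mul_one_div, div_le_div_iff₀ (by norm_num) (by positivity)]
      linarith
    calc (1 / 32 : ℝ) = 1 / 2 * (1 / 2) ^ 4 := by norm_num
      _ ≤ _ := by gcongr

end RealBounds

/-! ### Exactly one of several independent senders. -/

section Slots

variable {V : Type*}

lemma measureReal_inter_of_disjoint {A B : Set (V × ℕ × ℕ)} (h : Disjoint A B)
    {E F : Set (Tape V)} (hE : MeasurableSet[coordSigma A] E) (hF : MeasurableSet[coordSigma B] F) :
    (randomness V).real (E ∩ F) = (randomness V).real E * (randomness V).real F := by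
  simp only [measureReal_def]
  rw [← ENNReal.toReal_mul, ← measure_inter_of_disjoint h hE hF]

/-- The random numbers of node `x`. -/
def nodeCoords (x : V) : Set (V × ℕ × ℕ) := {i | i.1 = x}

lemma mem_nodeCoords (x : V) (t m : ℕ) : (x, t, m) ∈ nodeCoords x := rfl

lemma disjoint_nodeCoords {x y : V} (h : x ≠ y) : Disjoint (nodeCoords x) (nodeCoords y) :=
  Set.disjoint_left.2 fun i (hx : i.1 = x) (hy : i.1 = y) => h (hx.symm.trans hy)

variable [DecidableEq V]

/-- The probability that `v` is the only node of `M` whose event occurs, if the events of the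
nodes are independent and have probability `p`. -/
lemma measureReal_only {M : Finset V} {v : V} (hv : v ∈ M) (S : V → Set (Tape V)) (p : ℝ)
    (hS : ∀ x ∈ M, MeasurableSet[coordSigma (nodeCoords x)] (S x))
    (hp : ∀ x ∈ M, (randomness V).real (S x) = p) :
    (randomness V).real (S v ∩ ⋂ x ∈ M.erase v, (S x)ᶜ) = p * (1 - p) ^ (M.card - 1) := by
  have hmem : ∀ x ∈ M.erase v, x ∈ M := fun x hx => Finset.mem_of_mem_erase hx
  have hd : ((M.erase v : Finset V) : Set V).PairwiseDisjoint (nodeCoords (V := V)) :=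
    fun x _ y _ h => disjoint_nodeCoords h
  rw [measureReal_inter_of_disjoint (A := nodeCoords v) (B := ⋃ x ∈ M.erase v, nodeCoords x) ?_
    (hS v hv), hp v hv]
  · rw [measureReal_def, measure_biInter_of_disjoint _ nodeCoords hd _ fun x hx =>
      (hS x (hmem x hx)).compl, ENNReal.toReal_prod]
    congr 1
    rw [← Finset.card_erase_of_mem hv, ← Finset.prod_const]
    refine Finset.prod_congr rfl fun x hx => ?_
    change (randomness V).real (S x)ᶜ = _
    rw [probReal_compl_eq_one_sub (coordSigma_le _ _ (hS x (hmem x hx))), hp x (hmem x hx)]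
  · refine Finset.measurableSet_biInter (m := coordSigma (⋃ x ∈ M.erase v, nodeCoords x)) _
      fun x hx => ?_
    exact coordSigma_mono (Set.subset_biUnion_of_mem (u := nodeCoords) hx) _ (hS x (hmem x hx)).compl
  · rw [Set.disjoint_iUnion₂_right]
    intro x hx
    exact disjoint_nodeCoords (Finset.ne_of_mem_erase hx).symm

/-- Exactly one node of `M` would broadcast in slot `t` with broadcasting probability `2 ^ (-i)`. -/
def exactlyOne (M : Finset V) (t i : ℕ) : Set (Tape V) :=
  {w | ∃! x, x ∈ M ∧ (w (x, t, 2) : ℝ) ≤ (1 / 2) ^ i}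

lemma exactlyOne_eq (M : Finset V) (t i : ℕ) :
    exactlyOne M t i = ⋃ v ∈ M, ({w : Tape V | (w (v, t, 2) : ℝ) ≤ (1 / 2) ^ i} ∩
      ⋂ x ∈ M.erase v, {w : Tape V | (w (x, t, 2) : ℝ) ≤ (1 / 2) ^ i}ᶜ) := by
  ext w
  simp only [exactlyOne, ExistsUnique, Set.mem_ofPred_eq, Set.mem_iUnion, Set.mem_inter_iff,
    Set.mem_iInter, Finset.mem_erase, Set.mem_compl_iff, exists_prop]
  constructor
  · rintro ⟨v, ⟨hv, hb⟩, h⟩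
    exact ⟨v, hv, hb, fun x hx hxb => hx.1 (h x ⟨hx.2, hxb⟩)⟩
  · rintro ⟨v, hv, hb, h⟩
    refine ⟨v, ⟨hv, hb⟩, fun x hx => ?_⟩
    by_contra hne
    exact h x ⟨hne, hx.1⟩ hx.2

lemma measurableSet_exactlyOne {A : Set (V × ℕ × ℕ)} (M : Finset V) (t i : ℕ)
    (h : ∀ x ∈ M, (x, t, 2) ∈ A) : MeasurableSet[coordSigma A] (exactlyOne M t i) := by
  rw [exactlyOne_eq]
  refine Finset.measurableSet_biUnion (m := coordSigma A) _ fun v hv => ?_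
  refine MeasurableSet.inter (m := coordSigma A) (measurableSet_bit (h v hv) _) ?_
  refine Finset.measurableSet_biInter (m := coordSigma A) _ fun x hx => ?_
  exact (measurableSet_bit (h x (Finset.mem_of_mem_erase hx)) _).compl

lemma measureReal_exactlyOne (M : Finset V) (t i : ℕ) :
    (randomness V).real (exactlyOne M t i) =
      M.card * (1 / 2) ^ i * (1 - (1 / 2) ^ i) ^ (M.card - 1) := by
  have hm : ∀ x, MeasurableSet[coordSigma (nodeCoords x)]
      {w : Tape V | (w (x, t, 2) : ℝ) ≤ (1 / 2) ^ i} := fun x =>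
    measurableSet_bit (A := nodeCoords x) (i := (x, t, 2)) rfl _
  have hm' : ∀ x, MeasurableSet {w : Tape V | (w (x, t, 2) : ℝ) ≤ (1 / 2) ^ i} := fun x =>
    coordSigma_le _ _ (hm x)
  rw [exactlyOne_eq, measureReal_biUnion_finset]
  · rw [Finset.sum_congr rfl fun v hv => measureReal_only hv
      (fun x => {w : Tape V | (w (x, t, 2) : ℝ) ≤ (1 / 2) ^ i}) ((1 / 2) ^ i) (fun x _ => hm x)
      (fun x _ => measureReal_bit _ _ (by positivity) (pow_le_one₀ (by norm_num) (by norm_num)))]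
    rw [Finset.sum_const, nsmul_eq_mul, mul_assoc]
  · intro v _ v' hv' hne
    refine Set.disjoint_left.2 fun w hw hw' => ?_
    exact Set.mem_iInter₂.1 hw.2 v' (Finset.mem_erase.2 ⟨hne.symm, hv'⟩) hw'.1
  · intro v _
    exact (hm' v).inter (Finset.measurableSet_biInter _ fun x _ => (hm' x).compl)

end Slots

/-! ### Reception of a fixed neighbor on a fixed channel. -/

section Network

variable {V Ch : Type*} {c : ℕ} (N : Network V Ch c)

lemma Network.receive_eq_some_iff (acts : V → RadioAction c) (u v : V) :
    N.receive acts u = some v ↔ ∃ l, acts u = .listen l ∧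
      ((N.graph.Adj u v ∧ ∃ l', acts v = .broadcast l' ∧ N.chan v l' = N.chan u l) ∧
      ∀ y, (N.graph.Adj u y ∧ ∃ l', acts y = .broadcast l' ∧ N.chan y l' = N.chan u l) →
        y = v) := by
  unfold Network.receive
  rcases hu : acts u with l | l | _
  · simp
  · simp only [RadioAction.listen.injEq, exists_eq_left']
    split_ifs with h
    · rw [Option.some_inj]
      constructor
      · rintro rfl
        exact ⟨h.choose_spec.1, h.choose_spec.2⟩
      · intro hv
        exact hv.2 _ h.choose_spec.1
    · simp only [false_iff]
      exact fun hv => h ⟨v, hv⟩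
  · simp

lemma Network.adj_of_receive {acts : V → RadioAction c} {u v : V}
    (h : N.receive acts u = some v) : N.graph.Adj u v := by
  rw [N.receive_eq_some_iff] at h
  obtain ⟨l, -, h, -⟩ := h
  exact h.1

/-- Node `x` broadcasts on the channel with label `l` at `u`. -/
def Network.sendsTo (u : V) (l : Fin c) (s t j : ℕ) (x : V) : Set (Tape V) :=
  {w | ∃ l', N.chan x l' = N.chan u l ∧ w ∈ sends s t j x l'}

section Local

variable {N}

lemma Network.sendsTo_eq {u : V} {l : Fin c} {x : V} {l' : Fin c}
    (h : N.chan x l' = N.chan u l) (s t j : ℕ) : N.sendsTo u l s t j x = sends s t j x l' := by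
  ext w
  constructor
  · rintro ⟨l'', h'', hw⟩
    rwa [(N.chan x).injective (h''.trans h.symm)] at hw
  · exact fun hw => ⟨l', h, hw⟩

lemma Network.measurableSet_sendsTo {A : Set (V × ℕ × ℕ)} (u : V) (l : Fin c) {s t : ℕ} (j : ℕ)
    {x : V} (h0 : (x, s, 0) ∈ A) (h1 : (x, s, 1) ∈ A) (h2 : (x, t, 2) ∈ A) :
    MeasurableSet[coordSigma A] (N.sendsTo u l s t j x) := by
  by_cases h : ∃ l', N.chan x l' = N.chan u l
  · obtain ⟨l', h⟩ := h
    rw [Network.sendsTo_eq h]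
    exact measurableSet_sends j h0 h1 h2 l'
  · have : N.sendsTo u l s t j x = ∅ := by
      ext w
      simp only [Network.sendsTo, Set.mem_ofPred_eq, Set.mem_empty_iff_false, iff_false]
      exact fun ⟨l', hl, _⟩ => h ⟨l', hl⟩
    rw [this]
    exact @MeasurableSet.empty _ (coordSigma A)

end Local

variable [Fintype V]

open Classical in
/-- The neighbors of `u` that have the channel with label `l` at `u`. -/
noncomputable def Network.holders (u : V) (l : Fin c) : Finset V :=
  Finset.univ.filter fun x => N.graph.Adj u x ∧ ∃ l', N.chan x l' = N.chan u l

open Classical in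
/-- The neighbors of `u` that are broadcasters on the channel with label `l` at `u`, if the roles
and the channels of the nodes are given by `k`. -/
noncomputable def Network.senders (u : V) (l : Fin c) (k : V → Bool × Option (Fin c)) : Finset V :=
  Finset.univ.filter fun x =>
    N.graph.Adj u x ∧ ∃ l', k x = (true, some l') ∧ N.chan x l' = N.chan u l

variable {N}

lemma Network.mem_holders {u : V} {l : Fin c} {x : V} :
    x ∈ N.holders u l ↔ N.graph.Adj u x ∧ ∃ l', N.chan x l' = N.chan u l := by
  simp [Network.holders]

lemma Network.mem_senders {u : V} {l : Fin c} {k : V → Bool × Option (Fin c)} {x : V} :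
    x ∈ N.senders u l k ↔
      N.graph.Adj u x ∧ ∃ l', k x = (true, some l') ∧ N.chan x l' = N.chan u l := by
  simp [Network.senders]

lemma Network.senders_subset_holders (u : V) (l : Fin c) (k : V → Bool × Option (Fin c)) :
    N.senders u l k ⊆ N.holders u l := fun x hx => by
  rw [Network.mem_senders] at hx
  rw [Network.mem_holders]
  exact ⟨hx.1, hx.2.imp fun _ h => h.2⟩

lemma Network.measureReal_sendsTo {u : V} {l : Fin c} {x : V} (h : x ∈ N.holders u l)
    (s t j : ℕ) :
    (randomness V).real (N.sendsTo u l s t j x) = 1 / (2 * c) * (1 / 2) ^ j := by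
  obtain ⟨-, l', h⟩ := Network.mem_holders.1 h
  rw [Network.sendsTo_eq h, measureReal_sends]

open Classical in
/-- The event that `v` is the only neighbor of `u` that broadcasts on the channel with label `l` at
`u`, while `U` holds. -/
def Network.hears (N : Network V Ch c) (u : V) (l : Fin c) (s t j : ℕ) (v : V)
    (U : Set (Tape V)) : Set (Tape V) :=
  U ∩ (N.sendsTo u l s t j v ∩ ⋂ x ∈ (N.holders u l).erase v, (N.sendsTo u l s t j x)ᶜ)

lemma Network.measurableSet_hears {A : Set (V × ℕ × ℕ)} (u : V) (l : Fin c) {s t : ℕ} (j : ℕ)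
    (v : V) {U : Set (Tape V)} (hU : MeasurableSet[coordSigma A] U) (h0 : ∀ x, (x, s, 0) ∈ A)
    (h1 : ∀ x, (x, s, 1) ∈ A) (h2 : ∀ x, (x, t, 2) ∈ A) :
    MeasurableSet[coordSigma A] (N.hears u l s t j v U) := by
  refine hU.inter (MeasurableSet.inter (m := coordSigma A)
    (Network.measurableSet_sendsTo u l j (h0 v) (h1 v) (h2 v)) ?_)
  refine Finset.measurableSet_biInter (m := coordSigma A) _ fun x _ => ?_
  exact (Network.measurableSet_sendsTo u l j (h0 x) (h1 x) (h2 x)).compl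

/-- A holder sends on this channel with probability 1/(2·c·2^j), independently of the other holders
and of `U`, which involves only the random numbers of u. With at most K·c·2^j holders, silence of
all the others costs at most the factor 2^(-K). -/
lemma Network.le_measureReal_hears {u : V} {l : Fin c} {v : V} (hv : v ∈ N.holders u l)
    (s t j : ℕ) {U : Set (Tape V)} (hU : MeasurableSet[coordSigma (nodeCoords u)] U) {K : ℕ}
    (hK : (N.holders u l).card ≤ K * (c * 2 ^ j)) :
    (randomness V).real U * (1 / (2 * c) * (1 / 2) ^ j * (1 / 2) ^ K) ≤
      (randomness V).real (N.hears u l s t j v U) := by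
  classical
  have hc : 1 ≤ c := l.pos
  have hmeas : ∀ x, MeasurableSet[coordSigma (nodeCoords x)] (N.sendsTo u l s t j x) := fun x =>
    Network.measurableSet_sendsTo u l j rfl rfl rfl
  have huv : ∀ x ∈ N.holders u l, Disjoint (nodeCoords u) (nodeCoords x) := fun x hx =>
    disjoint_nodeCoords (Network.mem_holders.1 hx).1.ne
  have hsub : ∀ x ∈ N.holders u l, MeasurableSet[coordSigma (⋃ x ∈ N.holders u l, nodeCoords x)]
      (N.sendsTo u l s t j x) := fun x hx =>
    coordSigma_mono (Set.subset_biUnion_of_mem (u := nodeCoords) hx) _ (hmeas x)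
  rw [Network.hears, measureReal_inter_of_disjoint (A := nodeCoords u)
    (B := ⋃ x ∈ N.holders u l, nodeCoords x) (Set.disjoint_iUnion₂_right.2 huv) hU]
  · refine mul_le_mul_of_nonneg_left ?_ measureReal_nonneg
    have h1 := measureReal_only hv (N.sendsTo u l s t j) (1 / (2 * c) * (1 / 2) ^ j)
      (fun x _ => hmeas x) (fun x hx => Network.measureReal_sendsTo hx s t j)
    have h2 : (1 : ℝ) / (2 * c) * (1 / 2) ^ j = 1 / (2 * (c * 2 ^ j : ℕ)) := by
      push_cast; rw [one_div_pow]; field_simp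
    have h3 := half_pow_le_one_sub_pow (N := c * 2 ^ j) (n := (N.holders u l).card - 1) (K := K)
      (Nat.mul_pos hc (by positivity)) ((Nat.sub_le _ _).trans hK)
    rw [← h2] at h3
    refine le_trans ?_ (le_of_eq (Eq.trans h1.symm ?_))
    · exact mul_le_mul_of_nonneg_left h3 (by positivity)
    · congr!
  · refine MeasurableSet.inter (m := coordSigma _) (hsub v hv) ?_
    refine Finset.measurableSet_biInter (m := coordSigma _) _ fun x hx => ?_
    exact (hsub x (Finset.mem_of_mem_erase hx)).compl

end Network

/-! ### The run of the protocol as an explicit function of the tape. -/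

namespace CKSeek

lemma countEstimate_congr {R L : ℕ} {thr : ℝ} {h h' : ℕ → ℕ} (hh : ∀ i < R, h i = h' i) :
    countEstimate R L thr h = countEstimate R L thr h' := by
  have h1 : ∀ i, (i < R ∧ thr * L < h i) ↔ (i < R ∧ thr * L < h' i) := fun i =>
    and_congr_right fun hi => by rw [hh i hi]
  unfold countEstimate
  simp only [h1]

lemma countEstimate_eq_zero {R L : ℕ} {thr : ℝ} (hthr : 0 ≤ thr) :
    countEstimate R L thr (fun _ => 0) = 0 := by
  unfold countEstimate
  rw [dif_neg]
  rintro ⟨i, -, h⟩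
  have : 0 ≤ thr * L := by positivity
  simp only [Nat.cast_zero] at h
  linarith

lemma countEstimate_le_of_round {R L : ℕ} {thr : ℝ} {h : ℕ → ℕ} {i : ℕ} (hi : i < R)
    (hh : thr * L < h i) : countEstimate R L thr h ≤ 4 * 2 ^ i := by
  unfold countEstimate
  split_ifs with hex
  · rw [pow_add, mul_comm]
    exact Nat.mul_le_mul_left _ (Nat.pow_le_pow_right (by norm_num) (Nat.find_min' hex ⟨hi, hh⟩))
  · exact Nat.zero_le _

lemma countEstimate_le {R L : ℕ} {thr : ℝ} (hR : 1 ≤ R) (h : ℕ → ℕ) :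
    countEstimate R L thr h ≤ 4 * 2 ^ (R - 1) := by
  unfold countEstimate
  split_ifs with hex
  · rw [pow_add, mul_comm]
    have := (Nat.find_spec hex).1
    exact Nat.mul_le_mul_left _ (Nat.pow_le_pow_right (by norm_num) (by omega))
  · exact Nat.zero_le _

/-- If some round is above the threshold and all rounds with a small guess are not, then the
estimate is large. -/
lemma le_countEstimate {R L : ℕ} {thr : ℝ} {h : ℕ → ℕ} {i m : ℕ} (hi : i < R)
    (hh : thr * L < h i) (hsmall : ∀ j < R, 8 * 2 ^ j ≤ m → ¬ thr * L < h j) :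
    m ≤ 2 * countEstimate R L thr h := by
  unfold countEstimate
  have hex : ∃ i, i < R ∧ thr * L < h i := ⟨i, hi, hh⟩
  rw [dif_pos hex]
  have h1 := Nat.find_spec hex
  by_contra hlt
  refine hsmall _ h1.1 ?_ h1.2
  rw [pow_add] at hlt
  omega

section Arithmetic

variable {T₁ R L q i s : ℕ}

lemma slot_lt_step (hi : i < R) (hs : s < L) : i * L + s < R * L := by
  have : (i + 1) * L ≤ R * L := Nat.mul_le_mul_right _ hi
  rw [Nat.succ_mul] at this
  omega

lemma slot_lt_partOne (hq : q < T₁) (hi : i < R) (hs : s < L) :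
    q * (R * L) + i * L + s < T₁ * (R * L) := by
  rw [add_assoc]
  exact slot_lt_step hq (slot_lt_step hi hs)

lemma slot_div (hi : i < R) (hs : s < L) : (q * (R * L) + i * L + s) / (R * L) = q := by
  have h := slot_lt_step hi hs
  rw [add_assoc, mul_comm q, Nat.mul_add_div (by omega), Nat.div_eq_of_lt h, add_zero]

lemma slot_mod_div (hi : i < R) (hs : s < L) :
    (q * (R * L) + i * L + s) % (R * L) / L = i := by
  have h := slot_lt_step hi hs
  rw [add_assoc, mul_comm q, Nat.mul_add_mod, Nat.mod_eq_of_lt h, mul_comm i,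
    Nat.mul_add_div (by omega), Nat.div_eq_of_lt hs, add_zero]

end Arithmetic

variable {V Ch : Type*} {c : ℕ}

lemma partOne_eq_listen_iff {R L : ℕ} (w : Tape V) (x : V) (t : ℕ) (l : Fin c) :
    partOne R L c (fun i => w (x, i)) t = .listen l ↔
      choice c w (t / (R * L) * (R * L)) x = (false, some l) := by
  unfold partOne choice broadcastWithProb
  rcases uniformLabel c (fun i => w (x, i)) (t / (R * L) * (R * L)) with _ | l'
  · simp
  · simp only [Prod.mk.injEq, Option.some_inj]
    cases isBroadcaster (fun i => w (x, i)) (t / (R * L) * (R * L)) <;> simp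
    split_ifs <;> simp

lemma partOne_eq_broadcast_iff {R L : ℕ} (w : Tape V) (x : V) (t : ℕ) (l : Fin c) :
    partOne R L c (fun i => w (x, i)) t = .broadcast l ↔
      w ∈ sends (t / (R * L) * (R * L)) t (t % (R * L) / L) x l := by
  unfold partOne sends choice broadcastWithProb
  simp only [Set.mem_ofPred_eq]
  rcases uniformLabel c (fun i => w (x, i)) (t / (R * L) * (R * L)) with _ | l'
  · simp
  · simp only [Prod.mk.injEq, Option.some_inj]
    cases isBroadcaster (fun i => w (x, i)) (t / (R * L) * (R * L))
    · simp
    · simp only [if_true, true_and]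
      split_ifs with h <;> simp [h, -one_div]

lemma partTwo_eq_listen_iff {T R : ℕ} (cnt : Fin c → ℕ) (w : Tape V) (x : V) (t : ℕ)
    (l : Fin c) : partTwo T R cnt (fun i => w (x, i)) t = .listen l ↔
      isBroadcaster (fun i => w (x, i)) (T + t / R * R) = false ∧
        pick cnt (w (x, T + t / R * R, 1)) = some l := by
  unfold partTwo broadcastWithProb
  cases isBroadcaster (fun i => w (x, i)) (T + t / R * R)
  · simp only [Bool.false_eq_true, if_false, true_and]
    rcases pick cnt (w (x, T + t / R * R, 1)) with _ | l' <;> simp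
  · rcases uniformLabel c (fun i => w (x, i)) (T + t / R * R) with _ | l'
    · simp
    · simp only [if_true]
      split_ifs <;> simp

/-- The right side does not involve `cnt`: broadcasting ignores what was heard. Hence only the
counts of the listener itself matter for what it hears in part two. -/
lemma partTwo_eq_broadcast_iff {T R : ℕ} (cnt : Fin c → ℕ) (w : Tape V) (x : V) (t : ℕ)
    (l : Fin c) : partTwo T R cnt (fun i => w (x, i)) t = .broadcast l ↔
      w ∈ sends (T + t / R * R) (T + t) (R - t % R) x l := by
  unfold partTwo sends choice broadcastWithProb
  simp only [Set.mem_ofPred_eq, Prod.mk.injEq]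
  cases isBroadcaster (fun i => w (x, i)) (T + t / R * R)
  · rcases pick cnt (w (x, T + t / R * R, 1)) with _ | l' <;> simp
  · simp only [if_true, true_and]
    rcases uniformLabel c (fun i => w (x, i)) (T + t / R * R) with _ | l'
    · simp
    · simp only [Option.some_inj]
      split_ifs with h <;> simp [h, -one_div]

variable (N : Network V Ch c) {T₁ T₂ R L : ℕ} {thr : ℝ}

lemma heard_partOne (w : Tape V) {t : ℕ} (ht : t < T₁ * (R * L)) (u : V) :
    (protocol V c T₁ T₂ R L thr).heard N w t u =
      N.receive (fun x => partOne R L c (fun i => w (x, i)) t) u := by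
  rw [Protocol.heard]
  congr 1
  funext x
  simp [protocol, ht]

lemma discovered_subset (w : Tape V) (P : Protocol V c) (u : V) :
    P.discovered N w u ⊆ N.graph.neighborSet u := by
  rintro v ⟨t, -, h⟩
  rw [Protocol.heard] at h
  exact N.adj_of_receive h

variable [Fintype V]

lemma receive_eq_some_of_hears {acts : V → RadioAction c} {w : Tape V} {u v : V} {l : Fin c}
    {s t j : ℕ} {U : Set (Tape V)} (hv : v ∈ N.holders u l) (hu : acts u = .listen l)
    (hb : ∀ x l', acts x = .broadcast l' ↔ w ∈ sends s t j x l')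
    (hw : w ∈ N.hears u l s t j v U) : N.receive acts u = some v := by
  classical
  rw [N.receive_eq_some_iff]
  obtain ⟨-, ⟨l', hl', hs⟩, hother⟩ := hw
  refine ⟨l, hu, ⟨(Network.mem_holders.1 hv).1, l', (hb v l').2 hs, hl'⟩, ?_⟩
  rintro y ⟨hy, l'', hy', hl''⟩
  by_contra hne
  refine Set.mem_iInter₂.1 hother y ?_ ⟨l'', hl'', (hb y l'').1 hy'⟩
  exact Finset.mem_erase.2 ⟨hne, Network.mem_holders.2 ⟨hy, l'', hl''⟩⟩

open Classical in
/-- The estimate of the counting procedure that starts in slot `b`, if `M` is the set of the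
broadcasting neighbors of the listener on its channel. -/
noncomputable def stepEstimate (R L : ℕ) (thr : ℝ) (M : Finset V) (b : ℕ) (w : Tape V) : ℕ :=
  countEstimate R L thr fun i =>
    ((Finset.range L).filter fun s => w ∈ exactlyOne M (b + i * L + s) i).card

open Classical in
/-- The total count of node `u` for its label `l`. -/
noncomputable def channelCount (T₁ R L : ℕ) (thr : ℝ) (u : V) (w : Tape V) (l : Fin c) : ℕ :=
  ∑ q ∈ Finset.range T₁,
    if choice c w (q * (R * L)) u = (false, some l) then
      stepEstimate R L thr (N.senders u l (choice c w (q * (R * L)))) (q * (R * L)) w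
    else 0

/-- Actions in part one ignore the history, and the roles and channels are fixed during a step. A
slot thus carries a message iff exactly one bit of the fixed set of broadcasters is favorable. -/
lemma isSome_heard_iff (w : Tape V) {q i s : ℕ} (hq : q < T₁) (hi : i < R) (hs : s < L) (u : V) :
    ((protocol V c T₁ T₂ R L thr).heard N w (q * (R * L) + i * L + s) u).isSome = true ↔
      ∃ l, choice c w (q * (R * L)) u = (false, some l) ∧
        w ∈ exactlyOne (N.senders u l (choice c w (q * (R * L)))) (q * (R * L) + i * L + s) i := by
  rw [heard_partOne N w (slot_lt_partOne hq hi hs), Option.isSome_iff_exists]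
  simp only [Network.receive_eq_some_iff, partOne_eq_listen_iff, partOne_eq_broadcast_iff,
    slot_div hi hs, slot_mod_div hi hs]
  rw [exists_comm]
  refine exists_congr fun l => ?_
  simp only [exists_and_left]
  refine and_congr_right fun _ => ?_
  simp only [exactlyOne, ExistsUnique, Set.mem_ofPred_eq]
  have h1 : ∀ x, (N.graph.Adj u x ∧ ∃ l', w ∈ sends (q * (R * L)) (q * (R * L) + i * L + s) i x l'
      ∧ N.chan x l' = N.chan u l) ↔ (x ∈ N.senders u l (choice c w (q * (R * L))) ∧
        (w (x, q * (R * L) + i * L + s, 2) : ℝ) ≤ (1 / 2) ^ i) := by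
    intro x
    simp only [Network.mem_senders, sends, Set.mem_ofPred_eq]
    constructor
    · rintro ⟨h1, l', ⟨h2, h3⟩, h4⟩
      exact ⟨⟨h1, l', h2, h4⟩, h3⟩
    · rintro ⟨⟨h1, l', h2, h4⟩, h3⟩
      exact ⟨h1, l', ⟨h2, h3⟩, h4⟩
  simp only [h1]

/-- This removes the recursion through the history: the counts used in part two become an explicit
function of the tape. -/
lemma totalCount_eq (w : Tape V) {t : ℕ} (ht : T₁ * (R * L) ≤ t) (u : V) :
    totalCount (c := c) T₁ R L thr (fun i => w (u, i))
      (fun s => if s < t then (protocol V c T₁ T₂ R L thr).heard N w s u else none) =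
    channelCount N T₁ R L thr u w := by
  funext l
  unfold totalCount channelCount
  refine Finset.sum_congr rfl fun q hq => ?_
  have hq' := Finset.mem_range.1 hq
  have hch : (isBroadcaster (fun i => w (u, i)) (q * (R * L)) = false ∧
      uniformLabel c (fun i => w (u, i)) (q * (R * L)) = some l) ↔
      choice c w (q * (R * L)) u = (false, some l) := by
    simp [choice]
  by_cases h : choice c w (q * (R * L)) u = (false, some l)
  · rw [if_pos (hch.2 h), if_pos h]
    refine countEstimate_congr fun i hi => ?_
    congr 1
    ext s
    simp only [Finset.mem_filter, Finset.mem_range]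
    refine and_congr_right fun hs => ?_
    rw [if_pos ((slot_lt_partOne hq' hi hs).trans_le ht), isSome_heard_iff N w hq' hi hs]
    constructor
    · rintro ⟨l', h1, h2⟩
      rw [h] at h1
      simp only [Prod.mk.injEq, Option.some_inj, true_and] at h1
      rwa [h1]
    · exact fun h2 => ⟨l, h, h2⟩
  · rw [if_neg (fun h' => h (hch.1 h')), if_neg h]

lemma heard_partTwo (w : Tape V) (t : ℕ) (u : V) :
    (protocol V c T₁ T₂ R L thr).heard N w (T₁ * (R * L) + t) u =
      N.receive (fun x => partTwo (T₁ * (R * L)) R (channelCount N T₁ R L thr x w)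
        (fun i => w (x, i)) t) u := by
  rw [Protocol.heard]
  congr 1
  funext x
  rw [← totalCount_eq (T₂ := T₂) N w (Nat.le_add_right (T₁ * (R * L)) t) x]
  simp [protocol]

/-- What node `u` hears in part one is discovered. -/
lemma mem_discovered_of_partOne {w : Tape V} {u v : V} {q : ℕ} (hq : q < T₁) (hR : 1 ≤ R)
    (hL : 1 ≤ L) {l : Fin c} (hv : v ∈ N.holders u l) {U : Set (Tape V)}
    (hU : choice c w (q * (R * L)) u = (false, some l))
    (hw : w ∈ N.hears u l (q * (R * L)) (q * (R * L)) 0 v U) :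
    v ∈ (protocol V c T₁ T₂ R L thr).discovered N w u := by
  have hlt : q * (R * L) < T₁ * (R * L) := by
    simpa using slot_lt_partOne (q := q) (T₁ := T₁) (i := 0) (s := 0) hq hR hL
  have h1 : q * (R * L) / (R * L) = q := by
    simpa using slot_div (q := q) (i := 0) (s := 0) hR hL
  have h2 : q * (R * L) % (R * L) / L = 0 := by
    simp
  refine ⟨q * (R * L), hlt.trans_le (Nat.le_add_right _ _), ?_⟩
  rw [heard_partOne N w hlt]
  refine receive_eq_some_of_hears N hv ?_ (fun x l' => ?_) hw
  · rw [partOne_eq_listen_iff, h1, hU]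
  · rw [partOne_eq_broadcast_iff, h1, h2]

/-- What node `u` hears in part two is discovered. -/
lemma mem_discovered_of_partTwo {w : Tape V} {u v : V} {q i : ℕ} (hq : q < T₂) (hi : i < R)
    {l : Fin c} (hv : v ∈ N.holders u l) {U : Set (Tape V)}
    (hrole : isBroadcaster (fun i => w (u, i)) (T₁ * (R * L) + q * R) = false)
    (hpick : pick (channelCount N T₁ R L thr u w) (w (u, T₁ * (R * L) + q * R, 1)) = some l)
    (hw : w ∈ N.hears u l (T₁ * (R * L) + q * R) (T₁ * (R * L) + q * R + i) (R - i) v U) :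
    v ∈ (protocol V c T₁ T₂ R L thr).discovered N w u := by
  have hdiv : (q * R + i) / R = q := by
    rw [mul_comm q, Nat.mul_add_div (by omega), Nat.div_eq_of_lt hi, add_zero]
  have hmod : (q * R + i) % R = i := by
    rw [mul_comm q, Nat.mul_add_mod, Nat.mod_eq_of_lt hi]
  refine ⟨T₁ * (R * L) + (q * R + i), Nat.add_lt_add_left (slot_lt_step hq hi) _, ?_⟩
  rw [heard_partTwo]
  refine receive_eq_some_of_hears N hv ?_ (fun x l' => ?_) hw
  · rw [partTwo_eq_listen_iff, hdiv]
    exact ⟨hrole, hpick⟩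
  · rw [partTwo_eq_broadcast_iff, hdiv, hmod, add_assoc]

end CKSeek

/-! ### Disjoint blocks of time slots. -/

section Blocks

variable {V : Type*}

/-- The random numbers of the slots from `a` to `b - 1`. -/
def slotCoords (V : Type*) (a b : ℕ) : Set (V × ℕ × ℕ) := {i | a ≤ i.2.1 ∧ i.2.1 < b}

lemma mem_slotCoords {a b : ℕ} {x : V} {t m : ℕ} (h1 : a ≤ t) (h2 : t < b) :
    (x, t, m) ∈ slotCoords V a b := ⟨h1, h2⟩

lemma disjoint_slotCoords {a b a' b' : ℕ} (h : b ≤ a') :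
    Disjoint (slotCoords V a b) (slotCoords V a' b') :=
  Set.disjoint_left.2 fun _ h1 h2 => absurd (h1.2.trans_le (h.trans h2.1)) (lt_irrefl _)

lemma pairwiseDisjoint_steps (V : Type*) (T K : ℕ) (s : Set ℕ) :
    s.PairwiseDisjoint fun q => slotCoords V (T + q * K) (T + (q + 1) * K) := by
  intro q _ q' _ hne
  rcases lt_or_gt_of_ne hne with h | h
  · exact disjoint_slotCoords (Nat.add_le_add_left (Nat.mul_le_mul_right _ h) _)
  · exact (disjoint_slotCoords (Nat.add_le_add_left (Nat.mul_le_mul_right _ h) _)).symm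

end Blocks

/-! ### Part one on sparse channels, and the accuracy of the counting procedure. -/

namespace CKSeek

variable {V Ch : Type*} {c : ℕ} [Fintype V] {N : Network V Ch c}

/-- The probability that `u` hears `v` on one of the channels in `Λ`. -/
lemma le_measureReal_biUnion_hears {u v : V} (Λ : Finset (Fin c))
    (hΛ : ∀ l ∈ Λ, v ∈ N.holders u l) (s : ℕ) (t j : Fin c → ℕ) (U : Fin c → Set (Tape V))
    (hU : ∀ l ∈ Λ, MeasurableSet[coordSigma (nodeCoords u)] (U l))
    (hd : (Λ : Set (Fin c)).PairwiseDisjoint U) {K : ℕ}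
    (hK : ∀ l ∈ Λ, (N.holders u l).card ≤ K * (c * 2 ^ j l)) :
    ∑ l ∈ Λ, (randomness V).real (U l) * (1 / (2 * c) * (1 / 2) ^ j l * (1 / 2) ^ K) ≤
      (randomness V).real (⋃ l ∈ Λ, N.hears u l s (t l) (j l) v (U l)) := by
  rw [measureReal_biUnion_finset]
  · exact Finset.sum_le_sum fun l hl =>
      Network.le_measureReal_hears (hΛ l hl) s (t l) (j l) (hU l hl) (hK l hl)
  · intro l hl l' hl' hne
    exact (hd hl hl' hne).mono (fun _ hw => hw.1) (fun _ hw => hw.1)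
  · intro l hl
    refine coordSigma_le Set.univ _ (Network.measurableSet_hears u l _ v ?_ ?_ ?_ ?_)
    · exact coordSigma_mono (Set.subset_univ _) _ (hU l hl)
    all_goals exact fun _ => Set.mem_univ _

variable {T₁ T₂ R L : ℕ} {thr : ℝ}

/-- Part one discovers a neighbor on the shared channels with few holders. -/
lemma measureReal_not_discovered_partOne_le (hR : 1 ≤ R) (hL : 1 ≤ L) {u v : V}
    (Λ : Finset (Fin c)) (hΛ : ∀ l ∈ Λ, v ∈ N.holders u l)
    (hK : ∀ l ∈ Λ, (N.holders u l).card ≤ 16 * c) :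
    (randomness V).real {w | v ∉ (protocol V c T₁ T₂ R L thr).discovered N w u} ≤
      Real.exp (-(T₁ * (Λ.card * (1 / (2 * c) * (1 / (2 * c) * (1 / 2) ^ 16))))) := by
  have hRL : 0 < R * L := Nat.mul_pos hR hL
  -- Only the first slot of each step is used; its exponent is 0, so all broadcasters transmit. A
  -- listener is on one label only, so the events for different labels are disjoint and their
  -- probabilities add up.
  set E : ℕ → Set (Tape V) := fun q => ⋃ l ∈ Λ,
    N.hears u l (q * (R * L)) (q * (R * L)) 0 v
      {w | choice c w (q * (R * L)) u = (false, some l)} with hE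
  have h1 := no_success_le (Finset.range T₁)
    (fun q => slotCoords V (0 + q * (R * L)) (0 + (q + 1) * (R * L)))
    (pairwiseDisjoint_steps V 0 (R * L) _) E (fun q _ => ?_)
    (Λ.card * (1 / (2 * c) * (1 / (2 * c) * (1 / 2) ^ 16))) (fun q _ => ?_)
  · rw [Finset.card_range] at h1
    refine le_trans (measureReal_mono fun w hw => ?_) h1
    refine Set.mem_iInter₂.2 fun q hq hmem => hw ?_
    obtain ⟨l, hl, hmem⟩ := Set.mem_iUnion₂.1 hmem
    exact mem_discovered_of_partOne N (Finset.mem_range.1 hq) hR hL (hΛ l hl) hmem.1 hmem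
  · have hmem : ∀ (x : V) (m : ℕ), (x, q * (R * L), m) ∈
        slotCoords V (0 + q * (R * L)) (0 + (q + 1) * (R * L)) := fun x m =>
      mem_slotCoords (by omega) (by rw [Nat.succ_mul]; omega)
    refine Finset.measurableSet_biUnion (m := coordSigma _) _ fun l _ => ?_
    exact Network.measurableSet_hears u l 0 v (measurableSet_choice (hmem _ _) (hmem _ _) _)
      (fun _ => hmem _ _) (fun _ => hmem _ _) (fun _ => hmem _ _)
  · have h2 := le_measureReal_biUnion_hears Λ hΛ (q * (R * L)) (fun _ => q * (R * L)) (fun _ => 0)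
      (fun l => {w | choice c w (q * (R * L)) u = (false, some l)})
      (fun l _ => measurableSet_choice (A := nodeCoords u) (x := u) rfl rfl _) ?_ (K := 16) (fun l hl => by simpa using hK l hl)
    · simp only [measureReal_choice, pow_zero, mul_one, Finset.sum_const, nsmul_eq_mul] at h2
      exact h2
    · intro l _ l' _ hne
      refine Set.disjoint_left.2 fun w hw hw' => hne ?_
      simp only [Set.mem_ofPred_eq] at hw hw'
      rw [hw] at hw'
      simpa using hw'

open Classical in
/-- In round `i` of the counting procedure starting in slot `b`, messages are heard in more than a
fraction `thr` of the slots. -/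
def loudRound (L : ℕ) (thr : ℝ) (M : Finset V) (b i : ℕ) : Set (Tape V) :=
  {w | thr * L < ((Finset.range L).filter fun s => w ∈ exactlyOne M (b + i * L + s) i).card}

omit [Fintype V] in
open Classical in
lemma mem_loudRound {M : Finset V} {b i : ℕ} {w : Tape V} : w ∈ loudRound L thr M b i ↔
    thr * L < ((Finset.range L).filter fun s => w ∈ exactlyOne M (b + i * L + s) i).card :=
  Iff.rfl

lemma two_pow_clog_le {m : ℕ} (hm : 1 ≤ m) : 2 ^ Nat.clog 2 m ≤ 2 * m := by
  rcases Nat.lt_or_ge m 2 with h | h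
  · have : m = 1 := by omega
    simp [this]
  · have h1 := Nat.pow_pred_clog_lt_self (b := 2) (by norm_num) (by omega : 1 < m)
    obtain ⟨k, hk⟩ := Nat.exists_eq_succ_of_ne_zero
      (Nat.clog_pos (b := 2) (by norm_num) (by omega : 2 ≤ m)).ne'
    rw [hk, Nat.pred_succ] at h1
    rw [hk, Nat.succ_eq_add_one, pow_succ]
    omega

lemma pairwiseDisjoint_slots (V : Type*) (T : ℕ) (s : Set ℕ) :
    s.PairwiseDisjoint fun q => slotCoords V (T + q) (T + q + 1) := by
  simpa [add_assoc] using pairwiseDisjoint_steps V T 1 s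

omit [Fintype V] in
lemma measurableSet_exactlyOne_slot (M : Finset V) (t i : ℕ) :
    MeasurableSet[coordSigma (slotCoords V t (t + 1))] (exactlyOne M t i) := by
  classical
  exact measurableSet_exactlyOne M t i fun x _ => mem_slotCoords le_rfl (Nat.lt_succ_self t)

omit [Fintype V] in
-- A slot succeeds with probability at least 1/32, and 1/128 is a quarter of that, as in the lower
-- tail bound `few_successes_le`.
lemma measureReal_not_loudRound_le {M : Finset V} {i : ℕ} (b : ℕ) (hthr : thr ≤ 1 / 128)
    (h1 : M.card ≤ 2 * 2 ^ i) (h2 : 2 ^ i ≤ 2 * M.card) (h3 : i = 0 → M.card = 1) :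
    (randomness V).real (loudRound L thr M b i)ᶜ ≤ Real.exp (-(L / 96)) := by
  classical
  have h4 := few_successes_le (Finset.range L) _ (pairwiseDisjoint_slots V (b + i * L) _)
    (fun s => exactlyOne M (b + i * L + s) i) (fun s _ => measurableSet_exactlyOne_slot M _ i)
    (1 / 32) (by norm_num)
    (fun s _ => (le_single_sender_prob h1 h2 h3).trans_eq (measureReal_exactlyOne M _ i).symm)
  rw [Finset.card_range] at h4
  refine le_trans (measureReal_mono fun w hw => ?_) (h4.trans_eq ?_)
  · have hw' := not_lt.1 fun h => hw (mem_loudRound.2 h)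
    have hL : (0 : ℝ) ≤ L := Nat.cast_nonneg _
    simp only [Set.mem_ofPred_eq]
    refine le_trans ?_ (hw'.trans ?_)
    · convert le_rfl
    · nlinarith
  · congr 1; ring

omit [Fintype V] in
-- The guess is too small by a factor of at least 8, so collisions keep the success probability
-- below 8e^(-7); the factor 1 + δ is the room for the upper tail bound.
lemma measureReal_loudRound_le {M : Finset V} {i : ℕ} (b : ℕ) {δ : ℝ} (hδ : 0 < δ) (hδ1 : δ ≤ 1)
    (hthr : thr = (1 + δ) * (8 * Real.exp (-7))) (h : 8 * 2 ^ i ≤ M.card) :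
    (randomness V).real (loudRound L thr M b i) ≤
      Real.exp (-(L * (8 * Real.exp (-7)) * δ ^ 2 / 4)) := by
  classical
  have h4 := many_successes_le (Finset.range L) _ (pairwiseDisjoint_slots V (b + i * L) _)
    (fun s => exactlyOne M (b + i * L + s) i) (fun s _ => measurableSet_exactlyOne_slot M _ i)
    (8 * Real.exp (-7)) δ (by positivity) hδ hδ1
    (fun s _ => (measureReal_exactlyOne M _ i).trans_le (single_sender_prob_le h))
  rw [Finset.card_range] at h4
  refine le_trans (measureReal_mono fun w hw => ?_) h4
  rw [← hthr]
  refine (le_of_lt (mem_loudRound.1 hw)).trans ?_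
  convert le_rfl

omit [Fintype V] in
/-- The counting procedure hardly ever overestimates. -/
lemma measureReal_overestimate_le {M : Finset V} (b : ℕ) (hthr : thr ≤ 1 / 128) (hR : 1 ≤ R)
    (hM : 1 ≤ M.card) :
    (randomness V).real {w | 8 * M.card < stepEstimate R L thr M b w} ≤
      Real.exp (-(L / 96)) := by
  have hclog := two_pow_clog_le hM
  have hle : M.card ≤ 2 ^ Nat.clog 2 M.card := Nat.le_pow_clog (by norm_num) _
  -- The decisive round has as its guess the least power of two that is at least the number of
  -- broadcasters. If this round is beyond the last one, even the largest possible estimate is small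
  -- enough.
  rcases lt_or_ge (Nat.clog 2 M.card) R with h | h
  · refine le_trans (measureReal_mono fun w hw => ?_)
      (measureReal_not_loudRound_le b hthr (i := Nat.clog 2 M.card) (by omega) hclog ?_)
    · intro hloud
      have h1 : stepEstimate R L thr M b w ≤ _ :=
        countEstimate_le_of_round h (mem_loudRound.1 hloud)
      simp only [Set.mem_ofPred_eq] at hw
      omega
    · intro h0
      rw [h0] at hle
      omega
  · have h1 : {w | 8 * M.card < stepEstimate R L thr M b w} = ∅ := by
      refine Set.eq_empty_iff_forall_notMem.2 fun w hw => ?_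
      have h2 : stepEstimate R L thr M b w ≤ 4 * 2 ^ (R - 1) := countEstimate_le hR _
      have h3 : 2 ^ R ≤ 2 ^ Nat.clog 2 M.card := Nat.pow_le_pow_right (by norm_num) h
      have h4 : 2 ^ R = 2 * 2 ^ (R - 1) := by
        rw [← pow_succ', Nat.sub_add_cancel hR]
      simp only [Set.mem_ofPred_eq] at hw
      omega
    rw [h1, measureReal_empty]
    positivity

omit [Fintype V] in
/-- The counting procedure rarely underestimates. -/
lemma measureReal_underestimate_le {M : Finset V} (b : ℕ) {δ : ℝ} (hδ : 0 < δ) (hδ1 : δ ≤ 1)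
    (hthr : thr = (1 + δ) * (8 * Real.exp (-7))) (hthr' : thr ≤ 1 / 128) (hR : 2 ≤ R)
    (hM : 2 ≤ M.card) (hMR : M.card ≤ 2 ^ R) :
    (randomness V).real {w | 2 * stepEstimate R L thr M b w < M.card} ≤
      Real.exp (-(L / 96)) + R * Real.exp (-(L * (8 * Real.exp (-7)) * δ ^ 2 / 4)) := by
  classical
  have hle : M.card ≤ 2 ^ Nat.clog 2 M.card := Nat.le_pow_clog (by norm_num) _
  have hcpos : 0 < Nat.clog 2 M.card := Nat.clog_pos (by norm_num) (by omega)
  have hclog := two_pow_clog_le (m := M.card) (by omega)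
  -- Some round must be loud for the estimate not to be 0: the one with the rounded-up guess, or the
  -- last one if that does not exist. Round 0 would not do, since two or more broadcasters always
  -- collide in it.
  obtain ⟨i, hiR, hi0, hi1, hi2⟩ : ∃ i, i < R ∧ i ≠ 0 ∧ M.card ≤ 2 * 2 ^ i ∧ 2 ^ i ≤ 2 * M.card := by
    rcases lt_or_ge (Nat.clog 2 M.card) R with h | h
    · exact ⟨_, h, hcpos.ne', by omega, hclog⟩
    · refine ⟨R - 1, by omega, by omega, ?_, ?_⟩
      · rwa [← pow_succ', Nat.sub_add_cancel (by omega)]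
      · exact (Nat.pow_le_pow_right (by norm_num) (by omega)).trans hclog
  have hsub : {w | 2 * stepEstimate R L thr M b w < M.card} ⊆ (loudRound L thr M b i)ᶜ ∪
      ⋃ j ∈ (Finset.range R).filter (fun j => 8 * 2 ^ j ≤ M.card), loudRound L thr M b j := by
    intro w hw
    by_contra hcon
    rw [Set.mem_union, not_or, Set.notMem_compl_iff] at hcon
    have h1 := le_countEstimate (m := M.card) hiR hcon.1 fun j hj hj8 hloud =>
      hcon.2 (Set.mem_iUnion₂.2 ⟨j, by simp [hj, hj8], hloud⟩)
    exact absurd h1 (not_le.2 hw)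
  refine (measureReal_mono hsub).trans ((measureReal_union_le _ _).trans (add_le_add ?_ ?_))
  · exact measureReal_not_loudRound_le b hthr' hi1 hi2 (fun h => absurd h hi0)
  · refine (measureReal_biUnion_finset_le _ _).trans ?_
    refine (Finset.sum_le_sum fun j hj => measureReal_loudRound_le b hδ hδ1 hthr
      (Finset.mem_filter.1 hj).2).trans ?_
    rw [Finset.sum_const, nsmul_eq_mul]
    gcongr
    exact_mod_cast (Finset.card_filter_le _ _).trans_eq (Finset.card_range R)

omit [Fintype V] in
-- Without broadcasters nothing is heard, and the threshold has to be exceeded strictly.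
lemma stepEstimate_empty (hthr : 0 ≤ thr) (b : ℕ) (w : Tape V) :
    stepEstimate R L thr (∅ : Finset V) b w = 0 := by
  rw [← countEstimate_eq_zero (R := R) (L := L) hthr]
  refine countEstimate_congr fun i _ => ?_
  simp [exactlyOne, ExistsUnique]

omit [Fintype V] in
lemma measurable_stepEstimate {A : Set (V × ℕ × ℕ)} (M : Finset V) (b : ℕ)
    (hA : ∀ x t, b ≤ t → t < b + R * L → (x, t, 2) ∈ A) :
    Measurable[coordSigma A] (stepEstimate R L thr M b) := by
  classical
  have hD : Measurable[coordSigma A] fun (w : Tape V) (i : Fin R) =>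
      ∑ s ∈ Finset.range L, if w ∈ exactlyOne M (b + i * L + s) i then 1 else 0 := by
    refine @measurable_pi_lambda _ _ _ (coordSigma A) _ _ fun i => ?_
    refine Finset.measurable_fun_sum (m := coordSigma A) _ fun s hs => ?_
    refine Measurable.ite (m := coordSigma A) ?_ measurable_const measurable_const
    refine measurableSet_exactlyOne M _ _ fun x _ => hA x _ (by omega) ?_
    have := slot_lt_step i.2 (Finset.mem_range.1 hs)
    omega
  let g : (Fin R → ℕ) → ℕ := fun d => countEstimate R L thr fun i =>
    if hi : i < R then d ⟨i, hi⟩ else 0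
  have hg : Measurable g := Measurable.of_discrete
  have h1 : stepEstimate R L thr M b = fun w => g fun i : Fin R =>
      ∑ s ∈ Finset.range L, if w ∈ exactlyOne M (b + i * L + s) i then 1 else 0 := by
    funext w
    refine countEstimate_congr fun i hi => ?_
    rw [dif_pos hi, Finset.card_filter]
  rw [h1]
  exact hg.comp hD

end CKSeek

/-! ### Conditioning on discrete variables, and Markov's inequality. -/

section Tools

variable {V κ : Type*}

lemma measureReal_conditional_le [Countable κ] {A B : Set (V × ℕ × ℕ)} (h : Disjoint A B)
    (X : Tape V → κ) (hX : ∀ k, MeasurableSet[coordSigma A] {w | X w = k}) (G : Set κ)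
    (E : κ → Set (Tape V)) (hE : ∀ k, MeasurableSet[coordSigma B] (E k)) (b : ℝ) (hb0 : 0 ≤ b)
    (hb : ∀ k ∈ G, (randomness V).real (E k) ≤ b) :
    (randomness V).real {w | X w ∈ G ∧ w ∈ E (X w)} ≤ b * (randomness V).real {w | X w ∈ G} := by
  have h1 := measure_conditional_le h X hX G E hE (ENNReal.ofReal b) fun k hk =>
    (ENNReal.le_ofReal_iff_toReal_le (measure_ne_top _ _) hb0).2 (hb k hk)
  rw [measureReal_def, measureReal_def]
  refine (ENNReal.toReal_mono (ENNReal.mul_ne_top ENNReal.ofReal_ne_top (measure_ne_top _ _))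
    h1).trans_eq ?_
  rw [ENNReal.toReal_mul, ENNReal.toReal_ofReal hb0]

open Classical in
/-- Markov's inequality for a number of occurrences. -/
lemma count_markov (s : Finset κ) (E : κ → Set (Tape V)) (hE : ∀ q ∈ s, MeasurableSet (E q))
    (p θ : ℝ) (hθ : 0 < θ) (hp : ∀ q ∈ s, (randomness V).real (E q) ≤ p) :
    (randomness V).real {w | θ ≤ ((s.filter fun q => w ∈ E q).card : ℝ)} ≤ s.card * p / θ := by
  have hint : ∀ q ∈ s, Integrable ((E q).indicator (1 : Tape V → ℝ)) (randomness V) := fun q hq =>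
    (integrable_const (1 : ℝ)).indicator (hE q hq)
  have hf : ∀ w, ((s.filter fun q => w ∈ E q).card : ℝ) =
      ∑ q ∈ s, (E q).indicator (1 : Tape V → ℝ) w := by
    intro w
    rw [Finset.card_filter]
    push_cast
    exact Finset.sum_congr rfl fun q _ => by simp [Set.indicator_apply]
  simp_rw [hf]
  have h1 := mul_meas_ge_le_integral_of_nonneg (μ := randomness V)
    (f := fun w => ∑ q ∈ s, (E q).indicator (1 : Tape V → ℝ) w)
    (Filter.Eventually.of_forall fun w => Finset.sum_nonneg fun q _ =>
      Set.indicator_nonneg (fun _ _ => zero_le_one) w) (integrable_finsetSum s hint) θ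
  rw [integral_finsetSum s hint] at h1
  rw [le_div_iff₀ hθ, mul_comm]
  refine h1.trans ((Finset.sum_le_sum fun q hq => ?_).trans_eq
    ((Finset.sum_const p).trans (nsmul_eq_mul _ _)))
  rw [integral_indicator_one (hE q hq)]
  exact hp q hq

variable [Finite V] {c : ℕ}

/-- Events that depend on the choices of the nodes in a measurable way. -/
lemma measurableSet_of_choices {A : Set (V × ℕ × ℕ)} {s : ℕ}
    (h : ∀ x, (x, s, 0) ∈ A ∧ (x, s, 1) ∈ A) (P : (V → Bool × Option (Fin c)) → Tape V → Prop)
    (hP : ∀ k, MeasurableSet[coordSigma A] {w | P k w}) :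
    MeasurableSet[coordSigma A] {w | P (choice c w s) w} := by
  have h1 : {w | P (choice c w s) w} = ⋃ k, ({w | choice c w s = k} ∩ {w | P k w}) := by
    ext w; simp
  rw [h1]
  exact MeasurableSet.iUnion (m := coordSigma A) fun k =>
    MeasurableSet.inter (m := coordSigma A) (measurableSet_choices h k) (hP k)

lemma measurable_comp_choice {A : Set (V × ℕ × ℕ)} {s : ℕ}
    (h : ∀ x, (x, s, 0) ∈ A ∧ (x, s, 1) ∈ A) {β : Type*} [MeasurableSpace β]
    (g : (V → Bool × Option (Fin c)) → β) :
    Measurable[coordSigma A] fun w => g (choice c w s) := fun E _ =>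
  measurableSet_of_choices h (fun k _ => g k ∈ E) fun _ => @MeasurableSet.const _ (coordSigma A) _

end Tools

/-- The random numbers that determine the roles and channels. -/
def choiceCoords (V : Type*) : Set (V × ℕ × ℕ) := {i | i.2.2 ≠ 2}

/-- The random numbers that determine whether a broadcaster broadcasts in a slot. -/
def bitCoords (V : Type*) : Set (V × ℕ × ℕ) := {i | i.2.2 = 2}

lemma disjoint_choiceCoords_bitCoords (V : Type*) : Disjoint (choiceCoords V) (bitCoords V) :=
  Set.disjoint_left.2 fun _ h1 h2 => h1 h2

/-! ### Load and overcount of a single step of part one. -/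

namespace CKSeek

variable {V Ch : Type*} {c : ℕ} [Fintype V] {N : Network V Ch c}

open Classical in
/-- The number of broadcasting neighbors of `u` on the channel on which it listens. -/
noncomputable def stepLoad (N : Network V Ch c) (u : V) (k : V → Bool × Option (Fin c)) : ℕ :=
  ∑ l, if k u = (false, some l) then (N.senders u l k).card else 0

open Classical in
/-- The count that `u` obtains in the step starting in slot `s`. -/
noncomputable def stepCount (N : Network V Ch c) (R L : ℕ) (thr : ℝ) (u : V) (s : ℕ)
    (k : V → Bool × Option (Fin c)) (w : Tape V) : ℕ :=
  ∑ l, if k u = (false, some l) then stepEstimate R L thr (N.senders u l k) s w else 0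

variable {T₁ R L : ℕ} {thr : ℝ} {u : V} {s : ℕ}

lemma sum_channelCount (w : Tape V) : ∑ l, channelCount N T₁ R L thr u w l =
    ∑ q ∈ Finset.range T₁, stepCount N R L thr u (q * (R * L)) (choice c w (q * (R * L))) w := by
  unfold channelCount stepCount
  rw [Finset.sum_comm]

omit [Fintype V] in
lemma sum_ite_listen {k : V → Bool × Option (Fin c)} {l : Fin c} (h : k u = (false, some l))
    {β : Type*} [AddCommMonoid β] (f : Fin c → β) [∀ l, Decidable (k u = (false, some l))] :
    ∑ l, (if k u = (false, some l) then f l else 0) = f l := by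
  rw [Finset.sum_eq_single l, if_pos h]
  · intro l' _ hne
    rw [if_neg]
    rw [h]
    simpa using hne.symm
  · simp

lemma stepLoad_of_listen {k : V → Bool × Option (Fin c)} {l : Fin c}
    (h : k u = (false, some l)) : stepLoad N u k = (N.senders u l k).card :=
  sum_ite_listen h _

lemma stepCount_of_listen {k : V → Bool × Option (Fin c)} {l : Fin c}
    (h : k u = (false, some l)) (w : Tape V) :
    stepCount N R L thr u s k w = stepEstimate R L thr (N.senders u l k) s w :=
  sum_ite_listen h _

lemma exists_listen_of_stepCount_pos {k : V → Bool × Option (Fin c)} {w : Tape V}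
    (h : 0 < stepCount N R L thr u s k w) : ∃ l, k u = (false, some l) := by
  by_contra hcon
  push Not at hcon
  refine h.ne' (Finset.sum_eq_zero fun l _ => if_neg (hcon l))

lemma stepCount_le (hR : 1 ≤ R) (k : V → Bool × Option (Fin c)) (w : Tape V) :
    stepCount N R L thr u s k w ≤ 4 * 2 ^ (R - 1) := by
  rcases Nat.eq_zero_or_pos (stepCount N R L thr u s k w) with h | h
  · rw [h]; exact Nat.zero_le _
  · obtain ⟨l, hl⟩ := exists_listen_of_stepCount_pos h
    rw [stepCount_of_listen hl]
    exact countEstimate_le hR _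

/-- The number of pairs of a channel of `u` and a neighbor that has this channel. -/
noncomputable def _root_.Network.degSum (N : Network V Ch c) (u : V) : ℕ :=
  ∑ l, (N.holders u l).card

lemma measurableSet_mem_senders {A : Set (V × ℕ × ℕ)} {x : V} (h0 : (x, s, 0) ∈ A)
    (h1 : (x, s, 1) ∈ A) (l : Fin c) :
    MeasurableSet[coordSigma A] {w | x ∈ N.senders u l (choice c w s)} := by
  by_cases h : ∃ l', N.graph.Adj u x ∧ N.chan x l' = N.chan u l
  · obtain ⟨l', hadj, h⟩ := h
    have h2 : {w | x ∈ N.senders u l (choice c w s)} =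
        {w | choice c w s x = (true, some l')} := by
      ext w
      simp only [Network.mem_senders, Set.mem_ofPred_eq]
      constructor
      · rintro ⟨-, l'', h3, h4⟩
        rwa [(N.chan x).injective (h4.trans h.symm)] at h3
      · exact fun h3 => ⟨hadj, l', h3, h⟩
    rw [h2]
    exact measurableSet_choice h0 h1 _
  · have h2 : {w | x ∈ N.senders u l (choice c w s)} = ∅ := by
      refine Set.eq_empty_iff_forall_notMem.2 fun w hw => h ?_
      simp only [Network.mem_senders, Set.mem_ofPred_eq] at hw
      obtain ⟨h3, l', -, h4⟩ := hw
      exact ⟨l', h3, h4⟩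
    rw [h2]
    exact @MeasurableSet.empty _ (coordSigma A)

lemma measureReal_mem_senders {x : V} {l : Fin c} (h : x ∈ N.holders u l) (s : ℕ) :
    (randomness V).real {w | x ∈ N.senders u l (choice c w s)} = 1 / (2 * c) := by
  obtain ⟨hadj, l', h⟩ := Network.mem_holders.1 h
  have h2 : {w : Tape V | x ∈ N.senders u l (choice c w s)} =
      {w | choice c w s x = (true, some l')} := by
    ext w
    simp only [Network.mem_senders, Set.mem_ofPred_eq]
    constructor
    · rintro ⟨-, l'', h3, h4⟩
      rwa [(N.chan x).injective (h4.trans h.symm)] at h3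
    · exact fun h3 => ⟨hadj, l', h3, h⟩
  rw [h2, measureReal_choice]

/-- The probability that the count of a step is more than eight times too large. -/
lemma measureReal_overcount_le (hthr0 : 0 ≤ thr) (hthr : thr ≤ 1 / 128) (hR : 1 ≤ R) :
    (randomness V).real {w | 8 * stepLoad N u (choice c w s) <
      stepCount N R L thr u s (choice c w s) w} ≤
      Real.exp (-(L / 96)) * (N.degSum u * (1 / (2 * c)) ^ 2) := by
  classical
  set G : Fin c → V → Set (V → Bool × Option (Fin c)) := fun l x =>
    {k | k u = (false, some l) ∧ x ∈ N.senders u l k} with hG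
  set E : Fin c → (V → Bool × Option (Fin c)) → Set (Tape V) := fun l k =>
    {w | 8 * (N.senders u l k).card < stepEstimate R L thr (N.senders u l k) s w} with hE
  -- An overcount requires a broadcaster on the channel listened to. The union over such pairs of a
  -- label and a holder contributes the factor S/(2c)², which is essential later because most steps
  -- may have no load.
  have hsub : {w | 8 * stepLoad N u (choice c w s) < stepCount N R L thr u s (choice c w s) w} ⊆
      ⋃ l ∈ (Finset.univ : Finset (Fin c)), ⋃ x ∈ N.holders u l,
        {w | choice c w s ∈ G l x ∧ w ∈ E l (choice c w s)} := by
    intro w hw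
    simp only [Set.mem_ofPred_eq] at hw
    obtain ⟨l, hl⟩ := exists_listen_of_stepCount_pos (Nat.zero_le _ |>.trans_lt hw)
    rw [stepLoad_of_listen hl, stepCount_of_listen hl] at hw
    have hne : (N.senders u l (choice c w s)).Nonempty := by
      rw [Finset.nonempty_iff_ne_empty]
      intro h0
      rw [h0, stepEstimate_empty hthr0] at hw
      simp at hw
    obtain ⟨x, hx⟩ := hne
    exact Set.mem_iUnion₂.2 ⟨l, Finset.mem_univ l, Set.mem_iUnion₂.2
      ⟨x, Network.senders_subset_holders u l _ hx, ⟨hl, hx⟩, hw⟩⟩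
  -- For fixed roles and channels the estimate reads broadcast bits only, so one may condition on
  -- the choices.
  have hmeasE : ∀ l k, MeasurableSet[coordSigma (bitCoords V)] (E l k) := fun l k => by
    have := measurable_stepEstimate (R := R) (L := L) (thr := thr) (A := bitCoords V)
      (N.senders u l k) s fun _ _ _ _ => rfl
    exact this (t := {e | 8 * (N.senders u l k).card < e}) trivial
  have hone : ∀ l, ∀ x ∈ N.holders u l,
      (randomness V).real {w | choice c w s ∈ G l x ∧ w ∈ E l (choice c w s)} ≤
        Real.exp (-(L / 96)) * (1 / (2 * c)) ^ 2 := by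
    intro l x hx
    refine (measureReal_conditional_le (disjoint_choiceCoords_bitCoords V) (fun w => choice c w s)
      (fun k => measurableSet_choices (fun x => ⟨by simp [choiceCoords], by simp [choiceCoords]⟩) k)
      (G l x) (E l) (hmeasE l) (Real.exp (-(L / 96))) (Real.exp_pos _).le ?_).trans_eq ?_
    · intro k hk
      exact measureReal_overestimate_le s hthr hR (Finset.card_pos.2 ⟨x, hk.2⟩)
    · congr 1
      have h1 := measureReal_and_of_disjoint (A := nodeCoords u) (B := nodeCoords x)
        (disjoint_nodeCoords (Network.mem_holders.1 hx).1.ne)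
        (P := fun w => choice c w s u = (false, some l))
        (Q := fun w => x ∈ N.senders u l (choice c w s))
        (measurableSet_choice (mem_nodeCoords _ _ _) (mem_nodeCoords _ _ _) _) (measurableSet_mem_senders (mem_nodeCoords _ _ _)
          (mem_nodeCoords _ _ _) l)
      rw [measureReal_choice, measureReal_mem_senders hx] at h1
      rw [sq, ← h1]
      rfl
  refine (measureReal_mono hsub (measure_ne_top _ _)).trans ((measureReal_biUnion_finset_le _ _).trans ?_)
  refine (Finset.sum_le_sum fun l _ => (measureReal_biUnion_finset_le _ _).trans
    (Finset.sum_le_sum (hone l))).trans_eq ?_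
  simp only [Finset.sum_const, nsmul_eq_mul, Network.degSum]
  push_cast
  rw [Finset.sum_mul, Finset.mul_sum]
  exact Finset.sum_congr rfl fun l _ => by ring

lemma measurable_stepCount {A : Set (V × ℕ × ℕ)}
    (hA : ∀ x t, s ≤ t → t < s + R * L → (x, t, 2) ∈ A) (k : V → Bool × Option (Fin c)) :
    Measurable[coordSigma A] (stepCount N R L thr u s k) := by
  refine Finset.measurable_fun_sum (m := coordSigma A) _ fun l _ => ?_
  by_cases h : k u = (false, some l)
  · simpa only [if_pos h] using measurable_stepEstimate (N.senders u l k) s hA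
  · simpa only [if_neg h] using measurable_const

/-- The moment generating function of the load of a step. -/
lemma lintegral_exp_stepLoad_le (lam : ℝ) (h0 : 0 ≤ lam) (h1 : lam ≤ 1)
    (h : ∀ l, lam * (N.holders u l).card ≤ c) :
    ∫⁻ w, ENNReal.ofReal (Real.exp (lam * stepLoad N u (choice c w s))) ∂randomness V ≤
      ENNReal.ofReal (Real.exp (lam * N.degSum u / c ^ 2)) := by
  classical
  set U : Fin c → Set (Tape V) := fun l => {w | choice c w s u = (false, some l)} with hU
  set f : Fin c → Tape V → ℝ≥0∞ := fun l w =>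
    ENNReal.ofReal (Real.exp (lam * (N.senders u l (choice c w s)).card) - 1) with hf
  have hUm : ∀ l, MeasurableSet[coordSigma (nodeCoords u)] (U l) := fun l =>
    measurableSet_choice (mem_nodeCoords _ _ _) (mem_nodeCoords _ _ _) _
  obtain ⟨S, hS⟩ : ∃ S : Fin c → V → Set (Tape V),
      ∀ l x, S l x = {w | x ∈ N.senders u l (choice c w s)} := ⟨_, fun _ _ => rfl⟩
  have hSm : ∀ {A : Set (V × ℕ × ℕ)} (l x), (∀ m, (x, s, m) ∈ A) →
      MeasurableSet[coordSigma A] (S l x) := fun l x hA => by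
    rw [hS]; exact measurableSet_mem_senders (hA 0) (hA 1) l
  have hcard : ∀ l w, lam * (N.senders u l (choice c w s)).card =
      ∑ x ∈ N.holders u l, if w ∈ S l x then lam else 0 := by
    intro l w
    rw [card_filter_eq_sum_mul]
    congr 3
    ext x
    simp only [Finset.mem_filter, hS, Set.mem_ofPred_eq]
    exact ⟨fun hx => ⟨Network.senders_subset_holders u l _ hx, hx⟩, fun hx => hx.2⟩
  have hfm : ∀ l, Measurable[coordSigma (⋃ x ∈ N.holders u l, nodeCoords x)] (f l) := by
    intro l
    refine ENNReal.measurable_ofReal.comp (Measurable.sub_const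
      (m := coordSigma (⋃ x ∈ N.holders u l, nodeCoords x)) (Real.measurable_exp.comp ?_) 1)
    simp_rw [hcard]
    refine Finset.measurable_fun_sum (m := coordSigma (⋃ x ∈ N.holders u l, nodeCoords x)) _
      fun x hx => ?_
    have hmem : ∀ m, (x, s, m) ∈ ⋃ x ∈ N.holders u l, nodeCoords x := fun m =>
      Set.mem_iUnion₂.2 ⟨x, hx, rfl⟩
    exact measurable_ite_mem (hSm l x hmem) _
  have hc : ∀ _ : Fin c, (0 : ℝ) < c := fun l => by exact_mod_cast l.pos
  -- For h holders, independence of the senders gives E exp(lam·#senders) ≤ exp(lam·h/c) ≤ 1 +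
  -- 2·lam·h/c. Both inequalities use e^y ≤ 1 + 2y on [0,1], which is why lam ≤ 1 and lam·h ≤ c are
  -- assumed.
  have hfint : ∀ l, ∫⁻ w, f l w ∂randomness V ≤
      ENNReal.ofReal (2 * (lam * (N.holders u l).card / c)) := by
    intro l
    have h2 := lintegral_exp_sum_le (N.holders u l) (nodeCoords (V := V))
      (fun x _ y _ hxy => disjoint_nodeCoords hxy)
      (fun x w => if w ∈ S l x then lam else 0)
      (fun x _ => measurable_ite_mem (hSm l x (mem_nodeCoords x s)) _)
      (fun _ => (Real.exp lam - 1) * (1 / (2 * c)))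
      (fun x hx => lintegral_exp_indicator_le (coordSigma_le (nodeCoords x) _
        (hSm l x (mem_nodeCoords x s))) _ _
        (Or.inl ⟨h0, by rw [hS]; exact (measureReal_mem_senders hx s).le⟩))
    simp_rw [← hcard] at h2
    rw [Finset.sum_const, nsmul_eq_mul] at h2
    have h3 : ∀ w, ENNReal.ofReal (Real.exp (lam * (N.senders u l (choice c w s)).card)) =
        f l w + 1 := by
      intro w
      rw [hf, ← ENNReal.ofReal_one, ← ENNReal.ofReal_add _ zero_le_one]
      · congr 1; ring
      · have : 0 ≤ lam * (N.senders u l (choice c w s)).card := by positivity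
        linarith [Real.add_one_le_exp (lam * (N.senders u l (choice c w s)).card)]
    simp_rw [h3] at h2
    rw [lintegral_add_right _ measurable_const, lintegral_const, measure_univ, one_mul] at h2
    have h4 : ENNReal.ofReal (Real.exp ((N.holders u l).card *
        ((Real.exp lam - 1) * (1 / (2 * c))))) ≤
        ENNReal.ofReal (2 * (lam * (N.holders u l).card / c)) + 1 := by
      have hcl := hc l
      have hy0 : 0 ≤ lam * (N.holders u l).card / c := by positivity
      have hy1 : lam * (N.holders u l).card / c ≤ 1 := (div_le_one hcl).2 (h l)
      rw [← ENNReal.ofReal_one, ← ENNReal.ofReal_add (by positivity) zero_le_one]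
      refine ENNReal.ofReal_le_ofReal ?_
      have hexp : ∀ y : ℝ, 0 ≤ y → y ≤ 1 → Real.exp y ≤ 1 + 2 * y := by
        intro y hy hy'
        have h5 := Real.abs_exp_sub_one_sub_id_le (x := y) (by rwa [abs_of_nonneg hy])
        have h6 := (abs_le.1 h5).2
        nlinarith
      have h7 : (N.holders u l).card * ((Real.exp lam - 1) * (1 / (2 * c))) ≤
          lam * (N.holders u l).card / c := by
        have h8 : Real.exp lam - 1 ≤ 2 * lam := by linarith [hexp lam h0 h1]
        calc (N.holders u l).card * ((Real.exp lam - 1) * (1 / (2 * c)))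
            ≤ (N.holders u l).card * (2 * lam * (1 / (2 * c))) := by gcongr
          _ = _ := by field_simp
      refine (Real.exp_le_exp.2 h7).trans ?_
      linarith [hexp _ hy0 hy1]
    exact (ENNReal.add_le_add_iff_right ENNReal.one_ne_top).1 (h2.trans h4)
  -- At most one label is listened to, so the exponential splits as 1 plus a sum over the labels of
  -- products of independent factors.
  have hpt : ∀ w, ENNReal.ofReal (Real.exp (lam * stepLoad N u (choice c w s))) ≤
      1 + ∑ l, (U l).indicator 1 w * f l w := by
    intro w
    by_cases hl : ∃ l, choice c w s u = (false, some l)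
    · obtain ⟨l, hl⟩ := hl
      rw [stepLoad_of_listen hl]
      have h2 : ENNReal.ofReal (Real.exp (lam * (N.senders u l (choice c w s)).card)) ≤
          1 + f l w := by
        rw [hf, ← ENNReal.ofReal_one, ← ENNReal.ofReal_add zero_le_one]
        · exact ENNReal.ofReal_le_ofReal (by linarith)
        · have : 0 ≤ lam * (N.senders u l (choice c w s)).card := by positivity
          linarith [Real.add_one_le_exp (lam * (N.senders u l (choice c w s)).card)]
      refine h2.trans (add_le_add le_rfl ?_)
      have h3 : (U l).indicator 1 w * f l w = f l w := by
        rw [Set.indicator_of_mem (show w ∈ U l from hl)]; simp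
      rw [← h3]
      exact Finset.single_le_sum (f := fun l => (U l).indicator 1 w * f l w)
        (fun _ _ => zero_le) (Finset.mem_univ l)
    · push Not at hl
      have h2 : stepLoad N u (choice c w s) = 0 :=
        Finset.sum_eq_zero fun l _ => if_neg (hl l)
      rw [h2]
      simp
  refine (lintegral_mono hpt).trans ?_
  have hUm' : ∀ l, Measurable[coordSigma (nodeCoords u)]
      ((U l).indicator (1 : Tape V → ℝ≥0∞)) := fun l =>
    Measurable.indicator (m := coordSigma (nodeCoords u)) measurable_const (hUm l)
  have hprodm : ∀ l, Measurable fun w => (U l).indicator (1 : Tape V → ℝ≥0∞) w * f l w := fun l =>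
    ((hUm' l).mono (coordSigma_le _) le_rfl).mul ((hfm l).mono (coordSigma_le _) le_rfl)
  rw [lintegral_add_left measurable_const, lintegral_finsetSum _ fun l _ => hprodm l,
    lintegral_const, measure_univ, one_mul]
  have hterm : ∀ l, ∫⁻ w, (U l).indicator (1 : Tape V → ℝ≥0∞) w * f l w ∂randomness V ≤
      ENNReal.ofReal (lam * (N.holders u l).card / c ^ 2) := by
    intro l
    rw [lintegral_mul_of_disjoint (Set.disjoint_iUnion₂_right.2 fun x hx =>
      disjoint_nodeCoords (Network.mem_holders.1 hx).1.ne) (hUm' l) (hfm l),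
      lintegral_indicator_one (coordSigma_le _ _ (hUm l)), ← ofReal_measureReal,
      measureReal_choice]
    refine (mul_le_mul_right (hfint l) _).trans_eq ?_
    rw [← ENNReal.ofReal_mul (by positivity)]
    congr 1
    have := hc l
    field_simp
  refine (add_le_add le_rfl (Finset.sum_le_sum fun l _ => hterm l)).trans ?_
  rw [← ENNReal.ofReal_sum_of_nonneg fun l _ => by positivity, ← ENNReal.ofReal_one,
    ← ENNReal.ofReal_add zero_le_one (Finset.sum_nonneg fun l _ => by positivity)]
  refine ENNReal.ofReal_le_ofReal ?_
  rw [← Finset.sum_div, ← Finset.mul_sum, add_comm]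
  refine (Real.add_one_le_exp _).trans_eq ?_
  rw [Network.degSum]
  push_cast
  rfl

end CKSeek

/-! ### Concentration of the counts over all steps of part one. -/

namespace CKSeek

variable {V Ch : Type*} {c : ℕ} [Fintype V] {N : Network V Ch c}
variable {T₁ T₂ R L : ℕ} {thr : ℝ} {u v : V}

lemma holders_card_le_degSum (u : V) (l : Fin c) : (N.holders u l).card ≤ N.degSum u :=
  Finset.single_le_sum (f := fun l => (N.holders u l).card) (fun _ _ => Nat.zero_le _)
    (Finset.mem_univ l)

omit [Fintype V] in
lemma mem_step {K q : ℕ} (T : ℕ) (hK : 0 < K) (x : V) (m : ℕ) :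
    (x, T + q * K, m) ∈ slotCoords V (T + q * K) (T + (q + 1) * K) :=
  mem_slotCoords le_rfl (by rw [Nat.succ_mul]; omega)

/-- Chernoff's bound with tilt h/S: the bounds h ≤ S and h ≤ c are exactly what makes this tilt
admissible for every label. A single load can be large, hence the small tilt. -/
lemma measureReal_load_le (hRL : 0 < R * L) {h : ℝ} (h0 : 0 < h) (hc : h ≤ c)
    (hS : h ≤ N.degSum u) :
    (randomness V).real {w | 2 * (T₁ * N.degSum u / c ^ 2 : ℝ) ≤
      ∑ q ∈ Finset.range T₁, (stepLoad N u (choice c w (0 + q * (R * L))) : ℝ)} ≤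
      Real.exp (-(T₁ * h / c ^ 2)) := by
  have hS0 : 0 < (N.degSum u : ℝ) := h0.trans_le hS
  have hc0 : (0 : ℝ) < c := h0.trans_le hc
  set lam : ℝ := h / N.degSum u with hlam
  have hlam0 : 0 < lam := div_pos h0 hS0
  have h1 := chernoff (V := V) (Finset.range T₁) _ (pairwiseDisjoint_steps V 0 (R * L) _)
    (fun q w => lam * stepLoad N u (choice c w (0 + q * (R * L))))
    (fun q _ => measurable_comp_choice (fun x => ⟨mem_step 0 hRL x 0, mem_step 0 hRL x 1⟩)
      fun k => lam * (stepLoad N u k : ℝ))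
    (lam * N.degSum u / c ^ 2) (lam * (2 * (T₁ * N.degSum u / c ^ 2)))
    (fun q _ => lintegral_exp_stepLoad_le lam hlam0.le ((div_le_one hS0).2 hS) fun l => ?_)
  · rw [Finset.card_range] at h1
    refine ENNReal.toReal_le_of_le_ofReal (Real.exp_pos _).le (le_trans (measure_mono ?_)
      (h1.trans_eq ?_))
    · intro w hw
      simp only [Set.mem_ofPred_eq] at hw ⊢
      rw [← Finset.mul_sum]
      exact mul_le_mul_of_nonneg_left hw hlam0.le
    · congr 2
      rw [hlam]
      field_simp
      ring
  · have h2 : ((N.holders u l).card : ℝ) ≤ N.degSum u := by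
      exact_mod_cast holders_card_le_degSum u l
    rw [hlam, div_mul_eq_mul_div, div_le_iff₀ hS0]
    exact mul_le_mul hc h2 (Nat.cast_nonneg _) hc0.le

lemma measurableSet_overcount (hRL : 0 < R * L) (q : ℕ) :
    MeasurableSet[coordSigma (slotCoords V (0 + q * (R * L)) (0 + (q + 1) * (R * L)))]
      {w | 8 * stepLoad N u (choice c w (0 + q * (R * L))) <
        stepCount N R L thr u (0 + q * (R * L)) (choice c w (0 + q * (R * L))) w} := by
  refine measurableSet_of_choices (fun x => ⟨mem_step 0 hRL x 0, mem_step 0 hRL x 1⟩)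
    (fun k w => 8 * stepLoad N u k < stepCount N R L thr u (0 + q * (R * L)) k w) fun k => ?_
  have h1 := measurable_stepCount (N := N) (R := R) (L := L) (thr := thr) (u := u)
    (s := 0 + q * (R * L)) (A := slotCoords V (0 + q * (R * L)) (0 + (q + 1) * (R * L)))
    (fun x t ht ht' => mem_slotCoords ht (by rw [Nat.succ_mul]; omega)) k
  exact h1 (t := {e | 8 * stepLoad N u k < e}) trivial

/-- With high probability the sum of all counts of a node is not much larger than expected. -/
lemma measureReal_sum_channelCount_le (hthr0 : 0 ≤ thr) (hthr : thr ≤ 1 / 128) (hR : 1 ≤ R)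
    (hL : 1 ≤ L) (hT₁ : 1 ≤ T₁) {h : ℝ} (h0 : 0 < h) (hc : h ≤ c) (hS : h ≤ N.degSum u) :
    (randomness V).real {w | 17 * (T₁ * N.degSum u / c ^ 2 : ℝ) ≤
      ((∑ l, channelCount N T₁ R L thr u w l : ℕ) : ℝ)} ≤
      Real.exp (-(T₁ * h / c ^ 2)) + 2 ^ (R - 1) * Real.exp (-(L / 96)) := by
  classical
  have hRL : 0 < R * L := Nat.mul_pos hR hL
  have hS0 : 0 < (N.degSum u : ℝ) := h0.trans_le hS
  have hc0 : (0 : ℝ) < c := h0.trans_le hc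
  have hT0 : (0 : ℝ) < T₁ := by exact_mod_cast hT₁
  set X : ℝ := T₁ * N.degSum u / c ^ 2 with hX
  have hX0 : 0 < X := by positivity
  obtain ⟨E, hE⟩ : ∃ E : ℕ → Set (Tape V), ∀ q, E q =
      {w | 8 * stepLoad N u (choice c w (0 + q * (R * L))) <
        stepCount N R L thr u (0 + q * (R * L)) (choice c w (0 + q * (R * L))) w} :=
    ⟨_, fun _ => rfl⟩
  -- 17 = 8·2 + 1: steps without overcount contribute at most eight times the load, and the
  -- overcounted ones, each at most 4·2^(R-1), contribute less than X if they are few.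
  have hsub : {w | 17 * X ≤ ((∑ l, channelCount N T₁ R L thr u w l : ℕ) : ℝ)} ⊆
      {w | 2 * X ≤ ∑ q ∈ Finset.range T₁, (stepLoad N u (choice c w (0 + q * (R * L))) : ℝ)} ∪
      {w | X / (4 * 2 ^ (R - 1)) ≤ (((Finset.range T₁).filter fun q => w ∈ E q).card : ℝ)} := by
    intro w hw
    by_contra hcon
    rw [Set.mem_union, not_or] at hcon
    simp only [Set.mem_ofPred_eq, not_le] at hw hcon
    obtain ⟨hload, hcard⟩ := hcon
    rw [lt_div_iff₀ (by positivity)] at hcard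
    rw [sum_channelCount] at hw
    have hq : ∀ q ∈ Finset.range T₁, stepCount N R L thr u (q * (R * L))
        (choice c w (q * (R * L))) w ≤ 8 * stepLoad N u (choice c w (0 + q * (R * L))) +
          if w ∈ E q then 4 * 2 ^ (R - 1) else 0 := by
      intro q _
      split_ifs with hwE
      · exact (stepCount_le hR _ _).trans (Nat.le_add_left _ _)
      · rw [hE] at hwE
        simp only [Set.mem_ofPred_eq, not_lt, zero_add] at hwE
        simpa using hwE
    have hsum := Finset.sum_le_sum hq
    rw [Finset.sum_add_distrib, ← Finset.mul_sum, ← Finset.sum_filter, Finset.sum_const,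
      smul_eq_mul] at hsum
    have hsum' := (Nat.cast_le (α := ℝ)).2 hsum
    push_cast at hsum' hw
    linarith
  refine (measureReal_mono hsub).trans ((measureReal_union_le _ _).trans (add_le_add ?_ ?_))
  · exact measureReal_load_le hRL h0 hc hS
  -- The mean number of overcounts and the threshold are both proportional to T₁·S/c², so only
  -- 2^(R-1)·exp(-L/96) remains.
  · have h1 := count_markov (Finset.range T₁) E
      (fun q _ => by rw [hE]; exact coordSigma_le _ _ (measurableSet_overcount hRL q))
      (Real.exp (-(L / 96)) * (N.degSum u * (1 / (2 * c)) ^ 2)) (X / (4 * 2 ^ (R - 1)))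
      (by positivity) (fun q _ => by rw [hE]; exact measureReal_overcount_le hthr0 hthr hR)
    refine h1.trans_eq ?_
    rw [Finset.card_range, hX]
    field_simp
    ring

/-- In a step, `u` listens on label `l`, many neighbors broadcast there, and they are not
underestimated. -/
def richStep (N : Network V Ch c) (R L : ℕ) (thr : ℝ) (u : V) (l : Fin c) (s : ℕ) :
    Set (Tape V) :=
  {w | (choice c w s u = (false, some l) ∧
      ((N.holders u l).card : ℝ) * (1 / (2 * c)) / 4 < (N.senders u l (choice c w s)).card) ∧
    (N.senders u l (choice c w s)).card ≤ 2 * stepEstimate R L thr (N.senders u l (choice c w s)) s w}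

lemma measurableSet_richStep (hRL : 0 < R * L) (l : Fin c) (q : ℕ) :
    MeasurableSet[coordSigma (slotCoords V (0 + q * (R * L)) (0 + (q + 1) * (R * L)))]
      (richStep N R L thr u l (0 + q * (R * L))) := by
  refine measurableSet_of_choices (fun x => ⟨mem_step 0 hRL x 0, mem_step 0 hRL x 1⟩)
    (fun k w => (k u = (false, some l) ∧
      ((N.holders u l).card : ℝ) * (1 / (2 * c)) / 4 < (N.senders u l k).card) ∧
      (N.senders u l k).card ≤ 2 * stepEstimate R L thr (N.senders u l k) (0 + q * (R * L)) w)
    fun k => ?_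
  have h1 := measurable_stepEstimate (R := R) (L := L) (thr := thr)
    (A := slotCoords V (0 + q * (R * L)) (0 + (q + 1) * (R * L))) (N.senders u l k)
    (0 + q * (R * L)) (fun x t ht ht' => mem_slotCoords ht (by rw [Nat.succ_mul]; omega))
  refine MeasurableSet.inter (m := coordSigma _) (@MeasurableSet.const _ (coordSigma _) _) ?_
  exact h1 (t := {e | (N.senders u l k).card ≤ 2 * e}) trivial

/-- The expected number of senders is at least 8, and falling to a quarter of it has probability at
most e^(-8/3). -/
lemma le_measureReal_many_senders (l : Fin c) (s : ℕ) (h : 16 * c ≤ (N.holders u l).card) :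
    1 / 2 ≤ (randomness V).real {w | ((N.holders u l).card : ℝ) * (1 / (2 * c)) / 4 <
      (N.senders u l (choice c w s)).card} := by
  classical
  have hc : (0 : ℝ) < c := by exact_mod_cast l.pos
  have hcard : ∀ w, (N.senders u l (choice c w s)).card = ((N.holders u l).filter fun x =>
      w ∈ {w | x ∈ N.senders u l (choice c w s)}).card := by
    intro w
    congr 1
    ext x
    simp only [Finset.mem_filter, Set.mem_ofPred_eq]
    exact ⟨fun hx => ⟨Network.senders_subset_holders u l _ hx, hx⟩, fun hx => hx.2⟩
  have h1 := few_successes_le (N.holders u l) (nodeCoords (V := V))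
    (fun x _ y _ hxy => disjoint_nodeCoords hxy)
    (fun x => {w | x ∈ N.senders u l (choice c w s)})
    (fun x _ => measurableSet_mem_senders (mem_nodeCoords _ _ _) (mem_nodeCoords _ _ _) l)
    (1 / (2 * c)) (by positivity) (fun x hx => (measureReal_mem_senders hx s).ge)
  have h2 : {w : Tape V | ((N.holders u l).card : ℝ) * (1 / (2 * c)) / 4 <
      (N.senders u l (choice c w s)).card} = {w | ((N.senders u l (choice c w s)).card : ℝ) ≤
        (N.holders u l).card * (1 / (2 * c)) / 4}ᶜ := by
    ext w; simp
  have hm : MeasurableSet {w : Tape V | ((N.senders u l (choice c w s)).card : ℝ) ≤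
        (N.holders u l).card * (1 / (2 * c)) / 4} :=
    coordSigma_le Set.univ _ (measurableSet_of_choices (fun x => ⟨Set.mem_univ _, Set.mem_univ _⟩)
      (fun k _ => ((N.senders u l k).card : ℝ) ≤ (N.holders u l).card * (1 / (2 * c)) / 4)
      fun k => @MeasurableSet.const _ (coordSigma _) _)
  rw [h2, probReal_compl_eq_one_sub hm]
  have h3 : (randomness V).real {w | ((N.senders u l (choice c w s)).card : ℝ) ≤
      (N.holders u l).card * (1 / (2 * c)) / 4} ≤
      Real.exp (-((N.holders u l).card * (1 / (2 * c)) / 3)) := by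
    refine le_trans (measureReal_mono fun w hw => ?_) h1
    simp only [Set.mem_ofPred_eq] at hw ⊢
    rw [hcard] at hw
    convert hw
    exact Iff.rfl
  have h4 : Real.exp (-((N.holders u l).card * (1 / (2 * c)) / 3)) ≤ 1 / 2 := by
    have h5 : (16 : ℝ) * c ≤ (N.holders u l).card := by exact_mod_cast h
    have h6 : (8 : ℝ) ≤ (N.holders u l).card * (1 / (2 * c)) := by
      rw [mul_one_div, le_div_iff₀ (by positivity)]
      linarith
    calc Real.exp (-((N.holders u l).card * (1 / (2 * c)) / 3)) ≤ Real.exp (-1) :=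
          Real.exp_le_exp.2 (by linarith)
      _ ≤ 1 / 2 := by
          rw [Real.exp_neg, inv_le_comm₀ (Real.exp_pos _) (by norm_num)]
          linarith [Real.exp_one_gt_d9]
  linarith

/-- Three factors: 1/(2c) for listening on l, 1/2 for many senders, and 1/2 for no underestimate
given the choices. Many senders means at least two here, as the lower bound for estimates requires.
-/
lemma le_measureReal_richStep {δ : ℝ} (hδ : 0 < δ) (hδ1 : δ ≤ 1)
    (hthr : thr = (1 + δ) * (8 * Real.exp (-7))) (hthr' : thr ≤ 1 / 128)
    (hε : Real.exp (-(L / 96)) + R * Real.exp (-(L * (8 * Real.exp (-7)) * δ ^ 2 / 4)) ≤ 1 / 2)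
    (l : Fin c) (s : ℕ) (h : 16 * c ≤ (N.holders u l).card)
    (hR2 : (N.holders u l).card ≤ 2 ^ R) :
    1 / (8 * c) ≤ (randomness V).real (richStep N R L thr u l s) := by
  classical
  have hcn : 0 < c := l.pos
  have hc : (0 : ℝ) < c := by exact_mod_cast hcn
  have hR : 2 ≤ R := by
    by_contra hlt
    have : 2 ^ R ≤ 2 ^ 1 := Nat.pow_le_pow_right (by norm_num) (by omega)
    omega
  set G : Set (V → Bool × Option (Fin c)) := {k | k u = (false, some l) ∧
    ((N.holders u l).card : ℝ) * (1 / (2 * c)) / 4 < (N.senders u l k).card} with hG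
  have hchoice : ∀ x, (x, s, 0) ∈ choiceCoords V ∧ (x, s, 1) ∈ choiceCoords V := fun x =>
    ⟨by simp [choiceCoords], by simp [choiceCoords]⟩
  have hGp : 1 / (4 * c) ≤ (randomness V).real {w | choice c w s ∈ G} := by
    have h1 := measureReal_and_of_disjoint (A := nodeCoords u)
      (B := ⋃ x ∈ N.holders u l, nodeCoords x) (Set.disjoint_iUnion₂_right.2 fun x hx =>
        disjoint_nodeCoords (Network.mem_holders.1 hx).1.ne)
      (P := fun w => choice c w s u = (false, some l))
      (Q := fun w => ((N.holders u l).card : ℝ) * (1 / (2 * c)) / 4 <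
        (N.senders u l (choice c w s)).card)
      (measurableSet_choice (mem_nodeCoords _ _ _) (mem_nodeCoords _ _ _) _) ?_
    · have h2 := le_measureReal_many_senders l s h
      rw [measureReal_choice] at h1
      change _ ≤ (randomness V).real {w | choice c w s u = (false, some l) ∧
        ((N.holders u l).card : ℝ) * (1 / (2 * c)) / 4 < (N.senders u l (choice c w s)).card}
      rw [h1]
      calc (1 : ℝ) / (4 * c) = 1 / (2 * c) * (1 / 2) := by field_simp; ring
        _ ≤ _ := by gcongr
    · have hcard : ∀ w : Tape V, ((N.senders u l (choice c w s)).card : ℝ) =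
          ∑ x ∈ N.holders u l, if x ∈ N.senders u l (choice c w s) then 1 else 0 := by
        intro w
        rw [← Finset.sum_filter, Finset.sum_const, nsmul_eq_mul, mul_one]
        congr 2
        ext x
        simp only [Finset.mem_filter]
        exact ⟨fun hx => ⟨Network.senders_subset_holders u l _ hx, hx⟩, fun hx => hx.2⟩
      simp_rw [hcard]
      have hmeas : Measurable[coordSigma (⋃ x ∈ N.holders u l, nodeCoords x)] fun w : Tape V =>
          ∑ x ∈ N.holders u l, if x ∈ N.senders u l (choice c w s) then (1 : ℝ) else 0 := ?_
      · exact hmeas measurableSet_Ioi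
      refine Finset.measurable_fun_sum (m := coordSigma _) _ fun x hx => ?_
      have hmem : ∀ m, (x, s, m) ∈ ⋃ x ∈ N.holders u l, nodeCoords x := fun m =>
        Set.mem_iUnion₂.2 ⟨x, hx, rfl⟩
      exact Measurable.ite (m := coordSigma _) (measurableSet_mem_senders (hmem 0) (hmem 1) l)
        measurable_const measurable_const
  have hbad := measureReal_conditional_le (disjoint_choiceCoords_bitCoords V)
    (fun w => choice c w s) (fun k => measurableSet_choices hchoice k) G
    (fun k => {w | 2 * stepEstimate R L thr (N.senders u l k) s w < (N.senders u l k).card})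
    (fun k => (measurable_stepEstimate (R := R) (L := L) (thr := thr) (A := bitCoords V)
      (N.senders u l k) s fun _ _ _ _ => rfl) (t := {e | 2 * e < (N.senders u l k).card}) trivial)
    (1 / 2) (by norm_num) (fun k hk => (measureReal_underestimate_le s hδ hδ1 hthr hthr' hR
      ?_ ((Finset.card_le_card (Network.senders_subset_holders u l k)).trans hR2)).trans hε)
  · have hsub : {w | choice c w s ∈ G} ⊆ richStep N R L thr u l s ∪ {w | choice c w s ∈ G ∧
        w ∈ {w' | 2 * stepEstimate R L thr (N.senders u l (choice c w s)) s w' <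
          (N.senders u l (choice c w s)).card}} := by
      intro w hw
      by_cases h' : (N.senders u l (choice c w s)).card ≤
          2 * stepEstimate R L thr (N.senders u l (choice c w s)) s w
      · exact Or.inl ⟨hw, h'⟩
      · exact Or.inr ⟨hw, not_le.1 h'⟩
    have h1 := (measureReal_mono (μ := randomness V) hsub).trans (measureReal_union_le _ _)
    have h2 : (1 : ℝ) / (8 * c) = 1 / 2 * (1 / (4 * c)) := by field_simp; ring
    rw [h2]
    linarith
  · have h5 : (16 : ℝ) * c ≤ (N.holders u l).card := by exact_mod_cast h
    have h6 : (8 : ℝ) ≤ (N.holders u l).card * (1 / (2 * c)) := by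
      rw [mul_one_div, le_div_iff₀ (by positivity)]
      linarith
    have h7 : (2 : ℝ) ≤ (N.senders u l k).card := by linarith [hk.2]
    exact_mod_cast h7

/-- With high probability the count of a channel with many holders is not much smaller than
expected. -/
lemma measureReal_channelCount_le {δ : ℝ} (hδ : 0 < δ) (hδ1 : δ ≤ 1)
    (hthr : thr = (1 + δ) * (8 * Real.exp (-7))) (hthr' : thr ≤ 1 / 128)
    (hε : Real.exp (-(L / 96)) + R * Real.exp (-(L * (8 * Real.exp (-7)) * δ ^ 2 / 4)) ≤ 1 / 2)
    (hRL : 0 < R * L) (l : Fin c) (h : 16 * c ≤ (N.holders u l).card)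
    (hR2 : (N.holders u l).card ≤ 2 ^ R) :
    (randomness V).real {w | (channelCount N T₁ R L thr u w l : ℝ) <
      (N.holders u l).card * (T₁ / (512 * c ^ 2))} ≤ Real.exp (-(T₁ / (24 * c))) := by
  classical
  have hc : (0 : ℝ) < c := by exact_mod_cast l.pos
  have h1 := few_successes_le (Finset.range T₁) _ (pairwiseDisjoint_steps V 0 (R * L) _)
    (fun q => richStep N R L thr u l (0 + q * (R * L)))
    (fun q _ => measurableSet_richStep hRL l q) (1 / (8 * c)) (by positivity)
    (fun q _ => le_measureReal_richStep hδ hδ1 hthr hthr' hε l _ h hR2)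
  rw [Finset.card_range] at h1
  refine le_trans (measureReal_mono fun w hw => ?_) (h1.trans_eq ?_)
  · simp only [Set.mem_ofPred_eq] at hw ⊢
    by_contra hcon
    refine absurd hw (not_lt.2 ?_)
    -- A rich step has more than h/(8c) senders for h holders, and its estimate is at least half of
    -- that. With at least T₁/(32c) rich steps the total is h·T₁/(512c²).
    have hq : ∀ q ∈ Finset.range T₁,
        (if w ∈ richStep N R L thr u l (0 + q * (R * L)) then
          ((N.holders u l).card : ℝ) / (16 * c) else 0) ≤
        ((if choice c w (q * (R * L)) u = (false, some l) then
          stepEstimate R L thr (N.senders u l (choice c w (q * (R * L)))) (q * (R * L)) w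
          else 0 : ℕ) : ℝ) := by
      intro q _
      split_ifs with hr hl hl
      · rw [zero_add] at hr
        have h2 : ((N.senders u l (choice c w (q * (R * L)))).card : ℝ) ≤
          2 * stepEstimate R L thr (N.senders u l (choice c w (q * (R * L)))) (q * (R * L)) w := by
          exact_mod_cast hr.2
        have h3 := hr.1.2
        have h4 : ((N.holders u l).card : ℝ) / (16 * c) =
          ((N.holders u l).card : ℝ) * (1 / (2 * c)) / 4 / 2 := by field_simp; ring
        rw [h4]
        linarith
      · rw [zero_add] at hr
        exact absurd hr.1.1 hl
      · exact Nat.cast_nonneg _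
      · simp
    have hsum := Finset.sum_le_sum hq
    rw [← Finset.sum_filter, Finset.sum_const, nsmul_eq_mul] at hsum
    have hcnt : (∑ q ∈ Finset.range T₁, ((if choice c w (q * (R * L)) u = (false, some l) then
          stepEstimate R L thr (N.senders u l (choice c w (q * (R * L)))) (q * (R * L)) w
          else 0 : ℕ) : ℝ)) = channelCount N T₁ R L thr u w l := by
      rw [← Nat.cast_sum]
      unfold channelCount
      congr
    rw [hcnt] at hsum
    refine le_trans ?_ hsum
    have hcon' : (T₁ : ℝ) * (1 / (8 * c)) / 4 ≤ ((Finset.range T₁).filter fun q =>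
        w ∈ richStep N R L thr u l (0 + q * (R * L))).card := by
      have := (not_le.1 hcon).le
      convert this
    calc ((N.holders u l).card : ℝ) * (T₁ / (512 * c ^ 2))
        = T₁ * (1 / (8 * c)) / 4 * ((N.holders u l).card / (16 * c)) := by
          field_simp; ring
      _ ≤ _ := by gcongr
  · congr 1
    field_simp
    ring

end CKSeek

/-! ### Part two on dense channels. -/

namespace CKSeek

variable {V Ch : Type*} {c : ℕ} [Fintype V] {N : Network V Ch c}
variable {T₁ T₂ R L : ℕ} {thr : ℝ} {u v : V}

lemma measurable_stepEstimate_senders {A : Set (V × ℕ × ℕ)} {s : ℕ} (l : Fin c)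
    (h : ∀ x, (x, s, 0) ∈ A ∧ (x, s, 1) ∈ A)
    (hA : ∀ x t, s ≤ t → t < s + R * L → (x, t, 2) ∈ A) :
    Measurable[coordSigma A] fun w =>
      stepEstimate R L thr (N.senders u l (choice c w s)) s w := fun t ht =>
  measurableSet_of_choices h (fun k w => stepEstimate R L thr (N.senders u l k) s w ∈ t)
    fun k => measurable_stepEstimate (N.senders u l k) s hA ht

/-- The counts read only the slots of part one, which makes them independent of all random numbers
of part two. -/
lemma measurableSet_channelCount_eq (hRL : 0 < R * L) (κ : Fin c → ℕ) :
    MeasurableSet[coordSigma (slotCoords V 0 (T₁ * (R * L)))]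
      {w | channelCount N T₁ R L thr u w = κ} := by
  have hm : ∀ l, Measurable[coordSigma (slotCoords V 0 (T₁ * (R * L)))]
      fun w => channelCount N T₁ R L thr u w l := by
    intro l
    refine Finset.measurable_fun_sum (m := coordSigma _) _ fun q hq => ?_
    have hq' : (q + 1) * (R * L) ≤ T₁ * (R * L) :=
      Nat.mul_le_mul_right _ (Finset.mem_range.1 hq)
    rw [Nat.succ_mul] at hq'
    have h1 : ∀ (x : V) (m : ℕ), (x, q * (R * L), m) ∈ slotCoords V 0 (T₁ * (R * L)) := fun x m =>
      mem_slotCoords (Nat.zero_le _) (by omega)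
    refine Measurable.ite (m := coordSigma _) (measurableSet_choice (h1 u 0) (h1 u 1) _)
      (measurable_stepEstimate_senders l (fun x => ⟨h1 x 0, h1 x 1⟩) fun x t _ ht => ?_)
      measurable_const
    exact mem_slotCoords (Nat.zero_le _) (by omega)
  have h2 : {w | channelCount N T₁ R L thr u w = κ} =
      ⋂ l, {w | channelCount N T₁ R L thr u w l = κ l} := by
    ext w; simp [funext_iff]
  rw [h2]
  exact MeasurableSet.iInter (m := coordSigma _) fun l => hm l (measurableSet_singleton (κ l))

/-- Some slot of a step of part two has about the right broadcasting probability. -/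
lemma exists_backoff {n : ℕ} (hc : 0 < c) (h1 : c < n) (h2 : n ≤ 2 ^ R) :
    ∃ j, 1 ≤ j ∧ j ≤ R ∧ n ≤ c * 2 ^ j ∧ c * 2 ^ j ≤ 2 * n := by
  have hex : ∃ j, n ≤ c * 2 ^ j := ⟨R, h2.trans (Nat.le_mul_of_pos_left _ hc)⟩
  have h3 := Nat.find_spec hex
  -- The exponent is the least one that fits, so its predecessor yields the upper bound. It is not 0
  -- because c < n; this matters since part two has no slot with broadcasting probability 1.
  obtain ⟨j, hj⟩ : ∃ j, Nat.find hex = j + 1 := by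
    refine Nat.exists_eq_succ_of_ne_zero fun h0 => ?_
    rw [h0] at h3
    omega
  have h4 := Nat.find_min hex (m := j) (by omega)
  refine ⟨Nat.find hex, by omega,
    Nat.find_min' hex (h2.trans (Nat.le_mul_of_pos_left _ hc)), h3, ?_⟩
  rw [hj, pow_succ, ← mul_assoc]
  omega

/-- Part two discovers a neighbor on the shared channels with many holders, if the counts are
accurate. -/
lemma measureReal_not_discovered_partTwo_le (hR : 1 ≤ R) (hL : 1 ≤ L) (Λ : Finset (Fin c))
    (hΛ : ∀ l ∈ Λ, v ∈ N.holders u l) (hΛ1 : ∀ l ∈ Λ, 16 * c ≤ (N.holders u l).card)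
    (hΛ2 : ∀ l ∈ Λ, (N.holders u l).card ≤ 2 ^ R) {x y : ℝ} (hx : 0 < x) (hy : 0 < y) :
    (randomness V).real {w | ((∀ l ∈ Λ, (N.holders u l).card * x ≤
        (channelCount N T₁ R L thr u w l : ℝ)) ∧
      ((∑ l, channelCount N T₁ R L thr u w l : ℕ) : ℝ) ≤ y) ∧
      v ∉ (protocol V c T₁ T₂ R L thr).discovered N w u} ≤
      Real.exp (-(T₂ * (Λ.card * (x / (16 * y))))) := by
  classical
  have hRL : 0 < R * L := Nat.mul_pos hR hL
  have hcpos : ∀ _ : Fin c, 0 < c := fun l => l.pos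
  have hj : ∀ l : Fin c, ∃ j, l ∈ Λ → 1 ≤ j ∧ j ≤ R ∧ (N.holders u l).card ≤ c * 2 ^ j ∧
      c * 2 ^ j ≤ 2 * (N.holders u l).card := by
    intro l
    by_cases hl : l ∈ Λ
    · obtain ⟨j, hj⟩ := exists_backoff (hcpos l) (n := (N.holders u l).card)
        (by have := hΛ1 l hl; have := hcpos l; omega) (hΛ2 l hl)
      exact ⟨j, fun _ => hj⟩
    · exact ⟨0, fun h => absurd h hl⟩
  choose j hj using hj
  set T := T₁ * (R * L) with hT
  set U : (Fin c → ℕ) → ℕ → Fin c → Set (Tape V) := fun κ q l =>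
    {w | isBroadcaster (fun i => w (u, i)) (T + q * R) = false ∧
      pick κ (w (u, T + q * R, 1)) = some l} with hU
  set W : (Fin c → ℕ) → ℕ → Set (Tape V) := fun κ q => ⋃ l ∈ Λ,
    N.hears u l (T + q * R) (T + q * R + (R - j l)) (j l) v (U κ q l) with hW
  set G : Set (Fin c → ℕ) := {κ | (∀ l ∈ Λ, (N.holders u l).card * x ≤ (κ l : ℝ)) ∧
    ((∑ l, κ l : ℕ) : ℝ) ≤ y} with hG
  have hUm : ∀ {A : Set (V × ℕ × ℕ)} κ q l, (∀ m, (u, T + q * R, m) ∈ A) →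
      MeasurableSet[coordSigma A] (U κ q l) := fun κ q l hA =>
    MeasurableSet.inter (m := coordSigma _) (measurableSet_role (hA 0) _)
      (measurableSet_pick_coord (hA 1) _ _)
  have hWm : ∀ κ q, MeasurableSet[coordSigma (slotCoords V (T + q * R) (T + (q + 1) * R))]
      (W κ q) := by
    intro κ q
    refine Finset.measurableSet_biUnion (m := coordSigma _) _ fun l hl => ?_
    refine Network.measurableSet_hears u l _ v (hUm κ q l fun m => mem_step T hR u m)
      (fun x => mem_step T hR x 0) (fun x => mem_step T hR x 1) fun x => ?_
    have := (hj l hl).1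
    exact mem_slotCoords (by omega) (by rw [Nat.succ_mul]; omega)
  -- For fixed counts in `G`, label l with h holders is listened to with probability at least
  -- h·x/(2y), and v is then heard with probability at least 1/(8h). The number of holders cancels.
  have hWp : ∀ κ ∈ G, ∀ q, Λ.card * (x / (16 * y)) ≤ (randomness V).real (W κ q) := by
    intro κ hκ q
    refine le_trans ?_ (le_measureReal_biUnion_hears Λ hΛ (T + q * R)
      (fun l => T + q * R + (R - j l)) j (U κ q)
      (fun l _ => hUm κ q l (mem_nodeCoords _ _)) ?_ (K := 1)
      (fun l hl => by simpa using (hj l hl).2.2.1))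
    · rw [← nsmul_eq_mul]
      refine Finset.card_nsmul_le_sum _ _ _ fun l hl => ?_
      have hc : (0 : ℝ) < c := by exact_mod_cast hcpos l
      have hn0 : 0 < (N.holders u l).card := by
        have := hΛ1 l hl; have := hcpos l; omega
      have hn : (0 : ℝ) < (N.holders u l).card := by exact_mod_cast hn0
      have hκl : 0 < (κ l : ℝ) := lt_of_lt_of_le (by positivity) (hκ.1 l hl)
      have hle : κ l ≤ ∑ l, κ l := Finset.single_le_sum (fun _ _ => Nat.zero_le _)
        (Finset.mem_univ l)
      have hsum : 0 < ∑ l, κ l := lt_of_lt_of_le (by exact_mod_cast hκl) hle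
      have hsum' : (0 : ℝ) < (∑ l, κ l : ℕ) := by exact_mod_cast hsum
      have hprob : (randomness V).real (U κ q l) = 1 / 2 * ((κ l : ℝ) / (∑ l, κ l : ℕ)) :=
        measureReal_role_pick u (T + q * R) false κ l hsum
      rw [hprob]
      have h3 : (N.holders u l).card * x / y ≤ (κ l : ℝ) / (∑ l, κ l : ℕ) :=
        div_le_div₀ hκl.le (hκ.1 l hl) hsum' hκ.2
      have h4 : 1 / (4 * ((N.holders u l).card : ℝ)) ≤ 1 / (2 * c) * (1 / 2) ^ j l := by
        have h5 : (c : ℝ) * 2 ^ j l ≤ 2 * (N.holders u l).card := by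
          exact_mod_cast (hj l hl).2.2.2
        rw [one_div_pow, div_mul_div_comm, one_mul, div_le_div_iff₀ (by positivity) (by positivity)]
        linarith
      calc x / (16 * y) = 1 / 2 * ((N.holders u l).card * x / y) *
            (1 / (4 * ((N.holders u l).card : ℝ)) * (1 / 2) ^ 1) := by field_simp; ring
        _ ≤ _ := by gcongr
    · intro l _ l' _ hne
      refine Set.disjoint_left.2 fun w hw hw' => hne ?_
      exact Option.some_inj.1 (hw.2.symm.trans hw'.2)
  -- Failure of all steps, for frozen counts κ. The steps are independent for each κ, and the actual
  -- counts are inserted by conditioning.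
  set E : (Fin c → ℕ) → Set (Tape V) := fun κ => ⋂ q ∈ Finset.range T₂, (W κ q)ᶜ with hE
  have hcond := measureReal_conditional_le (A := slotCoords V 0 T)
    (B := slotCoords V T (T + T₂ * R)) (disjoint_slotCoords le_rfl)
    (fun w => channelCount N T₁ R L thr u w) (fun κ => measurableSet_channelCount_eq hRL κ) G E
    (fun κ => ?_) (Real.exp (-(T₂ * (Λ.card * (x / (16 * y)))))) (Real.exp_pos _).le ?_
  · refine le_trans (measureReal_mono fun w hw => ?_) (hcond.trans
      (mul_le_of_le_one_right (Real.exp_pos _).le measureReal_le_one))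
    refine ⟨hw.1, Set.mem_iInter₂.2 fun q hq hmem => hw.2 ?_⟩
    obtain ⟨l, hl, hmem⟩ := Set.mem_iUnion₂.1 hmem
    have hjl := hj l hl
    refine mem_discovered_of_partTwo N (Finset.mem_range.1 hq) (i := R - j l) (by omega) (hΛ l hl)
      hmem.1.1 hmem.1.2 (U := U (channelCount N T₁ R L thr u w) q l) ?_
    rwa [Nat.sub_sub_self hjl.2.1]
  · refine Finset.measurableSet_biInter (m := coordSigma _) _ fun q hq => ?_
    have hq' : (q + 1) * R ≤ T₂ * R := Nat.mul_le_mul_right _ (Finset.mem_range.1 hq)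
    refine coordSigma_mono ?_ _ (hWm κ q).compl
    exact fun i hi => ⟨(Nat.le_add_right _ _).trans hi.1,
      hi.2.trans_le (Nat.add_le_add_left hq' _)⟩
  · intro κ hκ
    have h1 := no_success_le (Finset.range T₂) _ (pairwiseDisjoint_steps V T R _) (W κ)
      (fun q _ => hWm κ q) (Λ.card * (x / (16 * y))) (fun q _ => hWp κ hκ q)
    rwa [Finset.card_range] at h1

end CKSeek

/-! ### Double counting of shared channels. -/

namespace Network

variable {V Ch : Type*} {c : ℕ} [Fintype V] {N : Network V Ch c}

open Classical in
/-- The labels of `u` whose channels are shared with `v`. -/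
noncomputable def sharedLabels (N : Network V Ch c) (u v : V) : Finset (Fin c) :=
  Finset.univ.filter fun l => ∃ l', N.chan v l' = N.chan u l

omit [Fintype V] in
lemma card_sharedLabels (u v : V) : (N.sharedLabels u v).card = N.overlap u v := by
  classical
  have h : N.shared u v = N.chan u '' (N.sharedLabels u v : Set (Fin c)) := by
    ext x
    simp only [shared, sharedLabels, Set.mem_inter_iff, Set.mem_range, Finset.coe_filter,
      Finset.mem_univ, true_and, Set.mem_image, Set.mem_ofPred_eq]
    constructor
    · rintro ⟨⟨l, rfl⟩, h⟩
      exact ⟨l, h, rfl⟩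
    · rintro ⟨l, h, rfl⟩
      exact ⟨⟨l, rfl⟩, h⟩
  rw [overlap, h, Set.ncard_image_of_injective _ (N.chan u).injective, Set.ncard_coe_finset]

lemma mem_holders_of_mem_sharedLabels {u v : V} (h : N.graph.Adj u v) {l : Fin c}
    (hl : l ∈ N.sharedLabels u v) : v ∈ N.holders u l := by
  classical
  exact mem_holders.2 ⟨h, by simpa [sharedLabels] using hl⟩

lemma ncard_neighborSet_le_maxDeg (u : V) : (N.graph.neighborSet u).ncard ≤ N.maxDeg :=
  Finset.le_sup (f := fun u => (N.graph.neighborSet u).ncard) (Finset.mem_univ u)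

lemma ncard_goodNeighbors_le_maxGoodDeg (khat : ℕ) (u : V) :
    (N.goodNeighbors khat u).ncard ≤ N.maxGoodDeg khat :=
  Finset.le_sup (f := fun u => (N.goodNeighbors khat u).ncard) (Finset.mem_univ u)

lemma maxDeg_le_card : N.maxDeg ≤ Fintype.card V :=
  Finset.sup_le fun u _ => by
    rw [← Nat.card_eq_fintype_card, ← Set.ncard_univ]
    exact Set.ncard_le_ncard (Set.subset_univ _)

lemma card_holders_le_maxDeg (u : V) (l : Fin c) : (N.holders u l).card ≤ N.maxDeg := by
  refine le_trans ?_ (ncard_neighborSet_le_maxDeg u)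
  rw [← Set.ncard_coe_finset]
  exact Set.ncard_le_ncard fun x hx => (mem_holders.1 hx).1

lemma degSum_eq (u : V) [DecidablePred (N.graph.Adj u)] :
    N.degSum u = ∑ x ∈ Finset.univ.filter (N.graph.Adj u), N.overlap u x := by
  classical
  simp only [degSum, Finset.card_eq_sum_ones, holders, Finset.sum_filter]
  rw [Finset.sum_comm]
  refine Finset.sum_congr rfl fun x _ => ?_
  rw [← card_sharedLabels, sharedLabels, Finset.card_filter]
  split_ifs with h
  · exact Finset.sum_congr rfl fun l _ => by simp [h]
  · exact Finset.sum_eq_zero fun l _ => by simp [h]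

/-- Summing overlaps over the neighbors instead of holders over the channels: a good neighbor
contributes at most kmax, any other fewer than khat. -/
lemma degSum_le {kmax khat : ℕ} (hk : ∀ u v, N.graph.Adj u v → N.overlap u v ≤ kmax) (u : V) :
    N.degSum u ≤ kmax * N.maxGoodDeg khat + khat * N.maxDeg := by
  classical
  have h1 : ∀ x ∈ Finset.univ.filter (N.graph.Adj u), N.overlap u x ≤
      (if khat ≤ N.overlap u x then kmax else 0) + khat := by
    intro x hx
    split_ifs with h
    · exact (hk u x (Finset.mem_filter.1 hx).2).trans (Nat.le_add_right _ _)
    · omega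
  rw [degSum_eq]
  refine (Finset.sum_le_sum h1).trans ?_
  rw [Finset.sum_add_distrib, ← Finset.sum_filter, Finset.sum_const, Finset.sum_const, smul_eq_mul,
    smul_eq_mul, mul_comm, mul_comm _ khat]
  have h2 : ((Finset.univ.filter (N.graph.Adj u)).filter fun x => khat ≤ N.overlap u x).card ≤
      N.maxGoodDeg khat := by
    refine le_trans ?_ (ncard_goodNeighbors_le_maxGoodDeg khat u)
    rw [← Set.ncard_coe_finset]
    refine Set.ncard_le_ncard fun x hx => ?_
    simpa [goodNeighbors] using hx
  have h3 : (Finset.univ.filter (N.graph.Adj u)).card ≤ N.maxDeg := by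
    refine le_trans ?_ (ncard_neighborSet_le_maxDeg u)
    rw [← Set.ncard_coe_finset]
    refine Set.ncard_le_ncard fun x hx => ?_
    simpa using hx
  gcongr

lemma overlap_le_degSum {u v : V} (h : N.graph.Adj u v) : N.overlap u v ≤ N.degSum u := by
  classical
  rw [degSum_eq]
  exact Finset.single_le_sum (f := fun x => N.overlap u x) (fun _ _ => Nat.zero_le _)
    (Finset.mem_filter.2 ⟨Finset.mem_univ v, h⟩)

end Network

/-! ### The failure probability for one pair of nodes. -/

namespace CKSeek

variable {V Ch : Type*} {c : ℕ} [Fintype V] {N : Network V Ch c}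

/-- A node fails to discover a fixed good neighbor only with small probability. -/
lemma measureReal_not_discovered_le {T₁ T₂ R L n khat : ℕ} {thr δ β Q : ℝ} {u v : V}
    (hδ : 0 < δ) (hδ1 : δ ≤ 1) (hβ : 1 ≤ β) (hthr : thr = (1 + δ) * (8 * Real.exp (-7)))
    (hthr' : thr ≤ 1 / 128) (hn : 2 ≤ n) (hk1 : 1 ≤ khat) (hkc : khat ≤ c)
    (hv : v ∈ N.goodNeighbors khat u) (hR : 1 ≤ R) (hRn : 2 ^ (R - 1) ≤ n)
    (hN2 : ∀ l, (N.holders u l).card ≤ 2 ^ R) (hNn : ∀ l, (N.holders u l).card ≤ n)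
    (hQ : (N.degSum u : ℝ) ≤ Q)
    (hT₁ : 2 ^ 19 * β * ((c : ℝ) ^ 2 / khat) * Real.log n ≤ T₁)
    (hT₂ : 278528 * β * (Q / khat) * Real.log n ≤ T₂)
    (hL : (96 * (β + 1) + 12 / (8 * Real.exp (-7) * δ ^ 2)) * Real.log n ≤ L) :
    (randomness V).real {w | v ∉ (protocol V c T₁ T₂ R L thr).discovered N w u} ≤
      3 * n * Real.exp (-(β * Real.log n)) := by
  classical
  have hn' : (2 : ℝ) ≤ n := by exact_mod_cast hn
  have hlog : 0 < Real.log n := Real.log_pos (by linarith)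
  have hexpn : Real.exp (-Real.log n) = 1 / n := by
    rw [Real.exp_neg, Real.exp_log (by linarith), one_div]
  have hk0 : (0 : ℝ) < khat := by exact_mod_cast hk1
  have hkc' : (khat : ℝ) ≤ c := by exact_mod_cast hkc
  have hc0 : (0 : ℝ) < c := hk0.trans_le hkc'
  have hthr0 : 0 ≤ thr := by rw [hthr]; positivity
  set τ : ℝ := 8 * Real.exp (-7) with hτ
  have hτ0 : 0 < τ := by positivity
  -- The extra 1 next to β pays for the factor 2^(R-1) ≤ n in the bound for overcounts.
  have hL96 : (β + 1) * Real.log n ≤ L / 96 := by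
    have : 0 ≤ 12 / (τ * δ ^ 2) * Real.log n := by positivity
    linarith
  have hLτ : 3 * Real.log n ≤ L * τ * δ ^ 2 / 4 := by
    have h1 : 12 / (τ * δ ^ 2) * Real.log n ≤ L := by
      have : 0 ≤ 96 * (β + 1) * Real.log n := by positivity
      linarith
    rw [div_mul_eq_mul_div, div_le_iff₀ (by positivity)] at h1
    linarith
  have hL1 : 1 ≤ L := by
    rw [Nat.one_le_iff_ne_zero]
    rintro rfl
    have : 0 < (β + 1) * Real.log n := by positivity
    simp only [Nat.cast_zero, zero_div] at hL96
    linarith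
  have hT₁0 : (0 : ℝ) < T₁ := lt_of_lt_of_le (by positivity) hT₁
  have hT₁1 : 1 ≤ T₁ := by exact_mod_cast hT₁0
  have hT₁k : 2 ^ 19 * β * Real.log n ≤ T₁ * (khat / c ^ 2) := by
    calc 2 ^ 19 * β * Real.log n
        = 2 ^ 19 * β * ((c : ℝ) ^ 2 / khat) * Real.log n * (khat / c ^ 2) := by field_simp
      _ ≤ _ := by gcongr
  have hβl : 0 < β * Real.log n := by positivity
  set Λ := N.sharedLabels u v with hΛ
  have hΛmem : ∀ l ∈ Λ, v ∈ N.holders u l := fun l hl =>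
    Network.mem_holders_of_mem_sharedLabels hv.1 hl
  have hΛcard : khat ≤ Λ.card := by rw [hΛ, Network.card_sharedLabels]; exact hv.2
  have hS : (khat : ℝ) ≤ N.degSum u := by
    exact_mod_cast hv.2.trans (Network.overlap_le_degSum hv.1)
  have hS0 : (0 : ℝ) < N.degSum u := hk0.trans_le hS
  set Λs := Λ.filter fun l => (N.holders u l).card ≤ 16 * c with hΛs
  set Λd := Λ.filter fun l => ¬ (N.holders u l).card ≤ 16 * c with hΛd
  have hsplit : Λs.card + Λd.card = Λ.card := Finset.card_filter_add_card_filter_not _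
  set e : ℝ := Real.exp (-(β * Real.log n)) with he
  have he0 : 0 < e := Real.exp_pos _
  rcases Nat.lt_or_ge (2 * Λs.card) khat with hs | hs
  · have hd : khat ≤ 2 * Λd.card := by omega
    have hd' : (khat : ℝ) ≤ 2 * Λd.card := by exact_mod_cast hd
    have hdense : ∀ l ∈ Λd, 16 * c ≤ (N.holders u l).card := fun l hl =>
      (not_le.1 (Finset.mem_filter.1 hl).2).le
    -- A dense channel has at least 16c holders among n nodes, so the union over the at most c dense
    -- labels costs no more than a factor n.
    have hcn : c ≤ n := by
      obtain ⟨l, hl⟩ : Λd.Nonempty := Finset.card_pos.1 (by omega)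
      have := hdense l hl
      have := hNn l
      omega
    have hΛdn : (Λd.card : ℝ) ≤ n := by
      have h1 : Λd.card ≤ c := (Finset.card_le_univ _).trans_eq (Fintype.card_fin c)
      exact_mod_cast h1.trans hcn
    -- Each of the two summands is at most 1/n² ≤ 1/4, the second one because R ≤ n.
    have hε : Real.exp (-(L / 96)) + R * Real.exp (-(L * τ * δ ^ 2 / 4)) ≤ 1 / 2 := by
      have h1 : Real.exp (-(L / 96)) ≤ (1 / n) ^ 2 := by
        rw [← hexpn, ← Real.exp_nat_mul]
        refine Real.exp_le_exp.2 ?_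
        push_cast
        nlinarith
      have h2 : Real.exp (-(L * τ * δ ^ 2 / 4)) ≤ (1 / n) ^ 3 := by
        rw [← hexpn, ← Real.exp_nat_mul]
        refine Real.exp_le_exp.2 ?_
        push_cast
        linarith
      have h3 : (R : ℝ) ≤ n := by
        have : R - 1 < 2 ^ (R - 1) := Nat.lt_two_pow_self
        exact_mod_cast (by omega : R ≤ n)
      have h4 : (R : ℝ) * Real.exp (-(L * τ * δ ^ 2 / 4)) ≤ (1 / n) ^ 2 := by
        calc (R : ℝ) * Real.exp (-(L * τ * δ ^ 2 / 4)) ≤ n * (1 / n) ^ 3 := by gcongr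
          _ = (1 / n) ^ 2 := by field_simp
      have h5 : ((1 : ℝ) / n) ^ 2 ≤ (1 / 2) ^ 2 := by gcongr
      norm_num at h5 ⊢
      norm_num at h1 h4
      linarith
    set X : ℝ := T₁ * N.degSum u / c ^ 2 with hX
    have hX0 : 0 < X := by positivity
    have hsub : {w | v ∉ (protocol V c T₁ T₂ R L thr).discovered N w u} ⊆
        ({w | 17 * X ≤ ((∑ l, channelCount N T₁ R L thr u w l : ℕ) : ℝ)} ∪
          ⋃ l ∈ Λd, {w | (channelCount N T₁ R L thr u w l : ℝ) <
            (N.holders u l).card * (T₁ / (512 * c ^ 2))}) ∪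
        {w | ((∀ l ∈ Λd, (N.holders u l).card * ((T₁ : ℝ) / (512 * c ^ 2)) ≤
          (channelCount N T₁ R L thr u w l : ℝ)) ∧
          ((∑ l, channelCount N T₁ R L thr u w l : ℕ) : ℝ) ≤ 17 * X) ∧
          v ∉ (protocol V c T₁ T₂ R L thr).discovered N w u} := by
      intro w hw
      by_contra hcon
      rw [Set.mem_union, Set.mem_union, not_or, not_or] at hcon
      obtain ⟨⟨h1, h2⟩, h3⟩ := hcon
      refine h3 ⟨⟨fun l hl => ?_, (not_le.1 h1).le⟩, hw⟩
      by_contra hlt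
      exact h2 (Set.mem_iUnion₂.2 ⟨l, hl, not_le.1 hlt⟩)
    have hp1 := measureReal_sum_channelCount_le (N := N) (u := u) (R := R) hthr0 hthr' hR hL1 hT₁1
      hk0 hkc' hS
    have hp2 : ∀ l ∈ Λd, (randomness V).real {w | (channelCount N T₁ R L thr u w l : ℝ) <
        (N.holders u l).card * (T₁ / (512 * c ^ 2))} ≤ Real.exp (-(T₁ / (24 * c))) := fun l hl =>
      measureReal_channelCount_le hδ hδ1 hthr hthr' hε (Nat.mul_pos hR hL1) l (hdense l hl) (hN2 l)
    have hp3 := measureReal_not_discovered_partTwo_le (T₁ := T₁) (T₂ := T₂) (thr := thr)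
      hR hL1 Λd (fun l hl => hΛmem l (Finset.mem_filter.1 hl).1) hdense (fun l _ => hN2 l)
      (x := T₁ / (512 * c ^ 2)) (y := 17 * X) (by positivity) (by positivity)
    have hb1 : Real.exp (-(T₁ * khat / c ^ 2)) ≤ e := by
      refine Real.exp_le_exp.2 (neg_le_neg ?_)
      rw [mul_div_assoc]
      linarith
    have hb1' : 2 ^ (R - 1) * Real.exp (-(L / 96)) ≤ e := by
      have h1 : ((2 : ℝ)) ^ (R - 1) ≤ n := by exact_mod_cast hRn
      have h2 : Real.exp (-(L / 96)) ≤ e * (1 / n) := by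
        rw [he, ← hexpn, ← Real.exp_add]
        exact Real.exp_le_exp.2 (by linarith)
      calc 2 ^ (R - 1) * Real.exp (-(L / 96)) ≤ n * (e * (1 / n)) := by gcongr
        _ = e := by field_simp
    have hb2 : Real.exp (-(T₁ / (24 * c))) ≤ e := by
      refine Real.exp_le_exp.2 (neg_le_neg ?_)
      have h1 : (T₁ : ℝ) * (khat / c ^ 2) ≤ T₁ * (1 / c) := by
        refine mul_le_mul_of_nonneg_left ?_ hT₁0.le
        rw [div_le_div_iff₀ (by positivity) hc0]
        nlinarith
      have h2 : (T₁ : ℝ) / (24 * c) = T₁ * (1 / c) / 24 := by field_simp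
      rw [h2]
      linarith
    -- T₁ and c cancel and 139264 = 512·16·17 remains; the constant in T₂ is twice that, since only
    -- khat/2 channels are known to be dense.
    have hb3 : Real.exp (-(T₂ * (Λd.card * (T₁ / (512 * c ^ 2) / (16 * (17 * X)))))) ≤ e := by
      refine Real.exp_le_exp.2 (neg_le_neg ?_)
      have h1 : (T₁ : ℝ) / (512 * c ^ 2) / (16 * (17 * X)) = 1 / (139264 * N.degSum u) := by
        rw [hX]; field_simp; norm_num
      rw [h1]
      have hQk : (N.degSum u : ℝ) / khat ≤ Q / khat := by gcongr
      calc β * Real.log n = 278528 * β * ((N.degSum u : ℝ) / khat) * Real.log n *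
            (khat / 2 * (1 / (139264 * N.degSum u))) := by field_simp; norm_num
        _ ≤ T₂ * (Λd.card * (1 / (139264 * N.degSum u))) := by
            refine mul_le_mul (le_trans (by gcongr) hT₂) ?_ (by positivity) (Nat.cast_nonneg _)
            refine mul_le_mul_of_nonneg_right (by linarith) (by positivity)
    have hunion : (randomness V).real (⋃ l ∈ Λd, {w | (channelCount N T₁ R L thr u w l : ℝ) <
        (N.holders u l).card * (T₁ / (512 * c ^ 2))}) ≤ n * e := by
      refine (measureReal_biUnion_finset_le _ _).trans ((Finset.sum_le_sum hp2).trans ?_)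
      rw [Finset.sum_const, nsmul_eq_mul]
      gcongr
    refine (measureReal_mono hsub).trans ((measureReal_union_le _ _).trans
      ((add_le_add ((measureReal_union_le _ _).trans (add_le_add hp1 hunion)) hp3).trans ?_))
    have hne : 2 * e ≤ n * e := mul_le_mul_of_nonneg_right hn' he0.le
    linarith
  · have h1 := measureReal_not_discovered_partOne_le (T₁ := T₁) (T₂ := T₂) (thr := thr) hR hL1 Λs
      (fun l hl => hΛmem l (Finset.mem_filter.1 hl).1) (fun l hl => (Finset.mem_filter.1 hl).2)
    have hs' : (khat : ℝ) ≤ 2 * Λs.card := by exact_mod_cast hs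
    refine h1.trans (le_trans (b := e) (Real.exp_le_exp.2 (neg_le_neg ?_)) ?_)
    -- The exponent 19 collects 1/2 for the share of sparse channels, 1/2 for each of the two roles,
    -- and 2^(-16) for the silence of the other holders.
    · calc β * Real.log n = 2 ^ 19 * β * Real.log n / 2 ^ 19 := by field_simp
        _ ≤ T₁ * (khat / c ^ 2) / 2 ^ 19 := by gcongr
        _ = T₁ * (khat / 2 * (1 / (2 * c) * (1 / (2 * c) * (1 / 2) ^ 16))) := by
            field_simp
        _ ≤ _ := by
            gcongr
            linarith
    · have hne : 2 * e ≤ n * e := mul_le_mul_of_nonneg_right hn' he0.le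
      linarith

lemma two_pow_rounds_le {D n : ℕ} (hD : D ≤ n) (hn : 1 ≤ n) :
    2 ^ (max 1 (Nat.clog 2 D) - 1) ≤ n := by
  rcases Nat.lt_or_ge 1 D with h | h
  · have h1 := Nat.pow_pred_clog_lt_self (b := 2) (by norm_num) h
    have h2 : 0 < Nat.clog 2 D := Nat.clog_pos (by norm_num) h
    rw [max_eq_right h2]
    exact h1.le.trans hD
  · rw [Nat.clog_of_right_le_one h]
    simpa using hn

end CKSeek

/-! ### The threshold, the number of slots, and the union bound. -/

lemma threshold_le {δ : ℝ} (hδ : δ ≤ 1 / 20) : (1 + δ) * (8 * Real.exp (-7)) ≤ 1 / 128 := by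
  have h1 : Real.exp (-7) ≤ 1 / 1080 := by
    rw [Real.exp_neg, one_div]
    refine inv_anti₀ (by norm_num) ?_
    have h2 : Real.exp 7 = Real.exp 1 ^ 7 := by rw [← Real.exp_nat_mul]; norm_num
    rw [h2]
    calc (1080 : ℝ) ≤ 2.718 ^ 7 := by norm_num
      _ ≤ _ := by
        gcongr
        linarith [Real.exp_one_gt_d9]
  have := Real.exp_pos (-7)
  nlinarith

/-- The number of rounds R is at most 2·lg n for n ≥ 2. The summand c in the length of part two is
absorbed by c²/khat ≥ c, and rounding up costs only constants because the main terms are at least 1.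
-/
lemma ckSeek_slots_le (V : Type*) {δ a A B : ℝ} (ha : 0 < a) (hA : 0 < A) (hB : 0 < B)
    {n c kmax khat D Dhat : ℕ} (hn : 1 ≤ n) (hD : D ≤ n) (hk : 1 ≤ khat) (hkc : khat ≤ c) :
    ((ckSeek V δ a A B n c kmax khat D Dhat).slots : ℝ) ≤
      (2 * (A + 1) * (a + 1) + 2 * B + 2) * ((c : ℝ) ^ 2 / khat * Real.logb 2 n ^ 3 +
        ((kmax : ℝ) / khat * Dhat + D) * Real.logb 2 n ^ 2) := by
  rcases Nat.lt_or_ge n 2 with h1 | h2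
  -- Here lg n = 0, so both numbers of steps are 0.
  · have : n = 1 := by omega
    subst this
    simp [ckSeek, CKSeek.protocol]
  · set g := Real.logb 2 n with hg
    have hn' : (2 : ℝ) ≤ n := by exact_mod_cast h2
    have hg1 : 1 ≤ g := by
      rw [hg, Real.le_logb_iff_rpow_le (by norm_num) (by linarith)]
      simpa using hn'
    have hk0 : (0 : ℝ) < khat := by exact_mod_cast hk
    have hkc' : (khat : ℝ) ≤ c := by exact_mod_cast hkc
    have hc0 : (0 : ℝ) < c := hk0.trans_le hkc'
    have hc1 : (1 : ℝ) ≤ c := by exact_mod_cast hk.trans hkc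
    set P : ℝ := (c : ℝ) ^ 2 / khat with hP
    set Q : ℝ := (kmax : ℝ) / khat * Dhat + D with hQ
    have hQ0 : 0 ≤ Q := by positivity
    have hcP : (c : ℝ) ≤ P := by
      rw [hP, le_div_iff₀ hk0]
      nlinarith
    have hP1 : 1 ≤ P := hc1.trans hcP
    set R := max 1 (Nat.clog 2 D) with hRdef
    have hR : (R : ℝ) ≤ 2 * g := by
      have h3 := CKSeek.two_pow_rounds_le hD hn
      have h4 : ((R - 1 : ℕ) : ℝ) ≤ g := by
        rw [hg, Real.le_logb_iff_rpow_le (by norm_num) (by linarith), Real.rpow_natCast]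
        exact_mod_cast h3
      have h5 : 1 ≤ R := le_max_left _ _
      push_cast [Nat.cast_sub h5] at h4
      linarith
    have hceil : ∀ x : ℝ, 0 ≤ x → (⌈x⌉₊ : ℝ) ≤ x + 1 := fun x hx => (Nat.ceil_lt_add_one hx).le
    have hL : (⌈a * g⌉₊ : ℝ) ≤ (a + 1) * g := by
      have := hceil (a * g) (by positivity)
      linarith
    have hPg : 1 ≤ P * g := by nlinarith
    have hT₁ : (⌈A * P * g⌉₊ : ℝ) ≤ (A + 1) * (P * g) := by
      have := hceil (A * P * g) (by positivity)
      linarith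
    have hT₂ : (⌈B * (Q + c) * g⌉₊ : ℝ) ≤ B * (Q + P) * g + 1 := by
      have h3 := hceil (B * (Q + c) * g) (by positivity)
      have h4 : B * (Q + c) * g ≤ B * (Q + P) * g := by gcongr
      linarith
    have hslots : ((ckSeek V δ a A B n c kmax khat D Dhat).slots : ℝ) =
        ⌈A * P * g⌉₊ * (R * ⌈a * g⌉₊) + ⌈B * (Q + c) * g⌉₊ * R := by
      simp only [ckSeek, CKSeek.protocol, Nat.cast_add, Nat.cast_mul, hP, hQ, hg, hRdef]
    rw [hslots]
    have hg0 : 0 < g := by linarith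
    have hP0 : 0 < P := by linarith
    have ht1 : (⌈A * P * g⌉₊ : ℝ) * (R * ⌈a * g⌉₊) ≤
        (A + 1) * (P * g) * (2 * g * ((a + 1) * g)) := by gcongr
    have ht2 : (⌈B * (Q + c) * g⌉₊ : ℝ) * R ≤ (B * (Q + P) * g + 1) * (2 * g) := by gcongr
    have hg23 : g ^ 2 ≤ g ^ 3 := pow_le_pow_right₀ hg1 (by norm_num)
    have hg13 : g ≤ g ^ 3 := le_self_pow₀ hg1 (by norm_num)
    have e1 : P * g ^ 2 * B ≤ P * g ^ 3 * B := by gcongr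
    have e2 : g ≤ P * g ^ 3 := by nlinarith
    have e3 : 0 ≤ Q * g ^ 2 * ((A + 1) * (a + 1) + 1) := by positivity
    nlinarith

section Union

variable {V Ch : Type*} {c : ℕ} [Fintype V] {N : Network V Ch c}

lemma le_measureReal_solvesDiscovery (P : Protocol V c) (khat : ℕ) (b : ℝ) (hb0 : 0 ≤ b)
    (hb : ∀ u, ∀ v ∈ N.goodNeighbors khat u,
      (randomness V).real {w | v ∉ P.discovered N w u} ≤ b) :
    1 - (Fintype.card V : ℝ) ^ 2 * b ≤ (randomness V).real {w | P.SolvesDiscovery N khat w} := by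
  classical
  have hsub : (Set.univ : Set (Tape V)) ⊆ {w | P.SolvesDiscovery N khat w} ∪
      ⋃ u ∈ (Finset.univ : Finset V), ⋃ v ∈ Finset.univ.filter (· ∈ N.goodNeighbors khat u),
        {w | v ∉ P.discovered N w u} := by
    intro w _
    by_contra hcon
    rw [Set.mem_union, not_or] at hcon
    refine hcon.1 fun u => ⟨fun v hv => ?_, CKSeek.discovered_subset N w P u⟩
    by_contra hnot
    exact hcon.2 (Set.mem_iUnion₂.2 ⟨u, Finset.mem_univ u, Set.mem_iUnion₂.2
      ⟨v, Finset.mem_filter.2 ⟨Finset.mem_univ v, hv⟩, hnot⟩⟩)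
  -- Success and the failures cover the whole space, so subadditivity suffices and the success event
  -- need not be shown measurable.
  have h1 : (1 : ℝ) ≤ _ := probReal_univ.symm.le.trans ((measureReal_mono hsub
    (measure_ne_top (randomness V) _)).trans (measureReal_union_le _ _))
  have h2 : (randomness V).real (⋃ u ∈ (Finset.univ : Finset V),
      ⋃ v ∈ Finset.univ.filter (· ∈ N.goodNeighbors khat u), {w | v ∉ P.discovered N w u}) ≤
      (Fintype.card V : ℝ) ^ 2 * b := by
    refine (measureReal_biUnion_finset_le _ _).trans ?_
    have h3 : ∀ u ∈ (Finset.univ : Finset V), (randomness V).real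
        (⋃ v ∈ Finset.univ.filter (· ∈ N.goodNeighbors khat u), {w | v ∉ P.discovered N w u}) ≤
        Fintype.card V * b := by
      intro u _
      refine (measureReal_biUnion_finset_le _ _).trans
        ((Finset.sum_le_sum fun v hv => hb u v (Finset.mem_filter.1 hv).2).trans ?_)
      rw [Finset.sum_const, nsmul_eq_mul]
      gcongr
      exact Finset.card_le_univ _
    refine (Finset.sum_le_sum h3).trans_eq ?_
    rw [Finset.sum_const, nsmul_eq_mul, Finset.card_univ]
    ring
  linarith

end Union

theorem mainTheorem2 :
    ∃ δ₀ : ℝ, 0 < δ₀ ∧ δ₀ < 1 ∧ ∀ δ : ℝ, 0 < δ → δ ≤ δ₀ → ∀ α : ℝ, 1 ≤ α →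
      ∃ a A B C : ℝ, 0 < a ∧ 0 < A ∧ 0 < B ∧ 0 < C ∧
        ∀ (V : Type*) [Fintype V] (Ch : Type*) (c k kmax khat : ℕ) (N : Network V Ch c),
          N.graph.Connected → 1 ≤ k → kmax ≤ c →
          (∀ u v, N.graph.Adj u v → k ≤ N.overlap u v ∧ N.overlap u v ≤ kmax) →
          k ≤ khat → khat ≤ c →
          (((ckSeek V δ a A B (Fintype.card V) c kmax khat N.maxDeg (N.maxGoodDeg khat)).slots : ℝ)
              ≤ C * ((c : ℝ) ^ 2 / khat * Real.logb 2 (Fintype.card V) ^ 3 +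
                ((kmax : ℝ) / khat * N.maxGoodDeg khat + N.maxDeg) *
                  Real.logb 2 (Fintype.card V) ^ 2)) ∧
          1 - 1 / (Fintype.card V : ℝ) ^ α ≤
            (randomness V).real {w |
              (ckSeek V δ a A B (Fintype.card V) c kmax khat N.maxDeg
                (N.maxGoodDeg khat)).SolvesDiscovery N khat w} := by
  refine ⟨1 / 20, by norm_num, by norm_num, fun δ hδ hδ20 α hα => ?_⟩
  -- The n² pairs with failure probability 3n·n^(-β) each sum up to at most n^(5-β), since 3 ≤ n²
  -- for n ≥ 2.
  set β : ℝ := α + 5 with hβ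
  have hβ1 : 1 ≤ β := by linarith
  have hβ0 : 0 < β := by linarith
  set a : ℝ := 96 * (β + 1) + 12 / (8 * Real.exp (-7) * δ ^ 2) with ha
  have ha0 : 0 < a := by positivity
  refine ⟨a, 2 ^ 19 * β, 278528 * β, _, ha0, by positivity, by positivity, ?_,
    fun V _ Ch c k kmax khat N hconn hk hkmax hov hkk hkc => ⟨ckSeek_slots_le V ha0
      (by positivity) (by positivity) ?_ Network.maxDeg_le_card (hk.trans hkk) hkc, ?_⟩⟩
  · positivity
  · have := hconn.nonempty
    exact Fintype.card_pos
  have hk1 : 1 ≤ khat := hk.trans hkk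
  have hk0 : (0 : ℝ) < khat := by exact_mod_cast hk1
  set n := Fintype.card V with hn
  -- For n = 1 the claimed lower bound for the probability is 0.
  rcases Nat.lt_or_ge n 2 with hn1 | hn2
  · have hn1' : n = 1 := by
      have := hconn.nonempty
      have : 0 < n := Fintype.card_pos
      omega
    rw [hn1', Nat.cast_one, Real.one_rpow]
    norm_num
  have hn' : (2 : ℝ) ≤ n := by exact_mod_cast hn2
  have hn0 : (0 : ℝ) < n := by linarith
  have hlog0 : 0 < Real.log n := Real.log_pos (by linarith)
  have hlog : Real.log n ≤ Real.logb 2 n := by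
    rw [Real.logb, le_div_iff₀ (Real.log_pos (by norm_num))]
    have : Real.log 2 ≤ 1 := by linarith [Real.log_two_lt_d9]
    nlinarith
  have hDn : N.maxDeg ≤ n := Network.maxDeg_le_card
  have hmain := le_measureReal_solvesDiscovery (N := N)
    (ckSeek V δ a (2 ^ 19 * β) (278528 * β) n c kmax khat N.maxDeg (N.maxGoodDeg khat)) khat
    (3 * n * Real.exp (-(β * Real.log n))) (by positivity) fun u v hv =>
      CKSeek.measureReal_not_discovered_le
        (Q := (kmax : ℝ) * N.maxGoodDeg khat + khat * N.maxDeg) hδ (by linarith) hβ1 rfl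
        (threshold_le hδ20) hn2 hk1 hkc hv (le_max_left _ _)
        (CKSeek.two_pow_rounds_le hDn (by omega)) (fun l => ?_)
        (fun l => (Network.card_holders_le_maxDeg u l).trans hDn) ?_ ?_ ?_ ?_
  · refine le_trans ?_ hmain
    have h1 : Real.exp (-(β * Real.log n)) = (n : ℝ) ^ (-β) := by
      rw [Real.rpow_def_of_pos hn0]
      congr 1
      ring
    have h2 : (n : ℝ) ^ (-β) * (n : ℝ) ^ 5 = 1 / (n : ℝ) ^ α := by
      rw [← Real.rpow_natCast (n : ℝ) 5, ← Real.rpow_add hn0, one_div, ← Real.rpow_neg hn0.le]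
      congr 1
      push_cast
      linarith
    have h3 : (n : ℝ) ^ 2 * (3 * n * Real.exp (-(β * Real.log n))) ≤ 1 / (n : ℝ) ^ α := by
      rw [h1, ← h2]
      have h4 : (3 : ℝ) * n ^ 3 ≤ n ^ 5 := by
        have h5 : (3 : ℝ) ≤ n ^ 2 := by nlinarith
        calc (3 : ℝ) * n ^ 3 ≤ n ^ 2 * n ^ 3 := by gcongr
          _ = (n : ℝ) ^ 5 := by ring
      calc (n : ℝ) ^ 2 * (3 * n * (n : ℝ) ^ (-β)) = (n : ℝ) ^ (-β) * (3 * n ^ 3) := by ring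
        _ ≤ _ := by gcongr
    linarith
  · exact ((Network.card_holders_le_maxDeg u l).trans (Nat.le_pow_clog (by norm_num) _)).trans
      (Nat.pow_le_pow_right (by norm_num) (le_max_right _ _))
  · exact_mod_cast Network.degSum_le (fun u v h => (hov u v h).2) u
  · refine le_trans ?_ (Nat.le_ceil _)
    gcongr
  · refine le_trans ?_ (Nat.le_ceil _)
    have h1 : ((kmax : ℝ) * N.maxGoodDeg khat + khat * N.maxDeg) / khat =
        (kmax : ℝ) / khat * N.maxGoodDeg khat + N.maxDeg := by field_simp
    rw [h1]
    refine mul_le_mul (mul_le_mul_of_nonneg_left ?_ (by positivity)) hlog hlog0.le (by positivity)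
    -- The summand c in the length of part two is simply dropped here.
    linarith [(Nat.cast_nonneg c : (0 : ℝ) ≤ c)]
  · refine le_trans ?_ (Nat.le_ceil _)
    gcongr
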